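/- Let $M$ be a smooth $4$-manifold with (possibly empty) boundary $\partial M$, Hausdorff and second countable, and let $\Lambda\in\mathbb R$. All metrics $g$ are smooth and Lorentzian, of signature $(-,+,+,+)$, and the induced metric $\bar g$ on $\partial M$ is Lorentzian, i.e. $\partial M$ is timelike; $\nu$ is the outward unit normal and $\nabla$ the Levi-Civita connection of $g$. For a smooth tensor field $Q^\alpha{}_{\beta\gamma}$ let $\widetilde\nabla_XY=\nabla_XY+Q(X,Y)$ be the corresponding general affine connection, with $Q(X,Y)^\alpha=Q^\alpha{}_{\beta\gamma}X^\beta Y^\gamma$; let $\widetilde R=g^{\beta\delta}\widetilde R^\alpha{}_{\beta\alpha\delta}$ be its scalar curvature and let $\widetilde K$ be the $\bar g$-trace of $\widetilde K_{\bar\alpha\bar\beta}=\tfrac12\,\jmath^\alpha_{\bar\alpha}\jmath^\beta_{\bar\beta}\big(\widetilde\nabla_\alpha\nu_\beta+g_{\alpha\gamma}\widetilde\nabla_\beta\nu^\gamma\big)$, where $\jmath:\partial M\hookrightarrow M$. The Palatini action with Obukhov boundary term is $$\mathbb S^{(m)}_{PT}(g,Q)=\int_M(\widetilde R-2\Lambda)\,\mathrm{vol}_g+2\int_{\partial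 M}\widetilde K\,\mathrm{vol}_{\bar g},$$ and the Einstein–Hilbert action with Gibbons–Hawking–York boundary term is $\mathbb S^{(m)}_{EH}(g)=\mathbb S^{(m)}_{PT}(g,0)$. For a cotetrad $e^I$ (four smooth $1$-forms such that $g_{\alpha\beta}=\eta_{IJ}e^I_\alpha e^J_\beta$ is a metric as above, with dual tetrad $E_I$ and $\eta=\mathrm{diag}(-1,1,1,1)$) and arbitrary smooth $1$-forms $\widetilde\omega^{IJ}$, let $\omega_\mu{}^K{}_J=e^K_\alpha\nabla_\mu E^\alpha_J$ be the Levi-Civita spin connection and put $Q^\beta{}_{\mu\alpha}=E^\beta_Ke^J_\alpha(\widetilde\omega_\mu{}^K{}_J-\omega_\mu{}^K{}_J)$, internal indices being raised and lowered with $\eta$. Define the tetrad actions by substitution: $\mathbb S^{(t)}_{PT}(e,\widetilde\omega)=\mathbb S^{(m)}_{PT}(g,Q)$ and $\mathbb S^{(t)}_{EH}(e)=\mathbb S^{(m)}_{EH}(g)$. A solution of an action is a field configuration at which the first variation of the action vanishes for all smooth variations of the fields whose support is a compact subset of a coordinate chart domain and may meet $\partial M$ (the action being taken over a compact region of that domain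 containing the support). Under Neumann boundary conditions $(\mathcal N)$ the variations are otherwise unrestricted; under Dirichlet conditions $(\mathcal D)$ the variations of $g$ (respectively $e^I$) have vanishing pull-back to $\partial M$. For each of these two boundary conditions, the same one on both sides: 1. $\mathtt{Sol}(\mathbb S^{(m)}_{PT})=\{(g,Q)\mid g\in\mathtt{Sol}(\mathbb S^{(m)}_{EH}),\ Q^\alpha{}_{\beta\sigma}=\delta^\alpha_\sigma U_\beta\text{ for some }U\in\Omega^1(M)\}$. 2. $\mathtt{Sol}(\mathbb S^{(t)}_{PT})=\{(e,\widetilde\omega)\mid e\in\mathtt{Sol}(\mathbb S^{(t)}_{EH}),\ \widetilde\omega^{IJ}=\omega^{IJ}+\eta^{IJ}U\text{ for some }U\in\Omega^1(M)\}$, where $\omega$ is the Levi-Civita spin connection of $e$. 3. For every solution of $\mathbb S^{(m)}_{PT}$ or of $\mathbb S^{(t)}_{PT}$, at every point of $M$ the torsion of $\widetilde\nabla$ vanishes if and only if its non-metricity $\widetilde\nabla_\alpha g_{\beta\gamma}$ vanishes; in particular, the torsion vanishes identically if and only if the non-metricity does. -/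

import Mathlib

open scoped Manifold ContDiff Bundle Matrix

noncomputable section

namespace Palatini

/-! ## Local coordinate expressions

Everything in this part is a function of the components of the fields in one coordinate chart
`(y⁰, y¹, y², y³)` of a 4-manifold with boundary; the chart takes values in the half-space `0 ≤ y⁰`
and the boundary is `y⁰ = 0`. -/

/-- The coordinate space. -/
abbrev E4 : Type := EuclideanSpace ℝ (Fin 4)

/-- Component functions of a metric: `G y a b = g_{ab}(y)`. -/
abbrev MetricComp : Type := E4 → Matrix (Fin 4) (Fin 4) ℝ

/-- Component functions with three indices: connection coefficients
`C y a b c = Γ^a_{bc}(y)`, with `∇_b ∂_c = Γ^a_{bc} ∂_a`, or a tensor `Q^a_{bc}`. -/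
abbrev ConnComp : Type := E4 → Fin 4 → Fin 4 → Fin 4 → ℝ

/-- The partial derivative `∂f/∂y^i`; at boundary points it is taken within the half-space. -/
def pd (i : Fin 4) (f : E4 → ℝ) (y : E4) : ℝ :=
  fderivWithin ℝ f (Set.range (𝓡∂ 4)) y (EuclideanSpace.single i 1)

/-- The Minkowski matrix `diag(-1, 1, …, 1)` of size `n + 1`. -/
def minkowski (n : ℕ) : Matrix (Fin (n + 1)) (Fin (n + 1)) ℝ :=
  Matrix.diagonal (Fin.cons (-1) fun _ => 1)

/-- `A` is the Gram matrix of a symmetric nondegenerate form of signature `(-, +, …, +)`. -/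
def IsLorentzian {n : ℕ} (A : Matrix (Fin (n + 1)) (Fin (n + 1)) ℝ) : Prop :=
  ∃ P : Matrix (Fin (n + 1)) (Fin (n + 1)) ℝ, IsUnit P.det ∧ Pᵀ * A * P = minkowski n

/-- The components of the pull-back of the metric to the boundary `y⁰ = 0`. -/
def inducedMetric (G : MetricComp) (y : E4) : Matrix (Fin 3) (Fin 3) ℝ :=
  (G y).submatrix Fin.succ Fin.succ

/-- The Levi-Civita connection coefficients (Christoffel symbols) of `G`. -/
def christoffel (G : MetricComp) : ConnComp := fun y a b c =>
  (1 / 2) * ∑ d, (G y)⁻¹ a d *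
    (pd b (fun z => G z d c) y + pd c (fun z => G z d b) y - pd d (fun z => G z b c) y)

/-- The coefficients of the connection `∇̃ = ∇ + Q`, with `∇` the Levi-Civita connection:
`∇̃_X Y = ∇_X Y + Q(X, Y)`. -/
def connection (G : MetricComp) (Q : ConnComp) : ConnComp := fun y a b c =>
  christoffel G y a b c + Q y a b c

/-- The curvature `R^a_{bcd}` of a connection,
`(R(X, Y) Z)^a = R^a_{bcd} Z^b X^c Y^d` with `R(X, Y) = ∇_X ∇_Y - ∇_Y ∇_X - ∇_{[X, Y]}`. -/
def riemann (C : ConnComp) (y : E4) (a b c d : Fin 4) : ℝ :=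
  pd c (fun z => C z a d b) y - pd d (fun z => C z a c b) y
    + ∑ l, (C y a c l * C y l d b - C y a d l * C y l c b)

/-- The Ricci tensor `R_{bd} = R^a_{bad}` of a connection. -/
def ricci (C : ConnComp) (y : E4) (b d : Fin 4) : ℝ := ∑ a, riemann C y a b a d

/-- The scalar curvature `g^{bd} R_{bd}` of a metric and a connection. -/
def scalarCurvature (G : MetricComp) (C : ConnComp) (y : E4) : ℝ :=
  ∑ b, ∑ d, (G y)⁻¹ b d * ricci C y b d

/-- The torsion `T^a_{bc}` of a connection, `T(X, Y) = ∇_X Y - ∇_Y X - [X, Y]`. -/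
def torsion (C : ConnComp) (y : E4) (a b c : Fin 4) : ℝ := C y a b c - C y a c b

/-- The non-metricity `M_{abc} = ∇_a g_{bc}` of a connection. -/
def nonmetricity (G : MetricComp) (C : ConnComp) (y : E4) (a b c : Fin 4) : ℝ :=
  pd a (fun z => G z b c) y - ∑ l, C y l a b * G y l c - ∑ l, C y l a c * G y b l

/-- The outward unit normal vector `ν^a` of the boundary `y⁰ = 0` of the half-space `0 ≤ y⁰`
(when the boundary is timelike, so that `g^{00} > 0`). -/
def normalUp (G : MetricComp) (y : E4) (a : Fin 4) : ℝ :=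
  -((G y)⁻¹ a 0) / Real.sqrt ((G y)⁻¹ 0 0)

/-- The outward unit conormal `ν_a = g_{ab} ν^b`. -/
def normalDown (G : MetricComp) (y : E4) (a : Fin 4) : ℝ := ∑ b, G y a b * normalUp G y b

/-- The generalised extrinsic curvature
`½ (∇̃_a ν_b + g_{ac} ∇̃_b ν^c)` of the boundary, for `a`, `b` tangent to it. For the Levi-Civita
connection it is the usual extrinsic curvature `∇_a ν_b`. -/
def extrinsic (G : MetricComp) (C : ConnComp) (y : E4) (a b : Fin 3) : ℝ :=
  (1 / 2) *
    ((pd a.succ (fun z => normalDown G z b.succ) y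
        - ∑ c, C y c a.succ b.succ * normalDown G y c)
      + ∑ c, G y a.succ c *
          (pd b.succ (fun z => normalUp G z c) y + ∑ l, C y c b.succ l * normalUp G y l))

/-- The trace of the extrinsic curvature with respect to the induced metric. -/
def extrinsicTrace (G : MetricComp) (C : ConnComp) (y : E4) : ℝ :=
  ∑ a, ∑ b, (inducedMetric G y)⁻¹ a b * extrinsic G C y a b

/-- The bulk Lagrangian `(R̃ - 2Λ) vol_g`, as a density in the coordinates. -/
def bulkLagrangian (Λ : ℝ) (G : MetricComp) (C : ConnComp) (y : E4) : ℝ :=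
  (scalarCurvature G C y - 2 * Λ) * Real.sqrt |(G y).det|

/-- The boundary Lagrangian `-2 K̃ vol_ḡ`, as a density in the boundary coordinates. -/
def boundaryLagrangian (G : MetricComp) (C : ConnComp) (y : E4) : ℝ :=
  -2 * extrinsicTrace G C y * Real.sqrt |(inducedMetric G y).det|

/-- The boundary point `(0, z¹, z², z³)` of the half-space. -/
def boundaryPoint (z : EuclideanSpace ℝ (Fin 3)) : E4 := WithLp.toLp 2 (Fin.cons 0 z.ofLp)

/-- The action `∫_K L - ∫_{K ∩ ∂} ℓ` of the Lagrangian pair `(L, ℓ)` over the region `K` of the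
half-space. -/
def action (L ℓ : E4 → ℝ) (K : Set E4) : ℝ :=
  (∫ y in K, L y) - ∫ z in {z | boundaryPoint z ∈ K}, ℓ (boundaryPoint z)

/-- The Palatini action with Obukhov's boundary term, in the variables `(g, Q)`. -/
def palatiniAction (Λ : ℝ) (G : MetricComp) (Q : ConnComp) (K : Set E4) : ℝ :=
  action (bulkLagrangian Λ G (connection G Q)) (boundaryLagrangian G (connection G Q)) K

/-- The Einstein-Hilbert action with the Gibbons-Hawking-York boundary term:
`∫ (R - 2Λ) vol_g + 2 ∫_∂ K vol_ḡ` for the Levi-Civita connection. -/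
def einsteinHilbertAction (Λ : ℝ) (G : MetricComp) (K : Set E4) : ℝ :=
  action (bulkLagrangian Λ G (christoffel G)) (boundaryLagrangian G (christoffel G)) K

/-- Components of a cotetrad: `e y I a = e^I_a(y)`. -/
abbrev TetradComp : Type := E4 → Matrix (Fin 4) (Fin 4) ℝ

/-- Components of a spin connection: `w y I J a = ω_a^{IJ}(y)`. -/
abbrev SpinComp : Type := E4 → Fin 4 → Fin 4 → Fin 4 → ℝ

/-- The metric `g_{ab} = η_{IJ} e^I_a e^J_b`. -/
def tetradMetric (e : TetradComp) : MetricComp := fun y => (e y)ᵀ * minkowski 3 * e y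

/-- The Levi-Civita spin connection `ω_m^K_J = e^K_a ∇_m E^a_J`, with `E` the dual tetrad; the
index `J` is raised with `η`, so this is `ω_m^{KJ}`. -/
def spinLC (e : TetradComp) : SpinComp := fun y K J m =>
  ∑ I, (∑ a, e y K a * (pd m (fun z => (e z)⁻¹ a I) y
      + ∑ b, christoffel (tetradMetric e) y a m b * (e y)⁻¹ b I)) * minkowski 3 I J

/-- The tensor `Q^b_{ma} = E^b_K e^J_a (ω̃_m^K_J - ω_m^K_J)` of a cotetrad and a spin connection. -/
def tetradQ (e : TetradComp) (w : SpinComp) : ConnComp := fun y b m a =>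
  ∑ K, ∑ J, (e y)⁻¹ b K * e y J a * ∑ L, (w y K L m - spinLC e y K L m) * minkowski 3 L J

/-! ## Fields on the manifold -/

variable (M : Type*) [TopologicalSpace M] [ChartedSpace (EuclideanHalfSpace 4) M]
  [IsManifold (𝓡∂ 4) ∞ M]

/-- Smooth 1-forms on `M`. -/
abbrev OneForm : Type _ :=
  ContMDiffSection (𝓡∂ 4) (E4 →L[ℝ] ℝ) ∞
    (fun x : M => TangentSpace (𝓡∂ 4) x →L[ℝ] ℝ)

/-- Smooth covariant 2-tensors on `M`. -/
abbrev CovTensor : Type _ :=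
  ContMDiffSection (𝓡∂ 4) (E4 →L[ℝ] E4 →L[ℝ] ℝ) ∞
    (fun x : M => TangentSpace (𝓡∂ 4) x →L[ℝ] TangentSpace (𝓡∂ 4) x →L[ℝ] ℝ)

/-- Smooth tensors `Q^a_{bc}` on `M`: `Q x X Y` is the vector `Q^a_{bc} X^b Y^c`. -/
abbrev MixedTensor : Type _ :=
  ContMDiffSection (𝓡∂ 4) (E4 →L[ℝ] E4 →L[ℝ] E4) ∞
    (fun x : M =>
      TangentSpace (𝓡∂ 4) x →L[ℝ] TangentSpace (𝓡∂ 4) x →L[ℝ] TangentSpace (𝓡∂ 4) x)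

variable {M}

/-- The coordinate vector field `∂/∂y^i` of the preferred chart at `p`, at the point with coordinates
`y`. (The trivialization of the tangent bundle at `p` is the differential of that chart.) -/
def coordFrame (p : M) (y : E4) (i : Fin 4) :
    TangentSpace (𝓡∂ 4) ((extChartAt (𝓡∂ 4) p).symm y) :=
  (trivializationAt E4 (TangentSpace (𝓡∂ 4) : M → Type) p).symmL ℝ _
    (EuclideanSpace.single i (1 : ℝ))

/-- The components `θ_i` of a 1-form in the chart at `p`. -/
def formComp (θ : OneForm M) (p : M) (y : E4) (i : Fin 4) : ℝ :=
  θ ((extChartAt (𝓡∂ 4) p).symm y) (coordFrame p y i)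

/-- The components `h_{ij}` of a covariant 2-tensor in the chart at `p`. -/
def covComp (h : CovTensor M) (p : M) : MetricComp := fun y =>
  Matrix.of fun i j => h ((extChartAt (𝓡∂ 4) p).symm y) (coordFrame p y i) (coordFrame p y j)

/-- The components `Q^i_{jk}` of a mixed tensor in the chart at `p`. -/
def mixedComp (Q : MixedTensor M) (p : M) : ConnComp := fun y i j k =>
  ((trivializationAt E4 (TangentSpace (𝓡∂ 4) : M → Type) p).continuousLinearMapAt ℝ
    ((extChartAt (𝓡∂ 4) p).symm y)
    (Q ((extChartAt (𝓡∂ 4) p).symm y) (coordFrame p y j) (coordFrame p y k))) i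

/-- The components of a family of four 1-forms `e^I` in the chart at `p`. -/
def tetradComp (e : Fin 4 → OneForm M) (p : M) : TetradComp := fun y =>
  Matrix.of fun I i => formComp (e I) p y i

/-- The components of a family of 1-forms `ω^{IJ}` in the chart at `p`. -/
def spinComp (w : Fin 4 → Fin 4 → OneForm M) (p : M) : SpinComp := fun y I J i =>
  formComp (w I J) p y i

/-- The components `G p` (`p : M`) in all charts are those of a Lorentzian metric on `M` for which
the boundary of `M` is timelike. -/
def IsSpacetimeMetric (G : M → MetricComp) : Prop :=
  ∀ p : M, ∀ y ∈ (extChartAt (𝓡∂ 4) p).target,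
    IsLorentzian (G p y) ∧ (y 0 = 0 → IsLorentzian (inducedMetric (G p) y))

/-- The two kinds of boundary conditions: free (`neumann`), or the pull-back to the boundary of the
metric or the cotetrad is kept fixed (`dirichlet`). -/
inductive BoundaryCondition where
  | neumann
  | dirichlet

/-- `h` is an admissible variation of a metric. -/
def IsMetricVariation : BoundaryCondition → CovTensor M → Prop
  | .neumann, h => ∀ (x : M) (X Y : TangentSpace (𝓡∂ 4) x), h x X Y = h x Y X
  | .dirichlet, h => (∀ (x : M) (X Y : TangentSpace (𝓡∂ 4) x), h x X Y = h x Y X) ∧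
      ∀ p : M, ∀ y ∈ (extChartAt (𝓡∂ 4) p).target, y 0 = 0 →
        ∀ a b : Fin 3, covComp h p y a.succ b.succ = 0

/-- `f` is an admissible variation of a cotetrad. -/
def IsTetradVariation : BoundaryCondition → (Fin 4 → OneForm M) → Prop
  | .neumann, _ => True
  | .dirichlet, f => ∀ p : M, ∀ y ∈ (extChartAt (𝓡∂ 4) p).target, y 0 = 0 →
      ∀ (I : Fin 4) (a : Fin 3), tetradComp f p y I a.succ = 0

/-- Let `s` assign to each parameter `t`, point `p` and region `K` of the half-space the value over
`K` of the action of the fields at parameter `t`, computed in the chart at `p`. Let the fields depend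
on `t` only at the points of `S ⊆ M`. The first variation of the action vanishes if the derivative
at `t = 0` of the action over any compact region of any chart that contains `S` is zero. -/
def FirstVariationVanishes (s : ℝ → M → Set E4 → ℝ) (S : Set M) : Prop :=
  ∀ (p : M) (K : Set M), IsCompact K → K ⊆ (chartAt (EuclideanHalfSpace 4) p).source → S ⊆ K →
    HasDerivAt (fun t => s t p (extChartAt (𝓡∂ 4) p '' K)) 0 0

/-- The solutions `(g, Q)` for the Palatini action: the stationary points under all variations
`(h, q)` of `(g, Q)` that are supported in a compact subset of a chart domain (which may meet the
boundary) and obey the boundary condition. -/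
def solPalatini (bc : BoundaryCondition) (Λ : ℝ) : Set (CovTensor M × MixedTensor M) :=
  {φ | IsSpacetimeMetric (covComp φ.1) ∧
    ∀ (h : CovTensor M) (q : MixedTensor M), IsMetricVariation bc h →
      FirstVariationVanishes
        (fun t p => palatiniAction Λ (covComp φ.1 p + t • covComp h p)
          (mixedComp φ.2 p + t • mixedComp q p))
        {x | h x ≠ 0 ∨ q x ≠ 0}}

/-- The solutions for the Einstein-Hilbert action with the Gibbons-Hawking-York boundary term. -/
def solEinsteinHilbert (bc : BoundaryCondition) (Λ : ℝ) : Set (CovTensor M) :=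
  {g | IsSpacetimeMetric (covComp g) ∧
    ∀ h : CovTensor M, IsMetricVariation bc h →
      FirstVariationVanishes (fun t p => einsteinHilbertAction Λ (covComp g p + t • covComp h p))
        {x | h x ≠ 0}}

/-- The solutions `(e, ω̃)`, `ω̃ = (ω̃^{IJ})`, for the tetrad form of the Palatini action. -/
def solPalatiniTetrad (bc : BoundaryCondition) (Λ : ℝ) :
    Set ((Fin 4 → OneForm M) × (Fin 4 → Fin 4 → OneForm M)) :=
  {φ | IsSpacetimeMetric (fun p => tetradMetric (tetradComp φ.1 p)) ∧
    ∀ (f : Fin 4 → OneForm M) (u : Fin 4 → Fin 4 → OneForm M), IsTetradVariation bc f →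
      FirstVariationVanishes
        (fun t p => palatiniAction Λ (tetradMetric (tetradComp φ.1 p + t • tetradComp f p))
          (tetradQ (tetradComp φ.1 p + t • tetradComp f p)
            (spinComp φ.2 p + t • spinComp u p)))
        {x | ∃ I J, f I x ≠ 0 ∨ u I J x ≠ 0}}

/-- The solutions for the tetrad form of the Einstein-Hilbert action with the Gibbons-Hawking-York
boundary term. -/
def solEinsteinHilbertTetrad (bc : BoundaryCondition) (Λ : ℝ) : Set (Fin 4 → OneForm M) :=
  {e | IsSpacetimeMetric (fun p => tetradMetric (tetradComp e p)) ∧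
    ∀ f : Fin 4 → OneForm M, IsTetradVariation bc f →
      FirstVariationVanishes
        (fun t p => einsteinHilbertAction Λ (tetradMetric (tetradComp e p + t • tetradComp f p)))
        {x | ∃ I, f I x ≠ 0}}

/-- At every point of `M`, the connection `∇̃ = ∇ + Q` has vanishing torsion if and only if it has
vanishing non-metricity; `G p`, `Q p` are the components in the chart at `p`. -/
def TorsionFreeIffMetric (G : M → MetricComp) (Q : M → ConnComp) : Prop :=
  ∀ p : M, ∀ y ∈ (extChartAt (𝓡∂ 4) p).target,
    (∀ a b c, torsion (connection (G p) (Q p)) y a b c = 0) ↔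
      ∀ a b c, nonmetricity (G p) (connection (G p) (Q p)) y a b c = 0

end Palatini

end

/-!
# Equivalence of the Palatini and the Einstein-Hilbert action on manifolds with boundary

Write `∇̃ = ∇ + Q` with `∇` the Levi-Civita connection of `g`. In a chart, the scalar curvature of
`∇̃` is `R̃ = R + ∇_a V^a + B(Q, Q)`, with `V^a = g^{bd} Q^a_{db} - g^{ba} Q^l_{lb}` and `B` the
quadratic form `quadForm` (`bulkLagrangian_sub`). Obukhov's boundary term differs from the
Gibbons-Hawking-York term by minus the outward flux of `V` (`boundaryLagrangian_sub`), so by the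
divergence theorem in the half-space (`integral_divergence`) the Palatini and the Einstein-Hilbert
action differ by `∫ B(Q, Q) vol_g`, up to a term that does not change under variations of compact
support (`palatiniAction_sub_eq_of_eqOn`). As the boundary terms match exactly, nothing is required
of the variations at the boundary.

Hence stationarity in `Q` says that the polar form of `B` annihilates `Q` at every point, boundary
points included (`polar_eq_zero_of_stationary`), and linear algebra shows that the kernel of `B`
consists of the tensors `δ^a_c U_b` (`eq_pureTrace_of_polar_eq_zero`). Conversely, `δ ⊗ U` is in the
kernel of `B` for every metric. So if `Q` has this form at `t = 0`, then along any variation of the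
fields `∫ B(Q, Q) vol_g = O(t²)`, and the two actions have the same first variation
(`hasDerivAt_integral_quadLagrangian`). This gives the description of the solutions for either
boundary condition.

For tetrads, `ω̃ ↦ Q` is an affine bijection at each point that takes `ω + η U` to `δ ⊗ U`; since
`ω` is trace-free (`trace_spinLC`), `U = ¼ η_{IJ} ω̃^{IJ}` is smooth. As `Q` now depends on `t`
through the tetrad as well, the estimate `Q = δ ⊗ U + O(t)` needs uniform bounds on the Levi-Civita
spin connection along the variation; they are supplied by the calculus of families that are
Lipschitz at `t = 0` (`LipAtZero`).

Finally, for the connection `∇ + δ ⊗ U` the torsion is `U_b δ^a_c - U_c δ^a_b` and the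
non-metricity is `-2 U_a g_{bc}`; each vanishes at a point if and only if `U` does.
-/

open scoped Manifold ContDiff Bundle Matrix

noncomputable section

namespace Palatini

/-! ### Calculus in the half-space -/

/-- The coordinate half-space `0 ≤ y⁰`. -/
abbrev halfSpace : Set E4 := Set.range (𝓡∂ 4)

/-- `T` is a relatively open subset of the half-space. -/
structure IsRelOpen (T : Set E4) : Prop where
  subset : T ⊆ halfSpace
  mem_nhds : ∀ y ∈ T, T ∈ nhdsWithin y halfSpace

lemma mem_halfSpace {y : E4} : y ∈ halfSpace ↔ 0 ≤ y 0 := by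
  rw [halfSpace, range_modelWithCornersEuclideanHalfSpace]; rfl

lemma uniqueDiffOn_halfSpace : UniqueDiffOn ℝ halfSpace := (𝓡∂ 4).uniqueDiffOn

lemma IsRelOpen.exists_isOpen {T : Set E4} (hT : IsRelOpen T) :
    ∃ O : Set E4, IsOpen O ∧ T = halfSpace ∩ O := by
  have : ∀ y : T, ∃ O : Set E4, IsOpen O ∧ (y : E4) ∈ O ∧ O ∩ halfSpace ⊆ T := fun y => by
    obtain ⟨O, hO, hy, hs⟩ := mem_nhdsWithin.1 (hT.mem_nhds y y.2)
    exact ⟨O, hO, hy, hs⟩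
  choose O hO hy hs using this
  refine ⟨⋃ y, O y, isOpen_iUnion hO, Set.Subset.antisymm (fun y h => ⟨hT.subset h, ?_⟩) ?_⟩
  · exact Set.mem_iUnion.2 ⟨⟨y, h⟩, hy ⟨y, h⟩⟩
  · rintro y ⟨h1, h2⟩
    obtain ⟨z, hz⟩ := Set.mem_iUnion.1 h2
    exact hs z ⟨hz, h1⟩

lemma isRelOpen_inter {O : Set E4} (hO : IsOpen O) : IsRelOpen (halfSpace ∩ O) :=
  ⟨Set.inter_subset_left, fun _ hy =>
    Filter.inter_mem self_mem_nhdsWithin (nhdsWithin_le_nhds (hO.mem_nhds hy.2))⟩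

/-- The points of a relatively open set outside a closed set. -/
lemma IsRelOpen.diff {T K : Set E4} (hT : IsRelOpen T) (hK : IsClosed K) : IsRelOpen (T \ K) := by
  obtain ⟨O, hO, rfl⟩ := hT.exists_isOpen
  rw [Set.sdiff_eq, Set.inter_assoc]
  exact isRelOpen_inter (hO.inter hK.isOpen_compl)

lemma IsRelOpen.sep_pos {T : Set E4} (hT : IsRelOpen T) {f : E4 → ℝ} (hf : ContinuousOn f T) :
    IsRelOpen {y ∈ T | 0 < f y} := by
  refine ⟨fun y hy => hT.subset hy.1, fun y hy => ?_⟩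
  have h1 := hf y hy.1
  have h2 : ∀ᶠ z in nhdsWithin y T, 0 < f z := h1.eventually (lt_mem_nhds hy.2)
  have h3 : nhdsWithin y halfSpace ≤ nhdsWithin y T :=
    nhdsWithin_le_iff.2 (hT.mem_nhds y hy.1)
  exact Filter.inter_mem (hT.mem_nhds y hy.1) (h3 h2)

section
variable {T : Set E4} {f g : E4 → ℝ} {y : E4}

lemma IsRelOpen.differentiableWithinAt (hT : IsRelOpen T) (hf : ContDiffOn ℝ ∞ f T)
    (hy : y ∈ T) :
    DifferentiableWithinAt ℝ f halfSpace y :=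
  ((hf y hy).differentiableWithinAt (by simp)).mono_of_mem_nhdsWithin (hT.mem_nhds y hy)

lemma IsRelOpen.contDiffOn_pd (hT : IsRelOpen T) (hf : ContDiffOn ℝ ∞ f T) (i : Fin 4) :
    ContDiffOn ℝ ∞ (pd i f) T := by
  intro y hy
  have h1 : ContDiffWithinAt ℝ ∞ f halfSpace y :=
    (hf y hy).mono_of_mem_nhdsWithin (hT.mem_nhds y hy)
  have h2 := h1.fderivWithin_right (m := ∞) uniqueDiffOn_halfSpace (by simp) (hT.subset hy)
  exact (h2.clm_apply contDiffWithinAt_const).mono hT.subset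

lemma IsRelOpen.pd_congr (hT : IsRelOpen T) (h : Set.EqOn f g T) (hy : y ∈ T) (i : Fin 4) :
    pd i f y = pd i g y := by
  unfold pd
  rw [Filter.EventuallyEq.fderivWithin_eq (Filter.mem_of_superset (hT.mem_nhds y hy) h) (h hy)]

lemma pd_const (c : ℝ) (i : Fin 4) : pd i (fun _ => c) y = 0 := by
  simp [pd]

variable (hT : IsRelOpen T) (hy : y ∈ T) (i : Fin 4)
include hT hy

lemma pd_add (hf : ContDiffOn ℝ ∞ f T) (hg : ContDiffOn ℝ ∞ g T) :
    pd i (fun z => f z + g z) y = pd i f y + pd i g y := by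
  unfold pd
  rw [fderivWithin_fun_add (uniqueDiffOn_halfSpace y (hT.subset hy))
    (hT.differentiableWithinAt hf hy) (hT.differentiableWithinAt hg hy)]
  rfl

lemma pd_sub (hf : ContDiffOn ℝ ∞ f T) (hg : ContDiffOn ℝ ∞ g T) :
    pd i (fun z => f z - g z) y = pd i f y - pd i g y := by
  unfold pd
  rw [fderivWithin_fun_sub (uniqueDiffOn_halfSpace y (hT.subset hy))
    (hT.differentiableWithinAt hf hy) (hT.differentiableWithinAt hg hy)]
  rfl

lemma pd_mul (hf : ContDiffOn ℝ ∞ f T) (hg : ContDiffOn ℝ ∞ g T) :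
    pd i (fun z => f z * g z) y = pd i f y * g y + f y * pd i g y := by
  unfold pd
  rw [fderivWithin_fun_mul (uniqueDiffOn_halfSpace y (hT.subset hy))
    (hT.differentiableWithinAt hf hy) (hT.differentiableWithinAt hg hy)]
  simp only [add_apply, smul_apply, smul_eq_mul]
  ring

lemma pd_const_mul (c : ℝ) (hf : ContDiffOn ℝ ∞ f T) :
    pd i (fun z => c * f z) y = c * pd i f y := by
  rw [pd_mul hT hy i contDiffOn_const hf, pd_const]; ring

lemma pd_sum {ι : Type*} (s : Finset ι) {F : ι → E4 → ℝ}
    (hF : ∀ j ∈ s, ContDiffOn ℝ ∞ (F j) T) :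
    pd i (fun z => ∑ j ∈ s, F j z) y = ∑ j ∈ s, pd i (F j) y := by
  unfold pd
  rw [fderivWithin_fun_sum (uniqueDiffOn_halfSpace y (hT.subset hy))
    fun j hj => hT.differentiableWithinAt (hF j hj) hy]
  exact sum_apply _ _ _

lemma pd_sqrt (hf : ContDiffOn ℝ ∞ f T) (hpos : ∀ z ∈ T, 0 < f z) :
    pd i (fun z => √(f z)) y = pd i f y / (2 * √(f y)) := by
  unfold pd
  rw [fderivWithin_sqrt (hT.differentiableWithinAt hf hy) (hpos y hy).ne'
    (uniqueDiffOn_halfSpace y (hT.subset hy))]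
  simp only [smul_apply, smul_eq_mul]
  ring

end

/-! ### Matrix-valued functions -/

/-- The entries of the matrix-valued function `A` are smooth on `T`. -/
def MatSmoothOn {n m : Type*} (A : E4 → Matrix n m ℝ) (T : Set E4) : Prop :=
  ∀ i j, ContDiffOn ℝ ∞ (fun y => A y i j) T

/-- The entrywise partial derivative of a matrix-valued function. -/
def pdMat {n m : Type*} (i : Fin 4) (A : E4 → Matrix n m ℝ) (y : E4) : Matrix n m ℝ :=
  Matrix.of fun a b => pd i (fun z => A z a b) y

section
variable {n : Type*} [Fintype n] [DecidableEq n] {T : Set E4} {A B : E4 → Matrix n n ℝ} {y : E4}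

omit [DecidableEq n] in
lemma MatSmoothOn.mul (hA : MatSmoothOn A T) (hB : MatSmoothOn B T) :
    MatSmoothOn (fun y => A y * B y) T := fun i j => by
  simp only [Matrix.mul_apply]
  exact ContDiffOn.sum fun k _ => (hA i k).mul (hB k j)

lemma MatSmoothOn.det (hA : MatSmoothOn A T) : ContDiffOn ℝ ∞ (fun y => (A y).det) T := by
  simp only [Matrix.det_apply, Units.smul_def, zsmul_eq_mul]
  exact ContDiffOn.sum fun σ _ => contDiffOn_const.mul (contDiffOn_prod fun i _ => hA _ _)

lemma MatSmoothOn.adjugate (hA : MatSmoothOn A T) : MatSmoothOn (fun y => (A y).adjugate) T := by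
  intro i j
  simp only [Matrix.adjugate_apply]
  refine MatSmoothOn.det (A := fun y => (A y).updateRow j (Pi.single i 1)) fun a b => ?_
  by_cases h : a = j
  · subst h; simp only [Matrix.updateRow_self]; exact contDiffOn_const
  · simp only [Matrix.updateRow_ne h]; exact hA a b

lemma MatSmoothOn.inv (hA : MatSmoothOn A T) (h : ∀ y ∈ T, (A y).det ≠ 0) :
    MatSmoothOn (fun y => (A y)⁻¹) T := by
  intro i j
  simp only [Matrix.inv_def, Ring.inverse_eq_inv', Matrix.smul_apply, smul_eq_mul]
  exact (hA.det.inv h).mul (hA.adjugate i j)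

variable (hT : IsRelOpen T) (hy : y ∈ T) (i : Fin 4)
include hT hy

omit [DecidableEq n] in
lemma pdMat_mul (hA : MatSmoothOn A T) (hB : MatSmoothOn B T) :
    pdMat i (fun z => A z * B z) y = pdMat i A y * B y + A y * pdMat i B y := by
  ext a b
  simp only [pdMat, Matrix.of_apply, Matrix.mul_apply, Matrix.add_apply]
  rw [pd_sum hT hy i _ fun k _ => (hA a k).mul (hB k b), ← Finset.sum_add_distrib]
  exact Finset.sum_congr rfl fun k _ => pd_mul hT hy i (hA a k) (hB k b)

lemma pdMat_inv (hA : MatSmoothOn A T) (h : ∀ y ∈ T, (A y).det ≠ 0) :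
    pdMat i (fun z => (A z)⁻¹) y = -((A y)⁻¹ * pdMat i A y * (A y)⁻¹) := by
  have h1 := pdMat_mul hT hy i hA (hA.inv h)
  have h2 : pdMat i (fun z => A z * (A z)⁻¹) y = 0 := by
    ext a b
    rw [pdMat, Matrix.of_apply, hT.pd_congr (g := fun _ => (1 : Matrix n n ℝ) a b) _ hy, pd_const]
    · rfl
    · intro z hz
      show (A z * (A z)⁻¹) a b = _
      rw [Matrix.mul_nonsing_inv _ (h z hz).isUnit]
  rw [h2] at h1
  have h3 : (A y)⁻¹ * (A y * pdMat i (fun z => (A z)⁻¹) y) = pdMat i (fun z => (A z)⁻¹) y := by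
    rw [← Matrix.mul_assoc, Matrix.nonsing_inv_mul _ (h y hy).isUnit, Matrix.one_mul]
  rw [← h3, eq_neg_of_add_eq_zero_right h1.symm]
  simp only [Matrix.mul_neg, Matrix.mul_assoc]

/-- Jacobi's formula. -/
lemma pd_det (hA : MatSmoothOn A T) :
    pd i (fun z => (A z).det) y = ((A y).adjugate * pdMat i A y).trace := by
  have h1 : pd i (fun z => (A z).det) y =
      ∑ k, ((A y).updateCol k fun a => pdMat i A y a k).det := by
    simp only [Matrix.det_apply, Units.smul_def, zsmul_eq_mul]
    rw [pd_sum hT hy i _ fun σ _ => contDiffOn_const.mul (contDiffOn_prod fun i _ => hA _ _),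
      Finset.sum_comm]
    refine Finset.sum_congr rfl fun σ _ => ?_
    rw [pd_const_mul hT hy i _ (contDiffOn_prod fun i _ => hA _ _), ← Finset.mul_sum]
    congr 1
    unfold pd
    rw [fderivWithin_finsetProd (uniqueDiffOn_halfSpace y (hT.subset hy))
      fun k _ => hT.differentiableWithinAt (hA _ _) hy]
    simp only [sum_apply, smul_apply, smul_eq_mul]
    refine Finset.sum_congr rfl fun k _ => ?_
    rw [← Finset.prod_erase_mul _ _ (Finset.mem_univ k), Matrix.updateCol_self]
    congr 1
    refine Finset.prod_congr rfl fun l hl => ?_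
    rw [Matrix.updateCol_ne (Finset.ne_of_mem_erase hl)]
  rw [h1, Matrix.trace]
  refine Finset.sum_congr rfl fun k _ => ?_
  rw [← Matrix.cramer_apply, Matrix.cramer_eq_adjugate_mulVec]
  rfl

end

/-! ### The quadratic form of the difference tensor -/

/-- The bilinear form `g^{bd} (Q^a_{al} q^l_{db} - Q^a_{dl} q^l_{ab})`, for `gi` the inverse of the
metric. On the diagonal it is the part of the scalar curvature of `∇ + Q` quadratic in `Q`. -/
def quadForm (gi : Matrix (Fin 4) (Fin 4) ℝ) (Q q : Fin 4 → Fin 4 → Fin 4 → ℝ) : ℝ :=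
  ∑ b, ∑ d, gi b d * ∑ a, ∑ l, (Q a a l * q l d b - Q a d l * q l a b)

/-- The tensor `δ^a_c U_b`. -/
def pureTrace (U : Fin 4 → ℝ) : Fin 4 → Fin 4 → Fin 4 → ℝ := fun a b c =>
  if a = c then U b else 0

/-- The gradient of `Q ↦ quadForm gi Q Q`. -/
def quadGrad (gi : Matrix (Fin 4) (Fin 4) ℝ) (Q : Fin 4 → Fin 4 → Fin 4 → ℝ) :
    Fin 4 → Fin 4 → Fin 4 → ℝ := fun x y z =>
  (if x = y then ∑ b, ∑ d, gi b d * Q z d b else 0) + gi z y * ∑ a, Q a a x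
    - ∑ b, gi b y * Q z x b - ∑ d, gi z d * Q y d x

section
variable {gi : Matrix (Fin 4) (Fin 4) ℝ} {Q q r : Fin 4 → Fin 4 → Fin 4 → ℝ}

lemma quadForm_add_left : quadForm gi (Q + r) q = quadForm gi Q q + quadForm gi r q := by
  simp only [quadForm, ← Finset.sum_add_distrib, ← mul_add, Pi.add_apply]
  simp only [add_mul, sub_eq_add_neg, neg_add]
  refine Finset.sum_congr rfl fun b _ => Finset.sum_congr rfl fun d _ => ?_
  congr 1
  refine Finset.sum_congr rfl fun a _ => Finset.sum_congr rfl fun l _ => ?_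
  ring

lemma quadForm_add_right : quadForm gi Q (q + r) = quadForm gi Q q + quadForm gi Q r := by
  simp only [quadForm, ← Finset.sum_add_distrib, ← mul_add, Pi.add_apply]
  refine Finset.sum_congr rfl fun b _ => Finset.sum_congr rfl fun d _ => ?_
  congr 1
  refine Finset.sum_congr rfl fun a _ => Finset.sum_congr rfl fun l _ => ?_
  ring

lemma quadForm_smul_left (t : ℝ) : quadForm gi (t • Q) q = t * quadForm gi Q q := by
  simp only [quadForm, Finset.mul_sum, Pi.smul_apply, smul_eq_mul]
  refine Finset.sum_congr rfl fun b _ => Finset.sum_congr rfl fun d _ =>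
    Finset.sum_congr rfl fun a _ => Finset.sum_congr rfl fun l _ => ?_
  ring

lemma quadForm_smul_right (t : ℝ) : quadForm gi Q (t • q) = t * quadForm gi Q q := by
  simp only [quadForm, Finset.mul_sum, Pi.smul_apply, smul_eq_mul]
  refine Finset.sum_congr rfl fun b _ => Finset.sum_congr rfl fun d _ =>
    Finset.sum_congr rfl fun a _ => Finset.sum_congr rfl fun l _ => ?_
  ring

lemma quadForm_pureTrace_left (U : Fin 4 → ℝ) :
    quadForm gi (pureTrace U) q + quadForm gi q (pureTrace U) = 0 := by
  simp only [quadForm, pureTrace, ite_mul, zero_mul, mul_ite, mul_zero, Finset.sum_sub_distrib,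
    Finset.sum_ite_eq, Finset.mem_univ, if_true]
  have h2 : ∀ b d : Fin 4, (∑ a, ∑ l, if l = b then q a a l * U d else 0) = ∑ a, q a a b * U d :=
    fun b d => by simp
  have h3 : ∀ b d : Fin 4, (∑ a, ∑ l, if l = b then q a d l * U a else 0) = ∑ a, q a d b * U a :=
    fun b d => by simp
  simp only [h2, h3, ← Finset.sum_add_distrib, ← mul_add]
  refine Finset.sum_eq_zero fun b _ => Finset.sum_eq_zero fun d _ => ?_
  have h4 : ∀ p : Fin 4 → ℝ, ∑ a, p a * U d = ∑ a, U d * p a := fun p =>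
    Finset.sum_congr rfl fun a _ => mul_comm _ _
  have h5 : ∑ a, q a d b * U a = ∑ a, U a * q a d b :=
    Finset.sum_congr rfl fun a _ => mul_comm _ _
  rw [h4, h5]
  ring

/-- The quadratic form only depends on `Q` modulo the tensors `δ^a_c U_b`. -/
lemma quadForm_pureTrace_add (U : Fin 4 → ℝ) :
    quadForm gi (pureTrace U + q) (pureTrace U + q) = quadForm gi q q := by
  have h1 := quadForm_pureTrace_left (gi := gi) (q := q) U
  have h2 := quadForm_pureTrace_left (gi := gi) (q := pureTrace U) U
  rw [quadForm_add_left, quadForm_add_right, quadForm_add_right]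
  linarith

lemma quadForm_polar : quadForm gi Q q + quadForm gi q Q =
    ∑ x, ∑ y, ∑ z, quadGrad gi Q x y z * q x y z := by
  have e1 : ∑ x, ∑ y, ∑ z, (if x = y then ∑ b, ∑ d, gi b d * Q z d b else 0) * q x y z =
      ∑ b, ∑ d, ∑ a, ∑ l, gi b d * (q a a l * Q l d b) := by
    simp only [ite_mul, zero_mul, Finset.sum_ite_irrel, Finset.sum_const_zero, Finset.sum_ite_eq,
      Finset.mem_univ, if_true, Finset.sum_mul]
    calc _ = ∑ x, ∑ b, ∑ z, ∑ d, gi b d * Q z d b * q x x z :=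
          Finset.sum_congr rfl fun x _ => Finset.sum_comm
      _ = ∑ b, ∑ x, ∑ z, ∑ d, gi b d * Q z d b * q x x z := Finset.sum_comm
      _ = ∑ b, ∑ x, ∑ d, ∑ z, gi b d * Q z d b * q x x z :=
          Finset.sum_congr rfl fun x _ => Finset.sum_congr rfl fun b _ => Finset.sum_comm
      _ = ∑ b, ∑ d, ∑ x, ∑ z, gi b d * Q z d b * q x x z :=
          Finset.sum_congr rfl fun x _ => Finset.sum_comm
      _ = _ := by simp only [mul_assoc, mul_comm (Q _ _ _)]
  have e2 : ∑ x, ∑ y, ∑ z, (gi z y * ∑ a, Q a a x) * q x y z =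
      ∑ b, ∑ d, ∑ a, ∑ l, gi b d * (Q a a l * q l d b) := by
    simp only [Finset.mul_sum, Finset.sum_mul]
    calc _ = ∑ y, ∑ x, ∑ z, ∑ a, gi z y * Q a a x * q x y z := Finset.sum_comm
      _ = ∑ y, ∑ z, ∑ x, ∑ a, gi z y * Q a a x * q x y z :=
          Finset.sum_congr rfl fun x _ => Finset.sum_comm
      _ = ∑ z, ∑ y, ∑ x, ∑ a, gi z y * Q a a x * q x y z := Finset.sum_comm
      _ = ∑ z, ∑ y, ∑ a, ∑ x, gi z y * Q a a x * q x y z :=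
          Finset.sum_congr rfl fun x _ => Finset.sum_congr rfl fun b _ => Finset.sum_comm
      _ = _ := by simp only [mul_assoc]
  have e3 : ∑ x, ∑ y, ∑ z, (∑ b, gi b y * Q z x b) * q x y z =
      ∑ b, ∑ d, ∑ a, ∑ l, gi b d * (q a d l * Q l a b) := by
    simp only [Finset.sum_mul]
    calc _ = ∑ x, ∑ y, ∑ b, ∑ z, gi b y * Q z x b * q x y z :=
          Finset.sum_congr rfl fun x _ => Finset.sum_congr rfl fun b _ => Finset.sum_comm
      _ = ∑ x, ∑ b, ∑ y, ∑ z, gi b y * Q z x b * q x y z :=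
          Finset.sum_congr rfl fun x _ => Finset.sum_comm
      _ = ∑ b, ∑ x, ∑ y, ∑ z, gi b y * Q z x b * q x y z := Finset.sum_comm
      _ = ∑ b, ∑ y, ∑ x, ∑ z, gi b y * Q z x b * q x y z :=
          Finset.sum_congr rfl fun x _ => Finset.sum_comm
      _ = _ := by simp only [mul_assoc, mul_comm (Q _ _ _)]
  have e4 : ∑ x, ∑ y, ∑ z, (∑ d, gi z d * Q y d x) * q x y z =
      ∑ b, ∑ d, ∑ a, ∑ l, gi b d * (Q a d l * q l a b) := by
    simp only [Finset.sum_mul]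
    calc _ = ∑ x, ∑ z, ∑ y, ∑ d, gi z d * Q y d x * q x y z :=
          Finset.sum_congr rfl fun x _ => Finset.sum_comm
      _ = ∑ z, ∑ x, ∑ y, ∑ d, gi z d * Q y d x * q x y z := Finset.sum_comm
      _ = ∑ z, ∑ x, ∑ d, ∑ y, gi z d * Q y d x * q x y z :=
          Finset.sum_congr rfl fun x _ => Finset.sum_congr rfl fun b _ => Finset.sum_comm
      _ = ∑ z, ∑ d, ∑ x, ∑ y, gi z d * Q y d x * q x y z :=
          Finset.sum_congr rfl fun x _ => Finset.sum_comm
      _ = ∑ z, ∑ d, ∑ y, ∑ x, gi z d * Q y d x * q x y z :=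
          Finset.sum_congr rfl fun x _ => Finset.sum_congr rfl fun b _ => Finset.sum_comm
      _ = _ := by simp only [mul_assoc]
  simp only [quadGrad, add_mul, sub_mul, Finset.sum_add_distrib, Finset.sum_sub_distrib]
  rw [e1, e2, e3, e4]
  simp only [quadForm, mul_sub, Finset.mul_sum, Finset.sum_sub_distrib]
  ring

/-- The stationary points of the quadratic form are the tensors `δ^a_c U_b`. With all indices
lowered, stationarity reads `Q_{zxy} + Q_{yzx} = g_{yx} W_z + g_{zy} A_x`, where `W` and `A` are
traces of `Q`; the cyclic permutations of this equation determine `Q_{zxy}` in terms of the traces,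
and the trace of the result shows that `W = A`. -/
theorem eq_pureTrace_of_quadGrad_eq_zero {g : Matrix (Fin 4) (Fin 4) ℝ} (hg : g.IsSymm)
    (hdet : g.det ≠ 0) (h : ∀ x y z, quadGrad g⁻¹ Q x y z = 0) :
    Q = pureTrace fun b => ∑ a, Q a a b := by
  have hu : IsUnit g.det := hdet.isUnit
  set A : Fin 4 → ℝ := fun x => ∑ a, Q a a x with hA
  set W : Fin 4 → ℝ := fun z => ∑ b, ∑ d, g⁻¹ b d * Q z d b with hW
  set w : Fin 4 → ℝ := g *ᵥ W with hw
  set f : Fin 4 → Fin 4 → Fin 4 → ℝ := fun z x y => ∑ c, g z c * Q c x y with hf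
  -- `h` as a matrix equation in the indices `z`, `y`, lowered on both sides.
  have key : ∀ x z y, f z x y + f y z x = g y x * w z + g z y * A x := by
    intro x z y
    have h1 : (Matrix.of fun z y => (if x = y then W z else 0)) + A x • g⁻¹
        - (Matrix.of fun z b => Q z x b) * g⁻¹ - g⁻¹ * (Matrix.of fun d y => Q y d x) = 0 := by
      ext z y
      have := h x y z
      simp only [quadGrad] at this
      simp only [Matrix.sub_apply, Matrix.add_apply, Matrix.of_apply, Matrix.smul_apply,
        Matrix.mul_apply, smul_eq_mul, Matrix.zero_apply]
      have h2 : ∑ b, Q z x b * g⁻¹ b y = ∑ b, g⁻¹ b y * Q z x b :=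
        Finset.sum_congr rfl fun b _ => mul_comm _ _
      rw [h2]
      refine Eq.trans ?_ this
      simp only [hW, hA]
      ring
    have h2 := congrArg (fun m => (g * m * g) z y) h1
    simp only [Matrix.mul_sub, Matrix.mul_add, Matrix.sub_mul, Matrix.add_mul, Matrix.mul_smul,
      Matrix.smul_mul, Matrix.mul_nonsing_inv _ hu, Matrix.one_mul, Matrix.mul_assoc,
      Matrix.nonsing_inv_mul _ hu, Matrix.mul_one] at h2
    rw [← Matrix.mul_assoc g g⁻¹, Matrix.mul_nonsing_inv _ hu, Matrix.one_mul] at h2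
    simp only [Matrix.sub_apply, Matrix.add_apply, Matrix.smul_apply, Matrix.mul_apply,
      Matrix.of_apply, smul_eq_mul, Matrix.zero_apply, mul_zero, zero_mul,
      Finset.sum_const_zero, ite_mul, Finset.sum_ite_eq, Finset.mem_univ, if_true] at h2
    have h3 : ∑ c, g z c * (W c * g x y) = g y x * w z := by
      rw [hw, Matrix.mulVec, dotProduct, Finset.mul_sum]
      refine Finset.sum_congr rfl fun c _ => ?_
      rw [hg.apply x y]; ring
    have h4 : ∑ c, Q c z x * g c y = f y z x := by
      simp only [hf]
      refine Finset.sum_congr rfl fun c _ => ?_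
      rw [hg.apply y c]; ring
    rw [h3, h4] at h2
    simp only [hf] at h2 ⊢
    linarith
  have hsym : ∀ i j, g i j = g j i := fun i j => hg.apply j i
  -- The alternating sum of the three cyclic permutations of `key` isolates `f z x y`.
  have hf2 : ∀ z x y,
      2 * f z x y = g y x * (w z - A z) + g z y * (A x + w x) - g x z * (w y - A y) := by
    intro z x y
    have k1 := key x z y
    have k2 := key z y x
    have k3 := key y x z
    linarith
  have hQ : ∀ z x y, Q z x y = ∑ c, g⁻¹ z c * f c x y := by
    intro z x y
    have h1 : g⁻¹ *ᵥ (g *ᵥ fun c => Q c x y) = fun c => Q c x y := by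
      rw [Matrix.mulVec_mulVec, Matrix.nonsing_inv_mul _ hu, Matrix.one_mulVec]
    exact (congrFun h1 z).symm
  have inv_g : ∀ (v : Fin 4 → ℝ) (y : Fin 4), ∑ x, ∑ c, g⁻¹ x c * (g y x * v c) = v y := by
    intro v y
    have h1 : g *ᵥ (g⁻¹ *ᵥ v) = v := by
      rw [Matrix.mulVec_mulVec, Matrix.mul_nonsing_inv _ hu, Matrix.one_mulVec]
    conv_rhs => rw [← h1]
    simp only [Matrix.mulVec, dotProduct, Finset.mul_sum]
    exact Finset.sum_congr rfl fun x _ => Finset.sum_congr rfl fun c _ => by ring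
  have inv_g' : ∀ z y, ∑ c, g⁻¹ z c * g c y = if z = y then 1 else 0 := by
    intro z y
    rw [← Matrix.mul_apply, Matrix.nonsing_inv_mul _ hu, Matrix.one_apply]
  -- The trace of `hf2` over `z` and `x`.
  have htr : ∀ y, w y = A y := by
    intro y
    have h1 : 2 * A y = ∑ x, ∑ c, g⁻¹ x c * (2 * f c x y) := by
      simp only [hA, Finset.mul_sum]
      refine Finset.sum_congr rfl fun x _ => ?_
      rw [hQ x x y, Finset.mul_sum]
      exact Finset.sum_congr rfl fun c _ => by ring
    simp only [hf2, mul_sub, mul_add, Finset.sum_sub_distrib, Finset.sum_add_distrib] at h1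
    have h2 : ∀ v : Fin 4 → ℝ, ∑ x, ∑ c, g⁻¹ x c * (g c y * v x) = v y := by
      intro v
      simp only [← mul_assoc, ← Finset.sum_mul, inv_g']
      simp
    have h3 : ∀ r : ℝ, ∑ x, ∑ c, g⁻¹ x c * (g x c * r) = 4 * r := by
      intro r
      simp only [← mul_assoc, ← Finset.sum_mul]
      have : ∀ x, ∑ c, g⁻¹ x c * g x c = 1 := fun x => by
        rw [← if_pos (c := x = x) (t := (1 : ℝ)) (e := 0) rfl, ← inv_g' x x]
        exact Finset.sum_congr rfl fun c _ => by rw [hsym x c]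
      simp [this]
    rw [inv_g, inv_g, h2, h2, h3, h3] at h1
    linarith
  funext z x y
  have h1 : ∀ c, f c x y = g c y * A x := fun c => by
    have := hf2 c x y
    rw [htr c, htr y, htr x] at this
    linarith
  rw [hQ z x y]
  simp only [h1, ← mul_assoc, ← Finset.sum_mul, inv_g', pureTrace]
  split_ifs <;> simp

end

/-! ### The Levi-Civita connection in coordinates -/

/-- `G` is smooth on `T`, symmetric and of negative determinant there, with induced metric of
negative determinant at the boundary points of `T`. This is all that is used of the Lorentzian
signature of `G` and of its boundary metric. -/
structure IsRegularMetric (G : MetricComp) (T : Set E4) : Prop where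
  smooth : MatSmoothOn G T
  symm : ∀ y ∈ T, (G y).IsSymm
  det_neg : ∀ y ∈ T, (G y).det < 0
  det_induced_neg : ∀ y ∈ T, y 0 = 0 → (inducedMetric G y).det < 0

/-- The components of `Q` are smooth on `T`. -/
def ConnSmoothOn (Q : ConnComp) (T : Set E4) : Prop :=
  ∀ a b c, ContDiffOn ℝ ∞ (fun y => Q y a b c) T

section
variable {T : Set E4} {G : MetricComp} {Q : ConnComp} {y : E4}

lemma MatSmoothOn.mono {n m : Type*} {A : E4 → Matrix n m ℝ} {S : Set E4}
    (h : MatSmoothOn A T) (hS : S ⊆ T) : MatSmoothOn A S :=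
  fun i j => (h i j).mono hS

lemma ConnSmoothOn.mono {S : Set E4} (h : ConnSmoothOn Q T) (hS : S ⊆ T) : ConnSmoothOn Q S :=
  fun a b c => (h a b c).mono hS

lemma IsRegularMetric.mono {S : Set E4} (h : IsRegularMetric G T) (hS : S ⊆ T) :
    IsRegularMetric G S :=
  ⟨h.smooth.mono hS, fun y hy => h.symm y (hS hy), fun y hy => h.det_neg y (hS hy),
    fun y hy => h.det_induced_neg y (hS hy)⟩

lemma IsRegularMetric.inv_smooth (h : IsRegularMetric G T) : MatSmoothOn (fun y => (G y)⁻¹) T :=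
  h.smooth.inv fun y hy => (h.det_neg y hy).ne

lemma IsRegularMetric.isUnit_det (h : IsRegularMetric G T) (hy : y ∈ T) : IsUnit (G y).det :=
  (h.det_neg y hy).ne.isUnit

lemma IsRegularMetric.inv_symm (h : IsRegularMetric G T) (hy : y ∈ T) : ((G y)⁻¹).IsSymm := by
  rw [Matrix.IsSymm, Matrix.transpose_nonsing_inv, (h.symm y hy).eq]

lemma IsRegularMetric.sqrt_smooth (h : IsRegularMetric G T) :
    ContDiffOn ℝ ∞ (fun y => √|(G y).det|) T :=
  ((h.smooth.det.neg.sqrt fun y hy => (neg_pos.2 (h.det_neg y hy)).ne')).congr fun y hy => by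
    rw [abs_of_neg (h.det_neg y hy)]

lemma IsRegularMetric.christoffel_smooth (hT : IsRelOpen T) (h : IsRegularMetric G T) :
    ConnSmoothOn (christoffel G) T := fun a _ _ =>
  contDiffOn_const.mul <| ContDiffOn.sum fun d _ => (h.inv_smooth a d).mul
    (((hT.contDiffOn_pd (h.smooth _ _) _).add (hT.contDiffOn_pd (h.smooth _ _) _)).sub
      (hT.contDiffOn_pd (h.smooth _ _) _))

lemma ConnSmoothOn.connection (hT : IsRelOpen T) (h : IsRegularMetric G T)
    (hQ : ConnSmoothOn Q T) : ConnSmoothOn (connection G Q) T := fun a b c =>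
  (h.christoffel_smooth hT a b c).add (hQ a b c)

variable (hT : IsRelOpen T) (h : IsRegularMetric G T) (hy : y ∈ T)
include hT h hy

lemma IsRegularMetric.pd_symm (m a b : Fin 4) :
    pd m (fun z => G z a b) y = pd m (fun z => G z b a) y :=
  hT.pd_congr (fun z hz => (h.symm z hz).apply b a) hy m

lemma IsRegularMetric.christoffel_symm (a b c : Fin 4) :
    christoffel G y a b c = christoffel G y a c b := by
  unfold christoffel
  congr 1
  refine Finset.sum_congr rfl fun d _ => ?_
  rw [h.pd_symm hT hy d b c]
  ring

omit hT in
lemma IsRegularMetric.lower_christoffel (e b c : Fin 4) :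
    ∑ a, G y e a * christoffel G y a b c = (1 / 2) *
      (pd b (fun z => G z e c) y + pd c (fun z => G z e b) y - pd e (fun z => G z b c) y) := by
  set v : Fin 4 → ℝ := fun d =>
    pd b (fun z => G z d c) y + pd c (fun z => G z d b) y - pd d (fun z => G z b c) y with hv
  have h1 : G y *ᵥ ((G y)⁻¹ *ᵥ v) = v := by
    rw [Matrix.mulVec_mulVec, Matrix.mul_nonsing_inv _ (h.isUnit_det hy), Matrix.one_mulVec]
  have h2 := congrFun h1 e
  simp only [Matrix.mulVec, dotProduct] at h2
  rw [show pd b (fun z => G z e c) y + pd c (fun z => G z e b) y - pd e (fun z => G z b c) y = v e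
    from rfl, ← h2, Finset.mul_sum]
  refine Finset.sum_congr rfl fun a _ => ?_
  unfold christoffel
  ring

/-- The Levi-Civita connection is metric. -/
lemma IsRegularMetric.pd_metric (m b c : Fin 4) :
    pd m (fun z => G z b c) y =
      ∑ l, christoffel G y l m b * G y l c + ∑ l, christoffel G y l m c * G y b l := by
  have h1 : ∑ l, christoffel G y l m b * G y l c = ∑ l, G y c l * christoffel G y l m b :=
    Finset.sum_congr rfl fun l _ => by rw [(h.symm y hy).apply c l, mul_comm]
  have h2 : ∑ l, christoffel G y l m c * G y b l = ∑ l, G y b l * christoffel G y l m c :=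
    Finset.sum_congr rfl fun l _ => mul_comm _ _
  rw [h1, h2, h.lower_christoffel hy, h.lower_christoffel hy, h.pd_symm hT hy m c b,
    h.pd_symm hT hy b m c, h.pd_symm hT hy c m b]
  ring

/-- `∂_m g = Γ_mᵀ g + g Γ_m`, with `Γ_m` the matrix `Γ^a_{mb}`. -/
lemma IsRegularMetric.pdMat_metric (m : Fin 4) :
    pdMat m G y = (Matrix.of fun a b => christoffel G y a m b)ᵀ * G y +
      G y * Matrix.of fun a b => christoffel G y a m b := by
  ext b c
  simp only [pdMat, Matrix.of_apply, Matrix.add_apply, Matrix.mul_apply, Matrix.transpose_apply]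
  rw [h.pd_metric hT hy]
  congr 1
  exact Finset.sum_congr rfl fun l _ => mul_comm _ _

lemma IsRegularMetric.pd_inv (m b d : Fin 4) :
    pd m (fun z => (G z)⁻¹ b d) y =
      -(∑ l, christoffel G y b m l * (G y)⁻¹ l d) - ∑ l, christoffel G y d m l * (G y)⁻¹ b l := by
  have h1 := pdMat_inv hT hy m h.smooth fun y hy => (h.det_neg y hy).ne
  rw [h.pdMat_metric hT hy m, Matrix.mul_add, Matrix.add_mul, ← Matrix.mul_assoc (G y)⁻¹ (G y),
    Matrix.nonsing_inv_mul _ (h.isUnit_det hy), Matrix.one_mul, ← Matrix.mul_assoc,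
    Matrix.mul_assoc _ (G y), Matrix.mul_nonsing_inv _ (h.isUnit_det hy), Matrix.mul_one] at h1
  have h2 := congrFun (congrFun h1 b) d
  simp only [pdMat, Matrix.of_apply, Matrix.neg_apply, Matrix.add_apply, Matrix.mul_apply,
    Matrix.transpose_apply] at h2
  rw [h2, neg_add, add_comm, ← sub_eq_add_neg]
  congr 1
  exact Finset.sum_congr rfl fun l _ => mul_comm _ _

lemma IsRegularMetric.trace_inv_mul_pdMat (m : Fin 4) :
    ((G y)⁻¹ * pdMat m G y).trace = 2 * ∑ l, christoffel G y l m l := by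
  rw [h.pdMat_metric hT hy m, Matrix.mul_add, Matrix.trace_add, ← Matrix.mul_assoc,
    Matrix.trace_mul_comm, ← Matrix.mul_assoc, Matrix.mul_nonsing_inv _ (h.isUnit_det hy),
    Matrix.one_mul, ← Matrix.mul_assoc, Matrix.nonsing_inv_mul _ (h.isUnit_det hy),
    Matrix.one_mul, Matrix.trace_transpose, Matrix.trace]
  simp only [Matrix.diag_apply, Matrix.of_apply]
  ring

lemma IsRegularMetric.pd_sqrt_det (m : Fin 4) :
    pd m (fun z => √|(G z).det|) y = √|(G y).det| * ∑ l, christoffel G y l m l := by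
  have hpos : ∀ z ∈ T, 0 < -1 * (G z).det := fun z hz => by linarith [h.det_neg z hz]
  have h0 : Set.EqOn (fun z => √|(G z).det|) (fun z => √(-1 * (G z).det)) T := fun z hz => by
    simp only [abs_of_neg (h.det_neg z hz), neg_one_mul]
  have hs := Real.sqrt_pos.2 (hpos y hy)
  have hq := Real.mul_self_sqrt (hpos y hy).le
  have hadj : (G y).adjugate = (G y).det • (G y)⁻¹ := by
    rw [Matrix.inv_def, Ring.inverse_eq_inv', smul_smul,
      mul_inv_cancel₀ (h.det_neg y hy).ne, one_smul]
  rw [hT.pd_congr h0 hy, pd_sqrt hT hy m (contDiffOn_const.mul h.smooth.det) hpos,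
    pd_const_mul hT hy m _ h.smooth.det, pd_det hT hy m h.smooth,
    show √|(G y).det| = √(-1 * (G y).det) from h0 hy, hadj,
    Matrix.smul_mul, Matrix.trace_smul, h.trace_inv_mul_pdMat hT hy, smul_eq_mul,
    div_eq_iff (by positivity)]
  linear_combination (-2 * ∑ l, christoffel G y l m l) * hq

end

/-! ### The difference of the Palatini and Einstein-Hilbert Lagrangians -/

/-- The vector `g^{bd} Q^a_{db} - g^{ba} Q^l_{lb}`, whose divergence is the part of the scalar
curvature of `∇ + Q` linear in `Q`. -/
def divVector (gi : Matrix (Fin 4) (Fin 4) ℝ) (Q : Fin 4 → Fin 4 → Fin 4 → ℝ) (a : Fin 4) : ℝ :=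
  ∑ b, ∑ d, gi b d * Q a d b - ∑ b, gi b a * ∑ l, Q l l b

lemma sum_perm4 {ι : Type*} [Fintype ι] {f g : ι → ι → ι → ι → ℝ}
    (σ τ : ι × ι × ι × ι → ι × ι × ι × ι) (h₁ : ∀ p, τ (σ p) = p) (h₂ : ∀ p, σ (τ p) = p)
    (h : ∀ a b c d, f a b c d = g (σ (a, b, c, d)).1 (σ (a, b, c, d)).2.1
      (σ (a, b, c, d)).2.2.1 (σ (a, b, c, d)).2.2.2) :
    ∑ a, ∑ b, ∑ c, ∑ d, f a b c d = ∑ a, ∑ b, ∑ c, ∑ d, g a b c d := by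
  simp only [← Fintype.sum_prod_type']
  exact Fintype.sum_equiv ⟨σ, τ, h₁, h₂⟩ _ _ fun p => h p.1 p.2.1 p.2.2.1 p.2.2.2

lemma sum_perm3 {ι : Type*} [Fintype ι] {f g : ι → ι → ι → ℝ}
    (σ τ : ι × ι × ι → ι × ι × ι) (h₁ : ∀ p, τ (σ p) = p) (h₂ : ∀ p, σ (τ p) = p)
    (h : ∀ a b c, f a b c = g (σ (a, b, c)).1 (σ (a, b, c)).2.1 (σ (a, b, c)).2.2) :
    ∑ a, ∑ b, ∑ c, f a b c = ∑ a, ∑ b, ∑ c, g a b c := by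
  simp only [← Fintype.sum_prod_type']
  exact Fintype.sum_equiv ⟨σ, τ, h₁, h₂⟩ _ _ fun p => h p.1 p.2.1 p.2.2

/-- The contraction identity behind the divergence formula: `D` are the derivatives of the
components of `Q`, and the derivatives of the inverse metric are expressed by the connection
coefficients `Γ`. -/
lemma contraction_identity (gi : Matrix (Fin 4) (Fin 4) ℝ) (Γ Q : Fin 4 → Fin 4 → Fin 4 → ℝ)
    (D : Fin 4 → Fin 4 → Fin 4 → Fin 4 → ℝ)
    (hΓ : ∀ a b c, Γ a b c = Γ a c b) :
    (∑ b, ∑ d, gi b d * ∑ a, (D a a d b - D d a a b + ∑ l, (Γ a a l * Q l d b + Q a a l * Γ l d b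
        - Γ a d l * Q l a b - Q a d l * Γ l a b))) =
      ∑ a, ((∑ b, ∑ d, ((-(∑ l, Γ b a l * gi l d) - ∑ l, Γ d a l * gi b l) * Q a d b
            + gi b d * D a a d b)
          - ∑ b, ((-(∑ l, Γ b a l * gi l a) - ∑ l, Γ a a l * gi b l) * ∑ l, Q l l b
            + gi b a * ∑ l, D a l l b))
        + (∑ l, Γ l a l) * divVector gi Q a) := by
  simp only [divVector, mul_add, mul_sub, sub_mul, neg_mul, Finset.sum_add_distrib,
    Finset.sum_sub_distrib, Finset.sum_neg_distrib, Finset.mul_sum, Finset.sum_mul]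
  have d1 : ∑ a, ∑ b, ∑ c, gi a b * D c c b a =
      ∑ a, ∑ b, ∑ c, gi b c * D a a c b :=
    sum_perm3 (fun p => (p.2.2, p.1, p.2.1))
    (fun p => (p.2.1, p.2.2, p.1)) (fun _ => rfl) (fun _ => rfl) fun a b c => by
      rfl
  have d2 : ∑ a, ∑ b, ∑ c, gi a b * D b c c a =
      ∑ a, ∑ b, ∑ c, gi b a * D a c c b :=
    sum_perm3 (fun p => (p.2.1, p.1, p.2.2))
    (fun p => (p.2.1, p.1, p.2.2)) (fun _ => rfl) (fun _ => rfl) fun a b c => by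
      rfl
  have e1 : ∑ a, ∑ b, ∑ c, ∑ d, gi a b * (Γ c c d * Q d b a) =
      ∑ a, ∑ b, ∑ c, ∑ d, Γ d a d * (gi b c * Q a c b) :=
    sum_perm4 (fun p => (p.2.2.2, p.1, p.2.1, p.2.2.1))
    (fun p => (p.2.1, p.2.2.1, p.2.2.2, p.1)) (fun _ => rfl) (fun _ => rfl) fun a b c d => by
      simp only [hΓ c d c]; ring
  have e2 : ∑ a, ∑ b, ∑ c, ∑ d, gi a b * (Q c c d * Γ d b a) =
      ∑ a, ∑ b, ∑ c, ∑ d, Γ b a d * gi d a * Q c c b :=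
    sum_perm4 (fun p => (p.2.1, p.2.2.2, p.2.2.1, p.1))
    (fun p => (p.2.2.2, p.1, p.2.2.1, p.2.1)) (fun _ => rfl) (fun _ => rfl) fun a b c d => by
      ring
  have e3 : ∑ a, ∑ b, ∑ c, ∑ d, gi a b * (Γ c b d * Q d c a) =
      ∑ a, ∑ b, ∑ c, ∑ d, Γ c a d * gi b d * Q a c b :=
    sum_perm4 (fun p => (p.2.2.2, p.1, p.2.2.1, p.2.1))
    (fun p => (p.2.1, p.2.2.2, p.2.2.1, p.1)) (fun _ => rfl) (fun _ => rfl) fun a b c d => by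
      simp only [hΓ c b d]; ring
  have e4 : ∑ a, ∑ b, ∑ c, ∑ d, gi a b * (Q c b d * Γ d c a) =
      ∑ a, ∑ b, ∑ c, ∑ d, Γ b a d * gi d c * Q a c b :=
    sum_perm4 (fun p => (p.2.2.1, p.2.2.2, p.2.1, p.1))
    (fun p => (p.2.2.2, p.2.2.1, p.1, p.2.1)) (fun _ => rfl) (fun _ => rfl) fun a b c d => by
      ring
  have e5 : ∑ a, ∑ b, ∑ c, ∑ d, Γ a a d * gi b d * Q c c b =
      ∑ a, ∑ b, ∑ c, ∑ d, Γ d a d * (gi b a * Q c c b) :=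
    sum_perm4 (fun p => (p.2.2.2, p.2.1, p.2.2.1, p.1))
    (fun p => (p.2.2.2, p.2.1, p.2.2.1, p.1)) (fun _ => rfl) (fun _ => rfl) fun a b c d => by
      simp only [hΓ a d a]; ring
  rw [d1, d2, e1, e2, e3, e4, e5]
  ring

section
variable {T : Set E4} {G : MetricComp} {Q : ConnComp} {y : E4}

/-- The vector density `√|g| V^a` whose divergence and boundary flux account for the terms linear
in `Q` of the Palatini action. -/
def divDensity (G : MetricComp) (Q : ConnComp) (a : Fin 4) (y : E4) : ℝ :=
  √|(G y).det| * divVector (G y)⁻¹ (Q y) a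

/-- The quadratic Lagrangian `√|g| (g^{bd} (Q^a_{al} Q^l_{db} - Q^a_{dl} Q^l_{ab}))`. -/
def quadLagrangian (G : MetricComp) (Q : ConnComp) (y : E4) : ℝ :=
  quadForm (G y)⁻¹ (Q y) (Q y) * √|(G y).det|

lemma IsRegularMetric.divVector_smooth (h : IsRegularMetric G T) (hQ : ConnSmoothOn Q T)
    (a : Fin 4) : ContDiffOn ℝ ∞ (fun y => divVector (G y)⁻¹ (Q y) a) T :=
  (ContDiffOn.sum fun b _ => ContDiffOn.sum fun d _ => (h.inv_smooth b d).mul (hQ a d b)).sub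
    (ContDiffOn.sum fun b _ => (h.inv_smooth b a).mul (ContDiffOn.sum fun l _ => hQ l l b))

lemma IsRegularMetric.divDensity_smooth (h : IsRegularMetric G T) (hQ : ConnSmoothOn Q T)
    (a : Fin 4) : ContDiffOn ℝ ∞ (divDensity G Q a) T :=
  h.sqrt_smooth.mul (h.divVector_smooth hQ a)

/-- The scalar curvature of `∇ + Q` is that of `∇`, plus a divergence, plus the quadratic form
of `Q`. -/
theorem bulkLagrangian_sub (hT : IsRelOpen T) (h : IsRegularMetric G T) (hQ : ConnSmoothOn Q T)
    (hy : y ∈ T) (Λ : ℝ) :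
    bulkLagrangian Λ G (connection G Q) y - bulkLagrangian Λ G (christoffel G) y =
      ∑ a, pd a (divDensity G Q a) y + quadLagrangian G Q y := by
  have hΓ := h.christoffel_smooth hT
  -- The curvature of `∇ + Q` is that of `∇` plus terms linear and quadratic in `Q`.
  have hriem : ∀ a b c d, riemann (connection G Q) y a b c d = riemann (christoffel G) y a b c d +
      (pd c (fun z => Q z a d b) y - pd d (fun z => Q z a c b) y
        + ∑ l, (christoffel G y a c l * Q y l d b + Q y a c l * christoffel G y l d b
          - christoffel G y a d l * Q y l c b - Q y a d l * christoffel G y l c b))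
      + ∑ l, (Q y a c l * Q y l d b - Q y a d l * Q y l c b) := by
    intro a b c d
    simp only [riemann, connection]
    rw [pd_add hT hy c (hΓ a d b) (hQ a d b), pd_add hT hy d (hΓ a c b) (hQ a c b)]
    have : ∀ l, (christoffel G y a c l + Q y a c l) * (christoffel G y l d b + Q y l d b) -
        (christoffel G y a d l + Q y a d l) * (christoffel G y l c b + Q y l c b) =
        (christoffel G y a c l * christoffel G y l d b
          - christoffel G y a d l * christoffel G y l c b) +
        (christoffel G y a c l * Q y l d b + Q y a c l * christoffel G y l d b
          - christoffel G y a d l * Q y l c b - Q y a d l * christoffel G y l c b) +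
        (Q y a c l * Q y l d b - Q y a d l * Q y l c b) := fun l => by ring
    simp only [this]
    rw [Finset.sum_add_distrib, Finset.sum_add_distrib]
    ring
  have hscal : scalarCurvature G (connection G Q) y = scalarCurvature G (christoffel G) y +
      (∑ b, ∑ d, (G y)⁻¹ b d * ∑ a, (pd a (fun z => Q z a d b) y - pd d (fun z => Q z a a b) y
        + ∑ l, (christoffel G y a a l * Q y l d b + Q y a a l * christoffel G y l d b
          - christoffel G y a d l * Q y l a b - Q y a d l * christoffel G y l a b)))
      + quadForm (G y)⁻¹ (Q y) (Q y) := by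
    simp only [scalarCurvature, ricci, quadForm, hriem]
    rw [← Finset.sum_add_distrib, ← Finset.sum_add_distrib]
    refine Finset.sum_congr rfl fun b _ => ?_
    rw [← Finset.sum_add_distrib, ← Finset.sum_add_distrib]
    refine Finset.sum_congr rfl fun d _ => ?_
    rw [← mul_add, ← mul_add, ← Finset.sum_add_distrib, ← Finset.sum_add_distrib]
  have hdiv : ∀ a, pd a (divDensity G Q a) y = √|(G y).det| *
      ((∑ b, ∑ d, ((-(∑ l, christoffel G y b a l * (G y)⁻¹ l d)
              - ∑ l, christoffel G y d a l * (G y)⁻¹ b l) * Q y a d b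
            + (G y)⁻¹ b d * pd a (fun z => Q z a d b) y)
          - ∑ b, ((-(∑ l, christoffel G y b a l * (G y)⁻¹ l a)
              - ∑ l, christoffel G y a a l * (G y)⁻¹ b l) * ∑ l, Q y l l b
            + (G y)⁻¹ b a * ∑ l, pd a (fun z => Q z l l b) y))
        + (∑ l, christoffel G y l a l) * divVector (G y)⁻¹ (Q y) a) := by
    intro a
    unfold divDensity
    rw [pd_mul hT hy a h.sqrt_smooth (h.divVector_smooth hQ a), h.pd_sqrt_det hT hy]
    have h1 : pd a (fun z => divVector (G z)⁻¹ (Q z) a) y =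
        (∑ b, ∑ d, ((-(∑ l, christoffel G y b a l * (G y)⁻¹ l d)
              - ∑ l, christoffel G y d a l * (G y)⁻¹ b l) * Q y a d b
            + (G y)⁻¹ b d * pd a (fun z => Q z a d b) y)
          - ∑ b, ((-(∑ l, christoffel G y b a l * (G y)⁻¹ l a)
              - ∑ l, christoffel G y a a l * (G y)⁻¹ b l) * ∑ l, Q y l l b
            + (G y)⁻¹ b a * ∑ l, pd a (fun z => Q z l l b) y)) := by
      have hs1 : ∀ b d, ContDiffOn ℝ ∞ (fun z => (G z)⁻¹ b d * Q z a d b) T := fun b d =>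
        (h.inv_smooth b d).mul (hQ a d b)
      have hs2 : ∀ b, ContDiffOn ℝ ∞ (fun z => ∑ l, Q z l l b) T := fun b =>
        ContDiffOn.sum fun l _ => hQ l l b
      unfold divVector
      rw [pd_sub hT hy a (ContDiffOn.sum fun b _ => ContDiffOn.sum fun d _ => hs1 b d)
        (ContDiffOn.sum fun b _ => (h.inv_smooth b a).mul (hs2 b)),
        pd_sum hT hy a _ fun b _ => ContDiffOn.sum fun d _ => hs1 b d,
        pd_sum hT hy a _ fun b _ => (h.inv_smooth b a).mul (hs2 b)]
      congr 1
      · refine Finset.sum_congr rfl fun b _ => ?_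
        rw [pd_sum hT hy a _ fun d _ => hs1 b d]
        refine Finset.sum_congr rfl fun d _ => ?_
        rw [pd_mul hT hy a (h.inv_smooth b d) (hQ a d b), h.pd_inv hT hy]
      · refine Finset.sum_congr rfl fun b _ => ?_
        rw [pd_mul hT hy a (h.inv_smooth b a) (hs2 b), h.pd_inv hT hy,
          pd_sum hT hy a _ fun l _ => hQ l l b]
    rw [h1]
    ring
  have hc := contraction_identity (G y)⁻¹ (christoffel G y) (Q y)
    (fun m a b c => pd m (fun z => Q z a b c) y) (h.christoffel_symm hT hy)
  simp only [hdiv, ← Finset.mul_sum]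
  rw [← hc, bulkLagrangian, bulkLagrangian, hscal, quadLagrangian]
  ring

end

/-! ### The boundary term -/

section
variable {g : Matrix (Fin 4) (Fin 4) ℝ}

lemma inv_zero_zero (hdet : g.det ≠ 0) :
    g⁻¹ 0 0 * g.det = (g.submatrix Fin.succ Fin.succ).det := by
  rw [Matrix.inv_def, Ring.inverse_eq_inv', Matrix.smul_apply,
    Matrix.adjugate_fin_succ_eq_det_submatrix]
  simp only [Fin.succAbove_zero, smul_eq_mul, Fin.val_zero, add_zero, pow_zero, one_mul]
  field_simp

/-- The inverse of the induced metric is the projection `g^{ab} - g^{a0} g^{0b} / g^{00}` of the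
inverse metric. -/
lemma inv_submatrix_succ (hdet : g.det ≠ 0) (h00 : g⁻¹ 0 0 ≠ 0) :
    (g.submatrix Fin.succ Fin.succ)⁻¹ =
      Matrix.of fun a b : Fin 3 => g⁻¹ a.succ b.succ - g⁻¹ a.succ 0 * g⁻¹ 0 b.succ / g⁻¹ 0 0 := by
  refine Matrix.inv_eq_left_inv ?_
  have hi : ∀ a c : Fin 4, ∑ b, g⁻¹ a b * g b c = if a = c then 1 else 0 := fun a c => by
    rw [← Matrix.mul_apply, Matrix.nonsing_inv_mul _ hdet.isUnit, Matrix.one_apply]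
  ext a c
  have h1 := hi a.succ c.succ
  have h2 := hi 0 c.succ
  rw [Fin.sum_univ_succ] at h1 h2
  rw [if_neg (Fin.succ_ne_zero c).symm] at h2
  simp only [Fin.succ_inj] at h1
  simp only [Matrix.mul_apply, Matrix.of_apply, Matrix.submatrix_apply, sub_mul,
    Finset.sum_sub_distrib, Matrix.one_apply]
  rw [eq_sub_of_add_eq' h1]
  have h3 : ∑ x : Fin 3, g⁻¹ a.succ 0 * g⁻¹ 0 x.succ / g⁻¹ 0 0 * g x.succ c.succ =
      g⁻¹ a.succ 0 / g⁻¹ 0 0 * ∑ x : Fin 3, g⁻¹ 0 x.succ * g x.succ c.succ := by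
    rw [Finset.mul_sum]
    exact Finset.sum_congr rfl fun x _ => by ring
  rw [h3, eq_neg_of_add_eq_zero_right h2]
  field_simp
  ring

/-- Contraction with the inverse of the induced metric, as a contraction in four dimensions. -/
lemma contraction_inv_submatrix (hdet : g.det ≠ 0) (h00 : g⁻¹ 0 0 ≠ 0)
    (X : Fin 4 → Fin 4 → ℝ) :
    ∑ a : Fin 3, ∑ b : Fin 3, (g.submatrix Fin.succ Fin.succ)⁻¹ a b * X a.succ b.succ =
      ∑ a, ∑ b, (g⁻¹ a b - g⁻¹ a 0 * g⁻¹ 0 b / g⁻¹ 0 0) * X a b := by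
  have e1 : ∀ b, g⁻¹ 0 b - g⁻¹ 0 0 * g⁻¹ 0 b / g⁻¹ 0 0 = 0 := fun b => by field_simp; ring
  have e2 : ∀ a, g⁻¹ a 0 - g⁻¹ a 0 * g⁻¹ 0 0 / g⁻¹ 0 0 = 0 := fun a => by field_simp; ring
  rw [inv_submatrix_succ hdet h00, Fin.sum_univ_succ (n := 3)]
  simp only [e1, zero_mul, Finset.sum_const_zero, zero_add]
  refine Finset.sum_congr rfl fun a _ => ?_
  rw [Fin.sum_univ_succ (n := 3), e2, zero_mul, zero_add]
  rfl

/-- The left-hand side is, up to a normalisation factor, the trace of the difference of the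
extrinsic curvatures of `∇ + Q` and `∇`; the right-hand side is the transversal component of the
vector whose divergence appears in the scalar curvature. -/
lemma trace_extrinsic_identity (hg : g.IsSymm) (hdet : g.det ≠ 0)
    (Q : Fin 4 → Fin 4 → Fin 4 → ℝ) :
    ∑ a, ∑ b, (g⁻¹ a b - g⁻¹ a 0 * g⁻¹ 0 b / g⁻¹ 0 0) *
      (Q 0 a b - ∑ c, g a c * ∑ l, Q c b l * g⁻¹ l 0) = divVector g⁻¹ Q 0 := by
  have hs : ∀ i j, g⁻¹ i j = g⁻¹ j i := fun i j => by
    have : g⁻¹.IsSymm := by rw [Matrix.IsSymm, Matrix.transpose_nonsing_inv, hg.eq]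
    exact this.apply j i
  have hi : ∀ a c : Fin 4, ∑ b, g⁻¹ b a * g b c = if a = c then 1 else 0 := fun a c => by
    simp only [hs _ a]
    rw [← Matrix.mul_apply, Matrix.nonsing_inv_mul _ hdet.isUnit, Matrix.one_apply]
  have h2 : ∑ a, ∑ b, (g⁻¹ a b - g⁻¹ a 0 * g⁻¹ 0 b / g⁻¹ 0 0) *
      (∑ c, g a c * ∑ l, Q c b l * g⁻¹ l 0) =
      ∑ b, ∑ c, ((if b = c then 1 else 0) - (if 0 = c then 1 else 0) * g⁻¹ 0 b / g⁻¹ 0 0) *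
        ∑ l, Q c b l * g⁻¹ l 0 := by
    rw [Finset.sum_comm]
    refine Finset.sum_congr rfl fun b _ => ?_
    simp only [Finset.mul_sum (s := Finset.univ) (f := fun c => g _ c * _)]
    rw [Finset.sum_comm]
    refine Finset.sum_congr rfl fun c _ => ?_
    rw [← hi b c, ← hi 0 c]
    simp only [← mul_assoc, ← Finset.sum_mul]
    congr 1
    rw [Finset.sum_mul, Finset.sum_div, ← Finset.sum_sub_distrib]
    exact Finset.sum_congr rfl fun a _ => by ring
  have h3 : ∑ b, ∑ c, ((if b = c then (1 : ℝ) else 0)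
        - (if 0 = c then 1 else 0) * g⁻¹ 0 b / g⁻¹ 0 0) * ∑ l, Q c b l * g⁻¹ l 0 =
      ∑ b, ∑ l, Q b b l * g⁻¹ l 0 - ∑ b, g⁻¹ 0 b / g⁻¹ 0 0 * ∑ l, Q 0 b l * g⁻¹ l 0 := by
    simp only [sub_mul, Finset.sum_sub_distrib, ite_mul, one_mul, zero_mul, ite_div, zero_div,
      Finset.sum_ite_eq, Finset.mem_univ, if_true]
  simp only [mul_sub, Finset.sum_sub_distrib]
  rw [h2, h3]
  simp only [sub_mul, Finset.sum_sub_distrib, divVector]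
  have h4 : ∑ a, ∑ b, g⁻¹ a 0 * g⁻¹ 0 b / g⁻¹ 0 0 * Q 0 a b =
      ∑ b, g⁻¹ 0 b / g⁻¹ 0 0 * ∑ l, Q 0 b l * g⁻¹ l 0 := by
    simp only [Finset.mul_sum]
    refine Finset.sum_congr rfl fun a _ => Finset.sum_congr rfl fun b _ => ?_
    rw [hs a 0, hs b 0]; ring
  have h5 : ∑ a, ∑ b, g⁻¹ a b * Q 0 a b = ∑ b, ∑ d, g⁻¹ b d * Q 0 d b := by
    rw [Finset.sum_comm]
    exact Finset.sum_congr rfl fun a _ => Finset.sum_congr rfl fun b _ => by rw [hs a b]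
  have h6 : ∑ b, ∑ l, Q b b l * g⁻¹ l 0 = ∑ b, g⁻¹ b 0 * ∑ l, Q l l b := by
    rw [Finset.sum_comm]
    refine Finset.sum_congr rfl fun a _ => ?_
    rw [Finset.mul_sum]
    exact Finset.sum_congr rfl fun b _ => mul_comm _ _
  rw [h4, h5, h6]
  ring

end

section
variable {T : Set E4} {G : MetricComp} {y : E4}

lemma IsRegularMetric.inv_zero_zero_pos (h : IsRegularMetric G T) (hy : y ∈ T) (hy0 : y 0 = 0) :
    0 < (G y)⁻¹ 0 0 := by
  have h1 := inv_zero_zero (h.det_neg y hy).ne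
  have h2 := h.det_induced_neg y hy hy0
  rw [inducedMetric, ← h1] at h2
  by_contra hc
  exact absurd h2 (not_lt.2 (mul_nonneg_of_nonpos_of_nonpos (not_lt.1 hc) (h.det_neg y hy).le))

/-- The boundary terms differ by the flux of the vector density whose divergence appears in
`bulkLagrangian_sub`. -/
theorem boundaryLagrangian_sub (h : IsRegularMetric G T) (hy : y ∈ T) (hy0 : y 0 = 0)
    (Q : ConnComp) :
    boundaryLagrangian G (connection G Q) y - boundaryLagrangian G (christoffel G) y =
      -divDensity G Q 0 y := by
  have hpos := h.inv_zero_zero_pos hy hy0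
  have hdet := (h.det_neg y hy).ne
  set s := √((G y)⁻¹ 0 0) with hs
  have hspos : 0 < s := Real.sqrt_pos.2 hpos
  -- The conormal is `-dy⁰ / √g^{00}`.
  have hdown : ∀ c, normalDown G y c = -(if c = 0 then 1 else 0) / s := by
    intro c
    have h1 : ∑ b, G y c b * (G y)⁻¹ b 0 = if c = 0 then 1 else 0 := by
      rw [← Matrix.mul_apply, Matrix.mul_nonsing_inv _ hdet.isUnit, Matrix.one_apply]
    rw [← h1, normalDown, ← Finset.sum_neg_distrib, Finset.sum_div]
    exact Finset.sum_congr rfl fun b _ => by rw [normalUp]; ring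
  have hext : ∀ a b : Fin 3, extrinsic G (connection G Q) y a b =
      extrinsic G (christoffel G) y a b + 1 / (2 * s) *
        (Q y 0 a.succ b.succ - ∑ c, G y a.succ c * ∑ l, Q y c b.succ l * (G y)⁻¹ l 0) := by
    intro a b
    simp only [extrinsic, connection, add_mul, Finset.sum_add_distrib, mul_add]
    have h1 : ∑ c, Q y c a.succ b.succ * normalDown G y c = -Q y 0 a.succ b.succ / s := by
      simp only [hdown, neg_div, mul_neg, Finset.sum_neg_distrib, ite_div, zero_div, mul_ite,
        mul_zero, Finset.sum_ite_eq', Finset.mem_univ, if_true]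
      ring
    have h2 : ∑ c, G y a.succ c * ∑ l, Q y c b.succ l * normalUp G y l =
        -(∑ c, G y a.succ c * ∑ l, Q y c b.succ l * (G y)⁻¹ l 0) / s := by
      rw [← Finset.sum_neg_distrib, Finset.sum_div]
      refine Finset.sum_congr rfl fun c _ => ?_
      rw [← mul_neg, mul_div_assoc, ← Finset.sum_neg_distrib, Finset.sum_div]
      congr 1
      exact Finset.sum_congr rfl fun l _ => by rw [normalUp]; ring
    rw [h1, h2]
    field_simp
    ring
  have htr : extrinsicTrace G (connection G Q) y = extrinsicTrace G (christoffel G) y +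
      1 / (2 * s) * divVector (G y)⁻¹ (Q y) 0 := by
    rw [← trace_extrinsic_identity (h.symm y hy) hdet, ← contraction_inv_submatrix hdet
      hpos.ne' fun a b => Q y 0 a b - ∑ c, G y a c * ∑ l, Q y c b l * (G y)⁻¹ l 0]
    simp only [extrinsicTrace, hext, mul_add, Finset.sum_add_distrib, Finset.mul_sum]
    congr 1
    refine Finset.sum_congr rfl fun a _ => Finset.sum_congr rfl fun b _ => ?_
    simp only [inducedMetric]
    ring
  have hvol : √|(inducedMetric G y).det| = s * √|(G y).det| := by
    rw [inducedMetric, ← inv_zero_zero hdet, abs_mul, abs_of_pos hpos, Real.sqrt_mul hpos.le]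
  rw [boundaryLagrangian, boundaryLagrangian, htr, hvol, divDensity]
  field_simp
  ring

end

/-! ### The divergence theorem in the half-space -/

lemma isRelOpen_halfSpace : IsRelOpen halfSpace :=
  ⟨subset_rfl, fun _ _ => self_mem_nhdsWithin⟩

lemma continuous_boundaryPoint : Continuous boundaryPoint := by
  unfold boundaryPoint
  refine (PiLp.continuous_toLp 2 _).comp (continuous_pi fun i => ?_)
  refine Fin.cases ?_ (fun i => ?_) i
  · exact continuous_const
  · exact PiLp.continuous_apply 2 _ i

lemma isCompact_boundaryPoint_preimage {K : Set E4} (hK : IsCompact K) :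
    IsCompact {z | boundaryPoint z ∈ K} := by
  refine Metric.isCompact_of_isClosed_isBounded (hK.isClosed.preimage continuous_boundaryPoint) ?_
  obtain ⟨R, hR⟩ := hK.isBounded.exists_norm_le
  refine isBounded_iff_forall_norm_le.2 ⟨R, fun z hz => ?_⟩
  refine le_trans (le_of_eq ?_) (hR _ hz)
  rw [EuclideanSpace.norm_eq, EuclideanSpace.norm_eq, Fin.sum_univ_succ (n := 3)]
  simp [boundaryPoint]

lemma pd_eq_zero_of_eqOn {S : Set E4} (hS : IsRelOpen S) {f : E4 → ℝ}
    (hf : ∀ y ∈ S, f y = 0) {y : E4} (hy : y ∈ S) (i : Fin 4) : pd i f y = 0 := by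
  rw [hS.pd_congr (g := fun _ => 0) hf hy, pd_const]

open MeasureTheory in
/-- The outward direction at the boundary is `-∂/∂y⁰`, so the flux of `D` through the boundary is
the integral of `-D 0`. -/
lemma integral_divergence_halfSpace {D : Fin 4 → E4 → ℝ} {K : Set E4}
    (hD : ∀ a, ContDiffOn ℝ ∞ (D a) halfSpace) (hK : IsCompact K) (hKH : K ⊆ halfSpace)
    (h0 : ∀ a, ∀ y ∈ halfSpace \ K, D a y = 0) :
    (∫ y in K, ∑ a, pd a (D a) y) +
      ∫ z in {z | boundaryPoint z ∈ K}, D 0 (boundaryPoint z) = 0 := by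
  -- Apply the divergence theorem in the box `[0, R] × [-R, R]³`, whose interior relative to the
  -- half-space contains `K`: only the face `y⁰ = 0` contributes.
  obtain ⟨R, hRpos, hR⟩ := hK.isBounded.exists_pos_norm_lt
  have hKR : ∀ y ∈ K, ∀ i, |y i| < R := fun y hy i =>
    (PiLp.norm_apply_le y i).trans_lt (hR y hy)
  set a : Fin 4 → ℝ := Fin.cons 0 fun _ => -R with ha
  set b : Fin 4 → ℝ := fun _ => R with hb
  have ha0 : a 0 = 0 := rfl
  have has : ∀ i : Fin 3, a i.succ = -R := fun i => rfl
  have hab : a ≤ b := by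
    intro i
    refine Fin.cases ?_ (fun i => ?_) i
    · rw [ha0]; exact hRpos.le
    · rw [has]; show -R ≤ R; linarith
  have hbox : ∀ x ∈ Set.Icc a b, WithLp.toLp 2 x ∈ halfSpace := fun x hx =>
    mem_halfSpace.2 (hx.1 0)
  have hcont : ∀ i, ContinuousOn (fun x : Fin 4 → ℝ => D i (WithLp.toLp 2 x)) (Set.Icc a b) :=
    fun i => (hD i).continuousOn.comp (PiLp.continuous_toLp 2 _).continuousOn hbox
  have hpdc : ∀ i, ContinuousOn (fun x : Fin 4 → ℝ => pd i (D i) (WithLp.toLp 2 x))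
      (Set.Icc a b) := fun i =>
    (isRelOpen_halfSpace.contDiffOn_pd (hD i) i).continuousOn.comp
      (PiLp.continuous_toLp 2 _).continuousOn hbox
  have hout : ∀ i, ∀ x ∈ Set.Icc a b, (∃ j, R ≤ |x j|) → D i (WithLp.toLp 2 x) = 0 := by
    rintro i x hx ⟨j, hj⟩
    exact h0 i _ ⟨hbox x hx, fun hxK => absurd (hKR _ hxK j) (not_lt.2 hj)⟩
  let e : (Fin 4 → ℝ) →L[ℝ] E4 :=
    ((PiLp.continuousLinearEquiv 2 ℝ fun _ : Fin 4 => ℝ).symm : (Fin 4 → ℝ) →L[ℝ] E4)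
  have he : ∀ x, e x = WithLp.toLp 2 x := fun x => rfl
  have key := integral_divergence_of_hasFDerivAt_off_countable a b hab
    (fun x i => D i (WithLp.toLp 2 x))
    (fun x => ContinuousLinearMap.pi fun i =>
      (fderivWithin ℝ (D i) halfSpace (WithLp.toLp 2 x)).comp e) ∅ Set.countable_empty
    (continuousOn_pi.2 hcont)
    (by
      rintro x ⟨hx, -⟩
      rw [hasFDerivAt_pi]
      intro i
      have hx0 : 0 < x 0 := (hx 0 (Set.mem_univ _)).1
      have hnhds : halfSpace ∈ nhds (WithLp.toLp 2 x : E4) := by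
        have ho : IsOpen {y : E4 | 0 < y 0} :=
          isOpen_lt continuous_const (PiLp.continuous_apply 2 _ 0)
        exact Filter.mem_of_superset (ho.mem_nhds hx0) fun y hy => mem_halfSpace.2 (le_of_lt hy)
      have hd := (isRelOpen_halfSpace.differentiableWithinAt (hD i)
        (mem_of_mem_nhds hnhds)).hasFDerivWithinAt.hasFDerivAt hnhds
      exact HasFDerivAt.comp x (by simpa only [he] using hd) e.hasFDerivAt)
    (by
      refine ContinuousOn.integrableOn_compact isCompact_Icc ?_
      exact continuousOn_finsetSum _ fun i _ => hpdc i)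
  have hlhs : (∫ y in K, ∑ i, pd i (D i) y) =
      ∫ x in Set.Icc a b, ∑ i, pd i (D i) (WithLp.toLp 2 x) := by
    rw [← (PiLp.volume_preserving_toLp (Fin 4)).setIntegral_preimage_emb
      (MeasurableEquiv.toLp 2 (Fin 4 → ℝ)).measurableEmbedding]
    refine (setIntegral_eq_of_subset_of_forall_sdiff_eq_zero measurableSet_Icc ?_ ?_).symm
    · intro x hx
      have h1 := hKR _ hx
      have h2 := mem_halfSpace.1 (hKH hx)
      refine ⟨fun i => ?_, fun i => (le_abs_self _).trans (h1 i).le⟩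
      refine Fin.cases ?_ (fun i => ?_) i
      · exact h2
      · rw [has]; exact (abs_lt.1 (h1 i.succ)).1.le
    · rintro x ⟨hx, hxK⟩
      exact Finset.sum_eq_zero fun i _ => pd_eq_zero_of_eqOn
        (isRelOpen_halfSpace.diff hK.isClosed) (h0 i) ⟨hbox x hx, hxK⟩ i
  have hrhs : ∫ z in {z | boundaryPoint z ∈ K}, D 0 (boundaryPoint z) =
      ∫ x in Set.Icc (a ∘ (0 : Fin 4).succAbove) (b ∘ (0 : Fin 4).succAbove),
        D 0 (WithLp.toLp 2 ((0 : Fin 4).insertNth (a 0) x)) := by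
    rw [← (PiLp.volume_preserving_toLp (Fin 3)).setIntegral_preimage_emb
      (MeasurableEquiv.toLp 2 (Fin 3 → ℝ)).measurableEmbedding]
    have hbp : ∀ x : Fin 3 → ℝ, boundaryPoint (WithLp.toLp 2 x) =
        WithLp.toLp 2 ((0 : Fin 4).insertNth (a 0) x) := fun x => by
      rw [boundaryPoint, Fin.insertNth_zero']; rfl
    simp only [← hbp]
    refine (setIntegral_eq_of_subset_of_forall_sdiff_eq_zero measurableSet_Icc ?_ ?_).symm
    · intro x hx
      have h1 := fun i : Fin 3 => abs_lt.1 (hKR _ hx i.succ)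
      refine ⟨fun i => (h1 i).1.le, fun i => (h1 i).2.le⟩
    · rintro x ⟨hx, hxK⟩
      exact h0 0 _ ⟨mem_halfSpace.2 le_rfl, hxK⟩
  have hins : ∀ (i : Fin 4) (c : ℝ), a i ≤ c → c ≤ b i → ∀ x ∈ Set.Icc (a ∘ i.succAbove)
      (b ∘ i.succAbove), (i.insertNth c x : Fin 4 → ℝ) ∈ Set.Icc a b := by
    intro i c h1 h2 x hx
    rw [Fin.insertNth_mem_Icc]
    exact ⟨⟨h1, h2⟩, hx⟩
  have hRabs : |R| = R := abs_of_pos hRpos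
  rw [hlhs, hrhs]
  have hL : (∫ x in Set.Icc a b, ∑ i, pd i (D i) (WithLp.toLp 2 x)) =
      ∑ i : Fin 4, ((∫ x in Set.Icc (a ∘ i.succAbove) (b ∘ i.succAbove),
          D i (WithLp.toLp 2 (i.insertNth (b i) x))) -
        ∫ x in Set.Icc (a ∘ i.succAbove) (b ∘ i.succAbove),
          D i (WithLp.toLp 2 (i.insertNth (a i) x))) := key
  rw [hL, Fin.sum_univ_succ]
  have hz : ∀ i : Fin 4, (∫ x in Set.Icc (a ∘ i.succAbove) (b ∘ i.succAbove),
      D i (WithLp.toLp 2 (i.insertNth (b i) x))) = 0 := fun i =>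
    setIntegral_eq_zero_of_forall_eq_zero fun x hx =>
      hout i _ (hins i _ (hab i) le_rfl x hx) ⟨i, by
        rw [Fin.insertNth_apply_same]; exact hRabs.ge⟩
  have hz' : ∀ i : Fin 3, (∫ x in Set.Icc (a ∘ i.succ.succAbove) (b ∘ i.succ.succAbove),
      D i.succ (WithLp.toLp 2 (i.succ.insertNth (a i.succ) x))) = 0 := fun i =>
    setIntegral_eq_zero_of_forall_eq_zero fun x hx =>
      hout i.succ _ (hins i.succ _ le_rfl (hab i.succ) x hx) ⟨i.succ, by
        rw [Fin.insertNth_apply_same, has, abs_neg]; exact hRabs.ge⟩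
  simp only [hz, hz', sub_self, Finset.sum_const_zero]
  ring

/-- The divergence theorem for a vector field on a relatively open set `T` that vanishes outside
the compact set `K ⊆ T`. -/
theorem integral_divergence {D : Fin 4 → E4 → ℝ} {T K : Set E4} (hT : IsRelOpen T)
    (hD : ∀ a, ContDiffOn ℝ ∞ (D a) T) (hK : IsCompact K) (hKT : K ⊆ T)
    (h0 : ∀ a, ∀ y ∈ T \ K, D a y = 0) :
    (∫ y in K, ∑ a, pd a (D a) y) +
      ∫ z in {z | boundaryPoint z ∈ K}, D 0 (boundaryPoint z) = 0 := by
  classical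
  -- Extend `D` by zero to the half-space.
  set D' : Fin 4 → E4 → ℝ := fun a => K.indicator (D a) with hD'
  have h1 : ∀ a, Set.EqOn (D' a) (D a) T := fun a y hy => by
    by_cases h : y ∈ K
    · exact Set.indicator_of_mem h _
    · rw [hD']; simp only [Set.indicator_of_notMem h, h0 a y ⟨hy, h⟩]
  have h2 : ∀ a, ∀ y ∈ halfSpace \ K, D' a y = 0 := fun a y hy => Set.indicator_of_notMem hy.2 _
  have h3 : ∀ a, ContDiffOn ℝ ∞ (D' a) halfSpace := by
    intro a y hy
    by_cases h : y ∈ T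
    · exact (((hD a).congr (h1 a)) y h).mono_of_mem_nhdsWithin (hT.mem_nhds y h)
    · have h4 : y ∈ halfSpace \ K := ⟨hy, fun h' => h (hKT h')⟩
      exact ((contDiffOn_const (c := (0 : ℝ))).congr (h2 a) y h4).mono_of_mem_nhdsWithin
        ((isRelOpen_halfSpace.diff hK.isClosed).mem_nhds y h4)
  have key := integral_divergence_halfSpace h3 hK (hKT.trans hT.subset) h2
  have hmeas := (isCompact_boundaryPoint_preimage hK).measurableSet
  rw [← key]
  congr 1
  · refine MeasureTheory.setIntegral_congr_fun hK.measurableSet fun y hy => ?_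
    exact Finset.sum_congr rfl fun a _ => (hT.pd_congr (h1 a) (hKT hy) a).symm
  · exact MeasureTheory.setIntegral_congr_fun hmeas fun z hz => (h1 0 (hKT hz)).symm

/-! ### Comparison of the two actions -/

section
variable {T K : Set E4} {G G' : MetricComp} {Q Q' C : ConnComp}

lemma continuousOn_bulkLagrangian (hT : IsRelOpen T) (h : IsRegularMetric G T)
    (hC : ConnSmoothOn C T) (Λ : ℝ) : ContinuousOn (bulkLagrangian Λ G C) T := by
  have h1 : ∀ a b c d, ContDiffOn ℝ ∞ (fun y => riemann C y a b c d) T := fun a b c d =>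
    ((hT.contDiffOn_pd (hC a d b) c).sub (hT.contDiffOn_pd (hC a c b) d)).add
      (ContDiffOn.sum fun l _ => ((hC a c l).mul (hC l d b)).sub ((hC a d l).mul (hC l c b)))
  have h2 : ContDiffOn ℝ ∞ (scalarCurvature G C) T :=
    ContDiffOn.sum fun b _ => ContDiffOn.sum fun d _ => (h.inv_smooth b d).mul
      (ContDiffOn.sum fun a _ => h1 a b a d)
  exact ((h2.sub contDiffOn_const).mul h.sqrt_smooth).continuousOn

lemma continuousOn_boundaryLagrangian (hT : IsRelOpen T) (h : IsRegularMetric G T)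
    (hC : ConnSmoothOn C T) : ContinuousOn (boundaryLagrangian G C) {y ∈ T | y 0 = 0} := by
  -- The normal is smooth where `g^{00} > 0`, which is a neighbourhood of the boundary points.
  set T' : Set E4 := {y ∈ T | 0 < (G y)⁻¹ 0 0} with hT'
  have hT'o : IsRelOpen T' := hT.sep_pos (h.inv_smooth 0 0).continuousOn
  have hsub : T' ⊆ T := fun y hy => hy.1
  have hB : {y ∈ T | y 0 = 0} ⊆ T' := fun y hy => ⟨hy.1, h.inv_zero_zero_pos hy.1 hy.2⟩
  have hs : ContDiffOn ℝ ∞ (fun y => √((G y)⁻¹ 0 0)) T' :=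
    ((h.inv_smooth 0 0).mono hsub).sqrt fun y hy => hy.2.ne'
  have hup : ∀ a, ContDiffOn ℝ ∞ (fun y => normalUp G y a) T' := fun a =>
    ((h.inv_smooth a 0).mono hsub).neg.div hs fun y hy => (Real.sqrt_pos.2 hy.2).ne'
  have hG := h.smooth.mono hsub
  have hC' := hC.mono hsub
  have hdown : ∀ a, ContDiffOn ℝ ∞ (fun y => normalDown G y a) T' := fun a =>
    ContDiffOn.sum fun b _ => (hG a b).mul (hup b)
  have hext : ∀ a b, ContDiffOn ℝ ∞ (fun y => extrinsic G C y a b) T' := fun a b =>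
    contDiffOn_const.mul (((hT'o.contDiffOn_pd (hdown _) _).sub
      (ContDiffOn.sum fun c _ => (hC' _ _ _).mul (hdown c))).add
      (ContDiffOn.sum fun c _ => (hG _ c).mul ((hT'o.contDiffOn_pd (hup c) _).add
        (ContDiffOn.sum fun l _ => (hC' _ _ _).mul (hup l)))))
  have hI : MatSmoothOn (inducedMetric G) {y ∈ T | y 0 = 0} := fun a b =>
    (h.smooth a.succ b.succ).mono fun y hy => hy.1
  have hI' := hI.inv fun y hy => (h.det_induced_neg y hy.1 hy.2).ne
  have htr : ContinuousOn (extrinsicTrace G C) {y ∈ T | y 0 = 0} :=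
    continuousOn_finsetSum _ fun a _ => continuousOn_finsetSum _ fun b _ =>
      (hI' a b).continuousOn.mul ((hext a b).continuousOn.mono hB)
  exact (continuousOn_const.mul htr).mul hI.det.continuousOn.abs.sqrt

lemma continuousOn_quadLagrangian (h : IsRegularMetric G T) (hQ : ConnSmoothOn Q T) :
    ContinuousOn (quadLagrangian G Q) T :=
  ((ContDiffOn.sum fun b _ => ContDiffOn.sum fun d _ => (h.inv_smooth b d).mul
    (ContDiffOn.sum fun a _ => ContDiffOn.sum fun l _ =>
      ((hQ a a l).mul (hQ l d b)).sub ((hQ a d l).mul (hQ l a b)))).mul h.sqrt_smooth).continuousOn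

open MeasureTheory in
/-- The Palatini action is the Einstein-Hilbert action plus the integral of the quadratic
Lagrangian, up to the divergence of a vector field in the bulk and its flux through the boundary. -/
theorem palatiniAction_sub_einsteinHilbertAction (hT : IsRelOpen T) (hK : IsCompact K)
    (hKT : K ⊆ T) (h : IsRegularMetric G T) (hQ : ConnSmoothOn Q T) (Λ : ℝ) :
    palatiniAction Λ G Q K - einsteinHilbertAction Λ G K = (∫ y in K, quadLagrangian G Q y) +
      ((∫ y in K, ∑ a, pd a (divDensity G Q a) y) +
        ∫ z in {z | boundaryPoint z ∈ K}, divDensity G Q 0 (boundaryPoint z)) := by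
  have hC := hQ.connection hT h
  have hΓ := h.christoffel_smooth hT
  have hKb := isCompact_boundaryPoint_preimage hK
  have i1 := ((continuousOn_bulkLagrangian hT h hC Λ).mono hKT).integrableOn_compact
    (μ := volume) hK
  have i2 := ((continuousOn_bulkLagrangian hT h hΓ Λ).mono hKT).integrableOn_compact
    (μ := volume) hK
  have i3 := ((continuousOn_quadLagrangian h hQ).mono hKT).integrableOn_compact (μ := volume) hK
  have i4 : IntegrableOn (fun y => ∑ a, pd a (divDensity G Q a) y) K :=
    ContinuousOn.integrableOn_compact hK (continuousOn_finsetSum _ fun a _ =>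
      (hT.contDiffOn_pd (h.divDensity_smooth hQ a) a).continuousOn.mono hKT)
  have hb : ∀ z ∈ {z | boundaryPoint z ∈ K}, boundaryPoint z ∈ {y ∈ T | y 0 = 0} :=
    fun z hz => ⟨hKT hz, rfl⟩
  have b1 := ((continuousOn_boundaryLagrangian hT h hC).comp
    continuous_boundaryPoint.continuousOn hb).integrableOn_compact (μ := volume) hKb
  have b2 := ((continuousOn_boundaryLagrangian hT h hΓ).comp
    continuous_boundaryPoint.continuousOn hb).integrableOn_compact (μ := volume) hKb
  have e1 : (∫ y in K, bulkLagrangian Λ G (connection G Q) y)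
      - (∫ y in K, bulkLagrangian Λ G (christoffel G) y) =
      (∫ y in K, ∑ a, pd a (divDensity G Q a) y) + ∫ y in K, quadLagrangian G Q y := by
    rw [← integral_sub i1 i2, ← integral_add i4 i3]
    exact setIntegral_congr_fun hK.measurableSet fun y hy =>
      bulkLagrangian_sub hT h hQ (hKT hy) Λ
  have e2 : (∫ z in {z | boundaryPoint z ∈ K}, boundaryLagrangian G (connection G Q)
        (boundaryPoint z))
      - (∫ z in {z | boundaryPoint z ∈ K}, boundaryLagrangian G (christoffel G)
        (boundaryPoint z)) =
      -∫ z in {z | boundaryPoint z ∈ K}, divDensity G Q 0 (boundaryPoint z) := by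
    refine (integral_sub b1 b2).symm.trans ?_
    rw [← integral_neg]
    exact setIntegral_congr_fun hKb.measurableSet fun z hz =>
      boundaryLagrangian_sub h (hKT hz) rfl Q
  rw [palatiniAction, einsteinHilbertAction, action, action]
  linarith

/-- If two pairs of fields agree outside `K`, then their divergence terms over `K` agree, by the
divergence theorem for the difference of the two vector densities, which vanishes outside `K`. -/
theorem palatiniAction_sub_eq_of_eqOn (hT : IsRelOpen T) (hK : IsCompact K) (hKT : K ⊆ T)
    (h : IsRegularMetric G T) (hQ : ConnSmoothOn Q T) (h' : IsRegularMetric G' T)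
    (hQ' : ConnSmoothOn Q' T) (hG : ∀ y ∈ T \ K, G' y = G y) (hQQ : ∀ y ∈ T \ K, Q' y = Q y)
    (Λ : ℝ) :
    palatiniAction Λ G' Q' K - einsteinHilbertAction Λ G' K - ∫ y in K, quadLagrangian G' Q' y =
      palatiniAction Λ G Q K - einsteinHilbertAction Λ G K - ∫ y in K, quadLagrangian G Q y := by
  have hs := fun a => h.divDensity_smooth hQ a
  have hs' := fun a => h'.divDensity_smooth hQ' a
  have key := integral_divergence (D := fun a y => divDensity G' Q' a y - divDensity G Q a y) hT
    (fun a => (hs' a).sub (hs a)) hK hKT fun a y hy => by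
      simp only [divDensity, hG y hy, hQQ y hy, sub_self]
  have e1 : (∫ y in K, ∑ a, pd a (fun y => divDensity G' Q' a y - divDensity G Q a y) y) =
      (∫ y in K, ∑ a, pd a (divDensity G' Q' a) y) - ∫ y in K, ∑ a, pd a (divDensity G Q a) y := by
    rw [← MeasureTheory.integral_sub]
    · refine MeasureTheory.setIntegral_congr_fun hK.measurableSet fun y hy => ?_
      show _ = _ - _
      rw [← Finset.sum_sub_distrib]
      exact Finset.sum_congr rfl fun a _ => pd_sub hT (hKT hy) a (hs' a) (hs a)
    · exact ContinuousOn.integrableOn_compact hK (continuousOn_finsetSum _ fun a _ =>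
        (hT.contDiffOn_pd (hs' a) a).continuousOn.mono hKT)
    · exact ContinuousOn.integrableOn_compact hK (continuousOn_finsetSum _ fun a _ =>
        (hT.contDiffOn_pd (hs a) a).continuousOn.mono hKT)
  have hKb := isCompact_boundaryPoint_preimage hK
  have e2 : (∫ z in {z | boundaryPoint z ∈ K},
        (divDensity G' Q' 0 (boundaryPoint z) - divDensity G Q 0 (boundaryPoint z))) =
      (∫ z in {z | boundaryPoint z ∈ K}, divDensity G' Q' 0 (boundaryPoint z)) -
        ∫ z in {z | boundaryPoint z ∈ K}, divDensity G Q 0 (boundaryPoint z) :=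
    MeasureTheory.integral_sub
      (((hs' 0).continuousOn.comp continuous_boundaryPoint.continuousOn
        fun z hz => hKT hz).integrableOn_compact hKb)
      (((hs 0).continuousOn.comp continuous_boundaryPoint.continuousOn
        fun z hz => hKT hz).integrableOn_compact hKb)
  rw [e1, e2] at key
  rw [palatiniAction_sub_einsteinHilbertAction hT hK hKT h' hQ',
    palatiniAction_sub_einsteinHilbertAction hT hK hKT h hQ]
  linarith

end

/-! ### One-parameter families that are Lipschitz at `t = 0` -/

open Filter Asymptotics

/-- The filter of pairs `(t, y)` with `t → 0`, uniformly in `y ∈ K`. -/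
abbrev unifFilter (K : Set E4) : Filter (ℝ × E4) := nhds 0 ×ˢ 𝓟 K

/-- Near `t = 0`, the function `φ t` is bounded on `K` and `φ t - φ 0 = O(t)`, uniformly on `K`. -/
structure LipAtZero (K : Set E4) (φ : ℝ → E4 → ℝ) : Prop where
  bdd : (fun p : ℝ × E4 => φ p.1 p.2) =O[unifFilter K] fun _ => (1 : ℝ)
  lip : (fun p : ℝ × E4 => φ p.1 p.2 - φ 0 p.2) =O[unifFilter K] fun p => p.1

section
variable {K : Set E4} {φ ψ : ℝ → E4 → ℝ}

lemma isBigO_fst_one : (fun p : ℝ × E4 => p.1) =O[unifFilter K] fun _ => (1 : ℝ) :=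
  (tendsto_fst (f := nhds (0 : ℝ)) (g := 𝓟 K)).isBigO_one ℝ

lemma isBigO_one_of_continuousOn (hK : IsCompact K) {f : E4 → ℝ} (hf : ContinuousOn f K) :
    (fun p : ℝ × E4 => f p.2) =O[unifFilter K] fun _ => (1 : ℝ) := by
  obtain ⟨C, hC⟩ := hK.exists_bound_of_continuousOn hf
  refine IsBigO.of_bound C (eventually_prod_principal_iff.2 (Eventually.of_forall fun t y hy => ?_))
  simpa using hC y hy

lemma LipAtZero.of_continuousOn (hK : IsCompact K) {f : E4 → ℝ} (hf : ContinuousOn f K) :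
    LipAtZero K fun _ => f :=
  ⟨isBigO_one_of_continuousOn hK hf, by simpa using isBigO_zero _ _⟩

lemma LipAtZero.const (c : ℝ) : LipAtZero K fun _ _ => c :=
  ⟨isBigO_const_const _ one_ne_zero _, by simpa using isBigO_zero _ _⟩

/-- The value at `t = 0` is bounded. -/
lemma LipAtZero.bdd_zero (h : LipAtZero K φ) :
    (fun p : ℝ × E4 => φ 0 p.2) =O[unifFilter K] fun _ => (1 : ℝ) := by
  have := h.bdd.sub (h.lip.trans isBigO_fst_one)
  simpa using this

lemma LipAtZero.add (h : LipAtZero K φ) (h' : LipAtZero K ψ) :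
    LipAtZero K fun t y => φ t y + ψ t y :=
  ⟨h.bdd.add h'.bdd, (h.lip.add h'.lip).congr_left fun p => by ring⟩

lemma LipAtZero.mul (h : LipAtZero K φ) (h' : LipAtZero K ψ) :
    LipAtZero K fun t y => φ t y * ψ t y := by
  refine ⟨(h.bdd.mul h'.bdd).congr_right fun p => by simp, ?_⟩
  have h1 := (h.lip.mul h'.bdd).add ((h'.lip.mul h.bdd_zero).congr_right fun p => rfl)
  exact (h1.congr_left fun p => by ring).congr_right fun p => by simp

lemma LipAtZero.neg (h : LipAtZero K φ) : LipAtZero K fun t y => -φ t y :=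
  ⟨h.bdd.neg_left, h.lip.neg_left.congr_left fun p => by ring⟩

lemma LipAtZero.sub (h : LipAtZero K φ) (h' : LipAtZero K ψ) :
    LipAtZero K fun t y => φ t y - ψ t y := by
  simpa only [sub_eq_add_neg] using h.add h'.neg

lemma LipAtZero.sum {ι : Type*} (s : Finset ι) {F : ι → ℝ → E4 → ℝ}
    (h : ∀ i ∈ s, LipAtZero K (F i)) : LipAtZero K fun t y => ∑ i ∈ s, F i t y := by
  classical
  induction s using Finset.induction_on with
  | empty => simpa using LipAtZero.const 0
  | insert i s hi ih =>
    simp only [Finset.sum_insert hi]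
    exact (h i (Finset.mem_insert_self _ _)).add
      (ih fun j hj => h j (Finset.mem_insert_of_mem hj))

lemma LipAtZero.prod {ι : Type*} (s : Finset ι) {F : ι → ℝ → E4 → ℝ}
    (h : ∀ i ∈ s, LipAtZero K (F i)) : LipAtZero K fun t y => ∏ i ∈ s, F i t y := by
  classical
  induction s using Finset.induction_on with
  | empty => simpa using LipAtZero.const 1
  | insert i s hi ih =>
    simp only [Finset.prod_insert hi]
    exact (h i (Finset.mem_insert_self _ _)).mul
      (ih fun j hj => h j (Finset.mem_insert_of_mem hj))

lemma LipAtZero.mono {K' : Set E4} (h : LipAtZero K φ) (hK : K' ⊆ K) : LipAtZero K' φ := by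
  have hl : unifFilter K' ≤ unifFilter K := prod_mono le_rfl (principal_mono.2 hK)
  exact ⟨h.bdd.mono hl, h.lip.mono hl⟩

lemma LipAtZero.id : LipAtZero K fun t _ => t :=
  ⟨isBigO_fst_one, by simpa using isBigO_refl _ _⟩

lemma LipAtZero.eventually_abs_sub_lt (h : LipAtZero K φ) {c : ℝ} (hc : 0 < c) :
    ∀ᶠ t in nhds (0 : ℝ), ∀ y ∈ K, |φ t y - φ 0 y| < c := by
  have h0 : Tendsto (fun p : ℝ × E4 => φ p.1 p.2 - φ 0 p.2) (unifFilter K) (nhds 0) :=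
    h.lip.trans_tendsto tendsto_fst
  have := h0.eventually (Metric.ball_mem_nhds 0 hc)
  have := eventually_prod_principal_iff.1 this
  simpa [Real.dist_eq] using this

lemma LipAtZero.eventually_neg (hK : IsCompact K) (h : LipAtZero K φ)
    (hc : ContinuousOn (φ 0) K) (h0 : ∀ y ∈ K, φ 0 y < 0) :
    ∀ᶠ t in nhds (0 : ℝ), ∀ y ∈ K, φ t y < 0 := by
  rcases K.eq_empty_or_nonempty with rfl | hne
  · simp
  obtain ⟨y₀, hy₀, hmax⟩ := hK.exists_isMaxOn hne hc
  filter_upwards [h.eventually_abs_sub_lt (neg_pos.2 (h0 y₀ hy₀))] with t ht y hy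
  have h1 := (abs_lt.1 (ht y hy)).2
  have h2 : φ 0 y ≤ φ 0 y₀ := hmax hy
  linarith

lemma LipAtZero.inv (hK : IsCompact K) (h : LipAtZero K φ) (hc : ContinuousOn (φ 0) K)
    (h0 : ∀ y ∈ K, φ 0 y ≠ 0) : LipAtZero K fun t y => (φ t y)⁻¹ := by
  rcases K.eq_empty_or_nonempty with rfl | hne
  · have : unifFilter ∅ = ⊥ := by simp [unifFilter]
    constructor <;> (rw [this]; exact isBigO_bot _ _)
  obtain ⟨y₀, hy₀, hmin⟩ := hK.exists_isMinOn hne hc.abs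
  have hpos : 0 < |φ 0 y₀| := abs_pos.2 (h0 y₀ hy₀)
  have hev : ∀ᶠ p in unifFilter K, φ p.1 p.2 ≠ 0 ∧ φ 0 p.2 ≠ 0 ∧
      |(φ p.1 p.2)⁻¹| ≤ (|φ 0 y₀| / 2)⁻¹ := by
    refine eventually_prod_principal_iff.2 ?_
    filter_upwards [h.eventually_abs_sub_lt (half_pos hpos)] with t ht y hy
    have h1 := ht y hy
    have h2 : |φ 0 y₀| ≤ |φ 0 y| := hmin hy
    have h3 : |φ 0 y₀| / 2 ≤ |φ t y| := by
      have := abs_sub_abs_le_abs_sub (φ 0 y) (φ t y)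
      rw [abs_sub_comm] at this
      linarith
    refine ⟨abs_pos.1 ((half_pos hpos).trans_le h3), h0 y hy, ?_⟩
    rw [abs_inv]
    exact inv_anti₀ (half_pos hpos) h3
  have hb : (fun p : ℝ × E4 => (φ p.1 p.2)⁻¹) =O[unifFilter K] fun _ => (1 : ℝ) := by
    refine IsBigO.of_bound (|φ 0 y₀| / 2)⁻¹ (hev.mono fun p hp => ?_)
    simpa using hp.2.2
  have hb0 : (fun p : ℝ × E4 => (φ 0 p.2)⁻¹) =O[unifFilter K] fun _ => (1 : ℝ) :=
    isBigO_one_of_continuousOn hK (hc.inv₀ h0)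
  refine ⟨hb, ?_⟩
  have h1 := (h.lip.neg_left.mul hb).mul hb0
  refine (h1.congr' ?_ ?_)
  · filter_upwards [hev] with p hp
    have := hp.1
    have := hp.2.1
    field_simp
    ring
  · exact Eventually.of_forall fun p => by simp

end

/-! ### Families of matrices -/

/-- The entries of the family `A t` of matrix-valued functions are Lipschitz at `t = 0`. -/
def MatLipAtZero {n m : Type*} (K : Set E4) (A : ℝ → E4 → Matrix n m ℝ) : Prop :=
  ∀ i j, LipAtZero K fun t y => A t y i j

section
variable {n : Type*} [Fintype n] [DecidableEq n] {K : Set E4} {A B : ℝ → E4 → Matrix n n ℝ}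

omit [DecidableEq n] in
lemma MatLipAtZero.mul (hA : MatLipAtZero K A) (hB : MatLipAtZero K B) :
    MatLipAtZero K fun t y => A t y * B t y := fun i j => by
  simp only [Matrix.mul_apply]
  exact LipAtZero.sum _ fun k _ => (hA i k).mul (hB k j)

omit [Fintype n] [DecidableEq n] in
lemma MatLipAtZero.add_smul {A₀ A₁ : E4 → Matrix n n ℝ} (hK : IsCompact K)
    (h₀ : ∀ i j, ContinuousOn (fun y => A₀ y i j) K)
    (h₁ : ∀ i j, ContinuousOn (fun y => A₁ y i j) K) :
    MatLipAtZero K fun t => A₀ + t • A₁ := fun i j =>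
  (LipAtZero.of_continuousOn hK (h₀ i j)).add
    (LipAtZero.id.mul (LipAtZero.of_continuousOn hK (h₁ i j)))

lemma MatLipAtZero.det (hA : MatLipAtZero K A) : LipAtZero K fun t y => (A t y).det := by
  simp only [Matrix.det_apply, Units.smul_def, zsmul_eq_mul]
  exact LipAtZero.sum _ fun σ _ => (LipAtZero.const _).mul (LipAtZero.prod _ fun i _ => hA _ _)

lemma MatLipAtZero.adjugate (hA : MatLipAtZero K A) :
    MatLipAtZero K fun t y => (A t y).adjugate := by
  intro i j
  simp only [Matrix.adjugate_apply]
  refine MatLipAtZero.det (A := fun t y => (A t y).updateRow j (Pi.single i 1)) fun a b => ?_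
  by_cases h : a = j
  · subst h; simp only [Matrix.updateRow_self]; exact LipAtZero.const _
  · simp only [Matrix.updateRow_ne h]; exact hA a b

lemma MatLipAtZero.inv (hK : IsCompact K) (hA : MatLipAtZero K A)
    (hc : ∀ i j, ContinuousOn (fun y => A 0 y i j) K) (h0 : ∀ y ∈ K, (A 0 y).det ≠ 0) :
    MatLipAtZero K fun t y => (A t y)⁻¹ := by
  intro i j
  simp only [Matrix.inv_def, Ring.inverse_eq_inv', Matrix.smul_apply, smul_eq_mul]
  refine (LipAtZero.inv hK hA.det ?_ h0).mul (hA.adjugate i j)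
  simp only [Matrix.det_apply, Units.smul_def, zsmul_eq_mul]
  exact continuousOn_finsetSum _ fun σ _ => continuousOn_const.mul
    (continuousOn_finsetProd _ fun i _ => hc _ _)

end

/-! ### First-order comparison of the two actions along a family -/

section
variable {T K : Set E4} {G : ℝ → MetricComp} {Q D : ℝ → ConnComp}

/-- The conditions on the metric are open: they persist for small `t` along a family that varies in
a compact set only. -/
lemma eventually_isRegularMetric (hK : IsCompact K) (hKT : K ⊆ T)
    (hs : ∀ t, MatSmoothOn (G t) T) (hsymm : ∀ t, ∀ y ∈ T, (G t y).IsSymm)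
    (hL : MatLipAtZero K G) (h0 : IsRegularMetric (G 0) T)
    (hG : ∀ t, ∀ y ∈ T \ K, G t y = G 0 y) : ∀ᶠ t in nhds 0, IsRegularMetric (G t) T := by
  have hKb : IsCompact {y ∈ K | y 0 = 0} :=
    hK.inter_right (isClosed_eq (PiLp.continuous_apply 2 _ 0) continuous_const)
  have hL' : MatLipAtZero {y ∈ K | y 0 = 0} fun t y => inducedMetric (G t) y := fun a b =>
    (hL a.succ b.succ).mono fun y hy => hy.1
  have hs' : MatSmoothOn (inducedMetric (G 0)) T := fun a b => hs 0 a.succ b.succ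
  have e1 := hL.det.eventually_neg hK ((hs 0).det.continuousOn.mono hKT)
    fun y hy => h0.det_neg y (hKT hy)
  have e2 := hL'.det.eventually_neg hKb
    (hs'.det.continuousOn.mono fun y hy => hKT hy.1)
    fun y hy => h0.det_induced_neg y (hKT hy.1) hy.2
  filter_upwards [e1, e2] with t h1 h2
  refine ⟨hs t, hsymm t, fun y hy => ?_, fun y hy hy0 => ?_⟩
  · by_cases hyK : y ∈ K
    · exact h1 y hyK
    · rw [hG t y ⟨hy, hyK⟩]; exact h0.det_neg y hy
  · by_cases hyK : y ∈ K
    · exact h2 y ⟨hyK, hy0⟩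
    · rw [inducedMetric, hG t y ⟨hy, hyK⟩]; exact h0.det_induced_neg y hy hy0

/-- Along a family of fields that varies in `K` only, the difference of the Palatini and the
Einstein-Hilbert action has the derivative of the integral of the quadratic Lagrangian. -/
theorem hasDerivAt_palatiniAction_sub (hT : IsRelOpen T) (hK : IsCompact K) (hKT : K ⊆ T)
    (hreg : ∀ᶠ t in nhds 0, IsRegularMetric (G t) T ∧ ConnSmoothOn (Q t) T)
    (hG : ∀ t, ∀ y ∈ T \ K, G t y = G 0 y) (hQ : ∀ t, ∀ y ∈ T \ K, Q t y = Q 0 y) (Λ d : ℝ)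
    (hd : HasDerivAt (fun t => ∫ y in K, quadLagrangian (G t) (Q t) y) d 0) :
    HasDerivAt (fun t => palatiniAction Λ (G t) (Q t) K - einsteinHilbertAction Λ (G t) K) d 0 := by
  have h0 := hreg.self_of_nhds
  refine (hd.add_const (palatiniAction Λ (G 0) (Q 0) K - einsteinHilbertAction Λ (G 0) K
    - ∫ y in K, quadLagrangian (G 0) (Q 0) y)).congr_of_eventuallyEq ?_
  filter_upwards [hreg] with t ht
  have := palatiniAction_sub_eq_of_eqOn hT hK hKT h0.1 h0.2 ht.1 ht.2 (hG t) (hQ t) Λ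
  linarith

/-- If `Q t` is of the form `δ^a_c U_b` up to `O(t)`, then the integral of the quadratic Lagrangian
is `O(t²)`. -/
theorem hasDerivAt_integral_quadLagrangian (hK : IsCompact K)
    (hL : MatLipAtZero K G) (hc : ∀ i j, ContinuousOn (fun y => G 0 y i j) K)
    (h0 : ∀ y ∈ K, (G 0 y).det ≠ 0) (U : E4 → Fin 4 → ℝ)
    (hD : ∀ a b c, (fun p : ℝ × E4 => D p.1 p.2 a b c) =O[unifFilter K] fun p => p.1)
    (hQ : ∀ᶠ t in nhds 0, ∀ y ∈ K, Q t y = pureTrace (U y) + D t y) :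
    HasDerivAt (fun t => ∫ y in K, quadLagrangian (G t) (Q t) y) 0 0 := by
  have hinv := hL.inv hK hc h0
  have hsqrt : (fun p : ℝ × E4 => √|(G p.1 p.2).det|) =O[unifFilter K] fun _ => (1 : ℝ) := by
    obtain ⟨C, hC⟩ := hL.det.bdd.bound
    refine IsBigO.of_bound √C (hC.mono fun p hp => ?_)
    simp only [norm_one, mul_one, Real.norm_eq_abs] at hp ⊢
    rw [abs_of_nonneg (Real.sqrt_nonneg _)]
    exact Real.sqrt_le_sqrt hp
  have hq : (fun p : ℝ × E4 => quadForm (G p.1 p.2)⁻¹ (D p.1 p.2) (D p.1 p.2) *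
      √|(G p.1 p.2).det|) =O[unifFilter K] fun p => p.1 ^ 2 := by
    have h1 : (fun p : ℝ × E4 => quadForm (G p.1 p.2)⁻¹ (D p.1 p.2) (D p.1 p.2))
        =O[unifFilter K] fun p => p.1 ^ 2 := by
      unfold quadForm
      refine IsBigO.fun_sum fun b _ => IsBigO.fun_sum fun d _ => ?_
      have h2 : (fun p : ℝ × E4 => ∑ a, ∑ l, (D p.1 p.2 a a l * D p.1 p.2 l d b
          - D p.1 p.2 a d l * D p.1 p.2 l a b)) =O[unifFilter K] fun p => p.1 ^ 2 :=
        IsBigO.fun_sum fun a _ => IsBigO.fun_sum fun l _ =>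
          (((hD a a l).mul (hD l d b)).sub ((hD a d l).mul (hD l a b))).congr_right
            fun p => by ring
      exact ((hinv b d).bdd.mul h2).congr_right fun p => by simp
    exact (h1.mul hsqrt).congr_right fun p => by simp
  obtain ⟨C, hC⟩ := hq.bound
  have hC' := eventually_prod_principal_iff.1 hC
  have hO : (fun t => ∫ y in K, quadLagrangian (G t) (Q t) y) =O[nhds 0]
      fun t => ‖t - (0 : ℝ)‖ ^ 2 := by
    refine IsBigO.of_bound (C * MeasureTheory.volume.real K) ?_
    filter_upwards [hC', hQ] with t ht htQ
    have := MeasureTheory.norm_setIntegral_le_of_norm_le_const (μ := MeasureTheory.volume)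
      (C := C * ‖t ^ 2‖) (f := quadLagrangian (G t) (Q t)) hK.measure_lt_top fun y hy => by
        rw [quadLagrangian, htQ y hy, quadForm_pureTrace_add]
        exact ht y hy
    refine this.trans (le_of_eq ?_)
    simp only [sub_zero, norm_pow, norm_norm]
    ring
  have := (IsBigO.hasFDerivAt (𝕜 := ℝ) hO (by norm_num)).hasDerivAt
  simpa using this

/-- If only `Q` varies, affinely in `t`, then the derivative of the integral of the quadratic
Lagrangian is given by the polar form. -/
theorem hasDerivAt_integral_quadLagrangian_affine {G₀ : MetricComp} {Q₀ q : ConnComp}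
    (hK : IsCompact K) (h : IsRegularMetric G₀ K) (hQ : ConnSmoothOn Q₀ K)
    (hq : ConnSmoothOn q K) :
    HasDerivAt (fun t : ℝ => ∫ y in K, quadLagrangian G₀ (Q₀ + t • q) y)
      (∫ y in K, (quadForm (G₀ y)⁻¹ (Q₀ y) (q y) + quadForm (G₀ y)⁻¹ (q y) (Q₀ y)) *
        √|(G₀ y).det|) 0 := by
  have hform : ∀ {Q q : ConnComp}, ConnSmoothOn Q K → ConnSmoothOn q K →
      ContinuousOn (fun y => quadForm (G₀ y)⁻¹ (Q y) (q y) * √|(G₀ y).det|) K := fun hQ hq =>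
    ((ContDiffOn.sum fun b _ => ContDiffOn.sum fun d _ => (h.inv_smooth b d).mul
      (ContDiffOn.sum fun a _ => ContDiffOn.sum fun l _ =>
        ((hQ a a l).mul (hq l d b)).sub ((hQ a d l).mul (hq l a b)))).mul
      h.sqrt_smooth).continuousOn
  have i1 := (hform hQ hQ).integrableOn_compact (μ := MeasureTheory.volume) hK
  have i2 := (hform hQ hq).integrableOn_compact (μ := MeasureTheory.volume) hK
  have i3 := (hform hq hQ).integrableOn_compact (μ := MeasureTheory.volume) hK
  have i4 := (hform hq hq).integrableOn_compact (μ := MeasureTheory.volume) hK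
  have e : ∀ t : ℝ, ∫ y in K, quadLagrangian G₀ (Q₀ + t • q) y =
      (∫ y in K, quadForm (G₀ y)⁻¹ (Q₀ y) (Q₀ y) * √|(G₀ y).det|) +
      t * ((∫ y in K, (quadForm (G₀ y)⁻¹ (Q₀ y) (q y) + quadForm (G₀ y)⁻¹ (q y) (Q₀ y)) *
        √|(G₀ y).det|)) +
      t ^ 2 * ∫ y in K, quadForm (G₀ y)⁻¹ (q y) (q y) * √|(G₀ y).det| := by
    intro t
    have i5 := (i2.add i3).const_mul t
    rw [← MeasureTheory.integral_const_mul, ← MeasureTheory.integral_const_mul]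
    refine Eq.trans ?_ ((MeasureTheory.integral_add (i1.add i5) (i4.const_mul (t ^ 2))).trans
      (congrArg (· + _) ((MeasureTheory.integral_add i1 i5).trans
        (congrArg (_ + ·) (MeasureTheory.integral_congr_ae (Eventually.of_forall fun y =>
          show t * (_ + _) = _ by rw [← add_mul]))))))
    refine MeasureTheory.integral_congr_ae (Eventually.of_forall fun y => ?_)
    simp only [quadLagrangian, Pi.add_apply, Pi.smul_apply]
    rw [quadForm_add_left, quadForm_add_right, quadForm_add_right, quadForm_smul_left,
      quadForm_smul_left, quadForm_smul_right, quadForm_smul_right]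
    ring
  simp only [e]
  have h1 := ((hasDerivAt_id (0 : ℝ)).mul_const (∫ y in K,
    (quadForm (G₀ y)⁻¹ (Q₀ y) (q y) + quadForm (G₀ y)⁻¹ (q y) (Q₀ y)) * √|(G₀ y).det|)).const_add
    (∫ y in K, quadForm (G₀ y)⁻¹ (Q₀ y) (Q₀ y) * √|(G₀ y).det|)
  have h2 := ((hasDerivAt_id (0 : ℝ)).pow 2).mul_const
    (∫ y in K, quadForm (G₀ y)⁻¹ (q y) (q y) * √|(G₀ y).det|)
  exact (h1.add h2).congr_deriv (by simp)

end

/-! ### Components of tensor fields in a chart -/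

section
variable {M : Type*} [TopologicalSpace M] [ChartedSpace (EuclideanHalfSpace 4) M]

lemma isRelOpen_target (p : M) : IsRelOpen (extChartAt (𝓡∂ 4) p).target :=
  ⟨extChartAt_target_subset_range p, fun _ hy => extChartAt_target_mem_nhdsWithin_of_mem hy⟩

variable [IsManifold (𝓡∂ 4) ∞ M]

/-- The preferred trivialization of the tangent bundle at `p`. -/
abbrev tangentTriv (p : M) := trivializationAt E4 (TangentSpace (𝓡∂ 4) : M → Type) p

lemma symm_mem_baseSet {p : M} {y : E4} (hy : y ∈ (extChartAt (𝓡∂ 4) p).target) :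
    (extChartAt (𝓡∂ 4) p).symm y ∈ (tangentTriv p).baseSet := by
  have := (extChartAt (𝓡∂ 4) p).map_target hy
  rwa [extChartAt_source] at this

section
variable {F : Type*} [NormedAddCommGroup F] [NormedSpace ℝ F] {V : M → Type*}
  [TopologicalSpace (Bundle.TotalSpace F V)] [∀ x, TopologicalSpace (V x)] [FiberBundle F V]
  [∀ x, AddCommGroup (V x)] [∀ x, Module ℝ (V x)] [VectorBundle ℝ F V]
  [ContMDiffVectorBundle ∞ F V (𝓡∂ 4)]

lemma contDiffOn_triv_section (s : ContMDiffSection (𝓡∂ 4) F ∞ V) (p : M)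
    (hb : (trivializationAt F V p).baseSet = (tangentTriv p).baseSet) :
    ContDiffOn ℝ ∞ (fun y : E4 => ((trivializationAt F V p)
      ⟨(extChartAt (𝓡∂ 4) p).symm y, s ((extChartAt (𝓡∂ 4) p).symm y)⟩).2)
      (extChartAt (𝓡∂ 4) p).target := by
  have h1 := ((trivializationAt F V p).contMDiffOn_section_baseSet_iff (IB := 𝓡∂ 4) (n := ∞)
    (s := s)).1 s.contMDiff.contMDiffOn
  exact (h1.comp (contMDiffOn_extChartAt_symm p) fun y hy => by
    rw [hb]; exact symm_mem_baseSet hy).contDiffOn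

/-- A multiple of the section with constant components `c` in a chart, by a function supported in
the chart domain, is a smooth section. -/
lemma exists_section_of_tsupport (p : M) {ψ : M → ℝ} (hψ : ContMDiff (𝓡∂ 4) 𝓘(ℝ, ℝ) ∞ ψ)
    (hb : (trivializationAt F V p).baseSet = (tangentTriv p).baseSet)
    (hs : tsupport ψ ⊆ (chartAt (EuclideanHalfSpace 4) p).source) (c : F) :
    ∃ s : ContMDiffSection (𝓡∂ 4) F ∞ V, (∀ x, ψ x = 0 → s x = 0) ∧
      ∀ x ∈ (tangentTriv p).baseSet, ((trivializationAt F V p) ⟨x, s x⟩).2 = ψ x • c := by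
  set e := trivializationAt F V p with he
  have hloc : ContMDiffOn (𝓡∂ 4) ((𝓡∂ 4).prod 𝓘(ℝ, F)) ∞
      (fun x => (⟨x, e.symm x c⟩ : Bundle.TotalSpace F V)) e.baseSet := by
    rw [e.contMDiffOn_section_baseSet_iff]
    refine (contMDiffOn_const (c := c)).congr fun x hx => ?_
    rw [e.apply_mk_symm hx]
  refine ⟨⟨_, hψ.contMDiffOn.smul_section_of_tsupport e.open_baseSet (by rw [hb]; exact hs) hloc⟩,
    fun x hx => ?_, fun x hx => ?_⟩
  · show ψ x • e.symm x c = 0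
    rw [hx, zero_smul]
  · show (e ⟨x, ψ x • e.symm x c⟩).2 = ψ x • c
    rw [← hb] at hx
    rw [(e.linear ℝ hx).map_smul, e.apply_mk_symm hx]

end

lemma oneForm_triv (p x : M) (θ : TangentSpace (𝓡∂ 4) x →L[ℝ] ℝ) (v : E4) :
    ((trivializationAt (E4 →L[ℝ] ℝ) (fun x : M => TangentSpace (𝓡∂ 4) x →L[ℝ] ℝ) p)
      ⟨x, θ⟩).2 v = θ ((tangentTriv p).symmL ℝ x v) := by
  have := hom_trivializationAt_apply (RingHom.id ℝ) (F₁ := E4)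
    (E₁ := (TangentSpace (𝓡∂ 4) : M → Type)) (F₂ := ℝ) (E₂ := Bundle.Trivial M ℝ) p ⟨x, θ⟩
  erw [this]
  simp [ContinuousLinearMap.inCoordinates]

lemma oneForm_baseSet (p : M) :
    (trivializationAt (E4 →L[ℝ] ℝ) (fun x : M => TangentSpace (𝓡∂ 4) x →L[ℝ] ℝ) p).baseSet =
      (tangentTriv p).baseSet := by
  have := hom_trivializationAt_baseSet (RingHom.id ℝ) (F₁ := E4)
    (E₁ := (TangentSpace (𝓡∂ 4) : M → Type)) (F₂ := ℝ) (E₂ := Bundle.Trivial M ℝ) p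
  exact this.trans (by simp)

lemma covTensor_baseSet (p : M) :
    (trivializationAt (E4 →L[ℝ] E4 →L[ℝ] ℝ) (fun x : M =>
      TangentSpace (𝓡∂ 4) x →L[ℝ] TangentSpace (𝓡∂ 4) x →L[ℝ] ℝ) p).baseSet =
      (tangentTriv p).baseSet := by
  rw [hom_trivializationAt_baseSet, oneForm_baseSet, Set.inter_self]

lemma endo_baseSet (p : M) :
    (trivializationAt (E4 →L[ℝ] E4) (fun x : M =>
      TangentSpace (𝓡∂ 4) x →L[ℝ] TangentSpace (𝓡∂ 4) x) p).baseSet =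
      (tangentTriv p).baseSet := by
  rw [hom_trivializationAt_baseSet, Set.inter_self]

lemma mixedTensor_baseSet (p : M) :
    (trivializationAt (E4 →L[ℝ] E4 →L[ℝ] E4) (fun x : M =>
      TangentSpace (𝓡∂ 4) x →L[ℝ] TangentSpace (𝓡∂ 4) x →L[ℝ] TangentSpace (𝓡∂ 4) x) p).baseSet =
      (tangentTriv p).baseSet := by
  rw [hom_trivializationAt_baseSet, endo_baseSet, Set.inter_self]

lemma covTensor_triv (h : CovTensor M) (p x : M) (hx : x ∈ (tangentTriv p).baseSet) (v w : E4) :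
    ((trivializationAt (E4 →L[ℝ] E4 →L[ℝ] ℝ) (fun x : M =>
      TangentSpace (𝓡∂ 4) x →L[ℝ] TangentSpace (𝓡∂ 4) x →L[ℝ] ℝ) p) ⟨x, h x⟩).2 v w =
      h x ((tangentTriv p).symmL ℝ x v) ((tangentTriv p).symmL ℝ x w) := by
  have := hom_trivializationAt_apply (RingHom.id ℝ) (F₁ := E4)
    (E₁ := (TangentSpace (𝓡∂ 4) : M → Type)) (F₂ := ℝ) (E₂ := Bundle.Trivial M ℝ) p
    ⟨x, h x ((tangentTriv p).symmL ℝ x v)⟩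
  rw [hom_trivializationAt_apply]
  simp only [ContinuousLinearMap.inCoordinates, ContinuousLinearMap.coe_comp, Function.comp_apply,
    Bundle.Trivialization.continuousLinearMapAt_apply]
  rw [Bundle.Trivialization.coe_linearMapAt_of_mem _ (by rw [oneForm_baseSet]; exact hx)]
  beta_reduce
  erw [this]
  simp [ContinuousLinearMap.inCoordinates]

lemma mixedTensor_triv (Q : MixedTensor M) (p x : M) (hx : x ∈ (tangentTriv p).baseSet)
    (v w : E4) :
    ((trivializationAt (E4 →L[ℝ] E4 →L[ℝ] E4) (fun x : M =>
      TangentSpace (𝓡∂ 4) x →L[ℝ] TangentSpace (𝓡∂ 4) x →L[ℝ] TangentSpace (𝓡∂ 4) x) p)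
      ⟨x, Q x⟩).2 v w = (tangentTriv p).continuousLinearMapAt ℝ x
        (Q x ((tangentTriv p).symmL ℝ x v) ((tangentTriv p).symmL ℝ x w)) := by
  rw [hom_trivializationAt_apply]
  simp only [ContinuousLinearMap.inCoordinates, ContinuousLinearMap.coe_comp, Function.comp_apply,
    Bundle.Trivialization.continuousLinearMapAt_apply]
  rw [Bundle.Trivialization.coe_linearMapAt_of_mem _ (by rw [endo_baseSet]; exact hx)]
  beta_reduce
  rw [hom_trivializationAt_apply]
  rfl

lemma contDiffOn_formComp (θ : OneForm M) (p : M) (i : Fin 4) :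
    ContDiffOn ℝ ∞ (fun y => formComp θ p y i) (extChartAt (𝓡∂ 4) p).target := by
  refine ((contDiffOn_triv_section θ p (oneForm_baseSet p)).clm_apply
    (contDiffOn_const (c := EuclideanSpace.single i (1 : ℝ)))).congr fun y hy => ?_
  rw [oneForm_triv]
  rfl

lemma matSmoothOn_covComp (h : CovTensor M) (p : M) :
    MatSmoothOn (covComp h p) (extChartAt (𝓡∂ 4) p).target := by
  intro i j
  refine (((contDiffOn_triv_section h p (covTensor_baseSet p)).clm_apply
    (contDiffOn_const (c := EuclideanSpace.single i (1 : ℝ)))).clm_apply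
    (contDiffOn_const (c := EuclideanSpace.single j (1 : ℝ)))).congr fun y hy => ?_
  rw [covTensor_triv _ _ _ (symm_mem_baseSet hy)]
  rfl

lemma connSmoothOn_mixedComp (Q : MixedTensor M) (p : M) :
    ConnSmoothOn (mixedComp Q p) (extChartAt (𝓡∂ 4) p).target := by
  intro i j k
  have h1 := (((contDiffOn_triv_section Q p (mixedTensor_baseSet p)).clm_apply
    (contDiffOn_const (c := EuclideanSpace.single j (1 : ℝ)))).clm_apply
    (contDiffOn_const (c := EuclideanSpace.single k (1 : ℝ))))
  have h2 := (EuclideanSpace.proj i : E4 →L[ℝ] ℝ).contDiff.comp_contDiffOn h1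
  refine h2.congr fun y hy => ?_
  simp only [Function.comp_apply]
  rw [mixedTensor_triv _ _ _ (symm_mem_baseSet hy)]
  rfl

end

/-! ### Test fields and the fundamental lemma -/

section
variable {M : Type*} [TopologicalSpace M] [ChartedSpace (EuclideanHalfSpace 4) M]
  [IsManifold (𝓡∂ 4) ∞ M]

/-- A smooth 1-form with components `ψ c_i` in the chart at `p`. -/
lemma exists_oneForm_formComp (p : M) {ψ : M → ℝ} (hψ : ContMDiff (𝓡∂ 4) 𝓘(ℝ, ℝ) ∞ ψ)
    (hs : tsupport ψ ⊆ (chartAt (EuclideanHalfSpace 4) p).source) (c : Fin 4 → ℝ) :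
    ∃ u : OneForm M, (∀ x, ψ x = 0 → u x = 0) ∧
      ∀ y ∈ (extChartAt (𝓡∂ 4) p).target, ∀ i,
        formComp u p y i = ψ ((extChartAt (𝓡∂ 4) p).symm y) * c i := by
  obtain ⟨u, hu0, hu⟩ := exists_section_of_tsupport
    (V := fun x : M => TangentSpace (𝓡∂ 4) x →L[ℝ] ℝ) p hψ (oneForm_baseSet p) hs
    (∑ i, c i • (EuclideanSpace.proj i : E4 →L[ℝ] ℝ))
  refine ⟨u, hu0, fun y hy i => ?_⟩
  have h1 := congrArg (fun l : E4 →L[ℝ] ℝ => l (EuclideanSpace.single i (1 : ℝ)))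
    (hu _ (symm_mem_baseSet hy))
  simp only [oneForm_triv] at h1
  refine Eq.trans h1 ?_
  simp

set_option synthInstance.maxHeartbeats 200000 in
/-- A smooth mixed tensor with components `ψ c^i_{jk}` in the chart at `p`. -/
lemma exists_mixedTensor_mixedComp (p : M) {ψ : M → ℝ} (hψ : ContMDiff (𝓡∂ 4) 𝓘(ℝ, ℝ) ∞ ψ)
    (hs : tsupport ψ ⊆ (chartAt (EuclideanHalfSpace 4) p).source)
    (c : Fin 4 → Fin 4 → Fin 4 → ℝ) :
    ∃ q : MixedTensor M, (∀ x, ψ x = 0 → q x = 0) ∧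
      ∀ y ∈ (extChartAt (𝓡∂ 4) p).target,
        mixedComp q p y = ψ ((extChartAt (𝓡∂ 4) p).symm y) • c := by
  let l : Fin 4 → E4 →L[ℝ] ℝ := fun i => EuclideanSpace.proj i
  let C : E4 →L[ℝ] E4 →L[ℝ] E4 := ∑ i, ∑ j, ∑ k, c i j k •
    (l j).smulRight ((l k).smulRight (EuclideanSpace.single i (1 : ℝ) : E4))
  obtain ⟨q, hq0, hq⟩ := exists_section_of_tsupport (F := E4 →L[ℝ] E4 →L[ℝ] E4)
    (V := fun x : M =>
      TangentSpace (𝓡∂ 4) x →L[ℝ] TangentSpace (𝓡∂ 4) x →L[ℝ] TangentSpace (𝓡∂ 4) x) p hψ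
    (mixedTensor_baseSet p) hs C
  refine ⟨q, hq0, fun y hy => ?_⟩
  funext i j k
  have h1 := congrArg (fun L : E4 →L[ℝ] E4 →L[ℝ] E4 => L (EuclideanSpace.single j (1 : ℝ))
    (EuclideanSpace.single k (1 : ℝ)) i) (hq _ (symm_mem_baseSet hy))
  simp only [mixedTensor_triv _ _ _ (symm_mem_baseSet hy)] at h1
  refine Eq.trans h1 ?_
  simp [C, l, Pi.single_apply]

open MeasureTheory in
/-- A function continuous in the coordinates vanishes at a point (which may lie on the boundary) if
its integrals against the bump functions at that point vanish. -/
lemma eq_zero_of_integral_bump [T2Space M] (p : M) {φ : E4 → ℝ}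
    (hφ : ContinuousOn φ (extChartAt (𝓡∂ 4) p).target) {y₀ : E4}
    (hy₀ : y₀ ∈ (extChartAt (𝓡∂ 4) p).target)
    (h : ∀ ψ : SmoothBumpFunction (𝓡∂ 4) ((extChartAt (𝓡∂ 4) p).symm y₀),
      tsupport ψ ⊆ (chartAt (EuclideanHalfSpace 4) p).source →
      ∫ y in extChartAt (𝓡∂ 4) p '' tsupport ψ, ψ ((extChartAt (𝓡∂ 4) p).symm y) * φ y = 0) :
    φ y₀ = 0 := by
  set e := extChartAt (𝓡∂ 4) p with he
  set T := e.target with hT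
  have hTo : IsRelOpen T := isRelOpen_target p
  set x₀ := e.symm y₀ with hx₀
  have hx₀s : x₀ ∈ e.source := e.map_target hy₀
  have hex₀ : e x₀ = y₀ := e.right_inv hy₀
  -- It suffices to exclude a positive value, for `φ` and for `-φ`.
  suffices hmain : ∀ s : ℝ, ¬ 0 < s * φ y₀ by
    have h1 := hmain 1
    have h2 := hmain (-1)
    linarith
  intro s hpos
  -- A neighbourhood of `x₀` in the chart domain on which `s * φ` is positive.
  have hN : {x | x ∈ e.source ∧ 0 < s * φ (e x)} ∈ nhds x₀ := by
    have hc : ContinuousAt (fun x => s * φ (e x)) x₀ := by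
      refine continuousAt_const.mul ?_
      have h1 : ContinuousOn (fun x => φ (e x)) e.source :=
        hφ.comp (continuousOn_extChartAt p) fun x hx => e.map_source hx
      exact h1.continuousAt ((isOpen_extChartAt_source p).mem_nhds hx₀s)
    exact Filter.inter_mem ((isOpen_extChartAt_source p).mem_nhds hx₀s)
      (hc.eventually (lt_mem_nhds (by simpa only [hex₀] using hpos)))
  obtain ⟨ψ, -, hψ⟩ := (SmoothBumpFunction.nhds_basis_tsupport (I := 𝓡∂ 4) x₀).mem_iff.1 hN
  have hsub : tsupport ψ ⊆ (chartAt (EuclideanHalfSpace 4) p).source := fun x hx => by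
    have := (hψ hx).1
    rwa [he, extChartAt_source] at this
  have hint := h ψ hsub
  set K := e '' tsupport ψ with hK
  have hKT : K ⊆ T := by
    rintro _ ⟨x, hx, rfl⟩
    exact e.map_source (hψ hx).1
  have hKc : IsCompact K := ψ.hasCompactSupport.image_of_continuousOn
    ((continuousOn_extChartAt p).mono fun x hx => (hψ hx).1)
  have hψc : ContinuousOn (fun y => ψ (e.symm y)) T :=
    ψ.continuous.comp_continuousOn (continuousOn_extChartAt_symm p)
  have hfc : ContinuousOn (fun y => ψ (e.symm y) * (s * φ y)) T :=
    hψc.mul (continuousOn_const.mul hφ)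
  have hint' : ∫ y in K, ψ (e.symm y) * (s * φ y) = 0 := by
    rw [← mul_zero s, ← hint, ← integral_const_mul]
    exact integral_congr_ae (Filter.Eventually.of_forall fun y => by ring)
  have hnn : ∀ y ∈ K, 0 ≤ ψ (e.symm y) * (s * φ y) := by
    rintro _ ⟨x, hx, rfl⟩
    have h1 := hψ hx
    rw [e.left_inv h1.1]
    exact mul_nonneg ψ.nonneg h1.2.le
  have hae := (setIntegral_eq_zero_iff_of_nonneg_ae
    ((ae_restrict_iff' hKc.measurableSet).2 (Filter.Eventually.of_forall hnn))
    ((hfc.mono hKT).integrableOn_compact hKc)).1 hint'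
  -- The integrand is positive on a relatively open subset, which has positive measure.
  have hf0 : 0 < ψ (e.symm y₀) * (s * φ y₀) := by
    rw [← hx₀, ψ.eq_one]; simpa using hpos
  have hP := hTo.sep_pos hfc
  obtain ⟨O, hO, hPO⟩ := hP.exists_isOpen
  have hPK : {y ∈ T | 0 < ψ (e.symm y) * (s * φ y)} ⊆ K := by
    rintro y ⟨hyT, hy⟩
    refine ⟨e.symm y, subset_tsupport _ ?_, e.right_inv hyT⟩
    rw [Function.mem_support]
    rintro h0
    rw [h0, zero_mul] at hy
    exact lt_irrefl _ hy
  have hnull : volume {y ∈ T | 0 < ψ (e.symm y) * (s * φ y)} = 0 := by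
    rw [Filter.EventuallyEq, ae_restrict_iff' hKc.measurableSet] at hae
    refine measure_mono_null (fun y hy => ?_) hae
    simp only [Set.mem_compl_iff, Set.mem_ofPred_eq, not_forall]
    exact ⟨hPK hy, hy.2.ne'⟩
  -- The interior of the half-space meets every neighbourhood of a point of the half-space.
  have hy₀P : y₀ ∈ {y ∈ T | 0 < ψ (e.symm y) * (s * φ y)} := ⟨hy₀, hf0⟩
  rw [hPO] at hnull hy₀P
  have hcl : y₀ ∈ closure (interior halfSpace) := by
    rw [← (𝓡∂ 4).range_eq_closure_interior]
    exact hy₀P.1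
  obtain ⟨y₁, hy₁O, hy₁⟩ := mem_closure_iff.1 hcl O hO hy₀P.2
  exact absurd (measure_mono_null
    (show O ∩ interior halfSpace ⊆ halfSpace ∩ O from
      fun y hy => ⟨interior_subset hy.2, hy.1⟩) hnull)
    ((hO.inter isOpen_interior).measure_pos volume ⟨y₁, hy₁O, hy₁⟩).ne'

/-! ### The trace of a mixed tensor -/

/-- The trace of endomorphisms of the model space, as a continuous linear form. -/
def traceCLM : (E4 →L[ℝ] E4) →L[ℝ] ℝ :=
  LinearMap.toContinuousLinearMap
    ((LinearMap.trace ℝ E4).comp (ContinuousLinearMap.coeLM ℝ))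

lemma traceCLM_eq_sum (A : E4 →L[ℝ] E4) :
    traceCLM A = ∑ a, A (EuclideanSpace.single a (1 : ℝ)) a := by
  show LinearMap.trace ℝ E4 (A : E4 →ₗ[ℝ] E4) = _
  rw [LinearMap.trace_eq_matrix_trace ℝ (EuclideanSpace.basisFun (Fin 4) ℝ).toBasis, Matrix.trace]
  simp [LinearMap.toMatrix_apply]

/-- The trace does not depend on the frame of the tangent space. -/
lemma traceCLM_conj (p x : M) (hx : x ∈ (tangentTriv p).baseSet)
    (A : TangentSpace (𝓡∂ 4) x →L[ℝ] TangentSpace (𝓡∂ 4) x) :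
    traceCLM (((tangentTriv p).continuousLinearMapAt ℝ x).comp
      (A.comp ((tangentTriv p).symmL ℝ x))) = traceCLM (A : E4 →L[ℝ] E4) := by
  have h1 : ((tangentTriv p).symmL ℝ x).comp ((tangentTriv p).continuousLinearMapAt ℝ x) =
      ContinuousLinearMap.id ℝ _ := by
    ext1 v
    exact (tangentTriv p).symmL_continuousLinearMapAt hx v
  have h2 : ∀ B C : E4 →L[ℝ] E4, traceCLM (B.comp C) = traceCLM (C.comp B) := fun B C =>
    LinearMap.trace_comp_comm' (C : E4 →ₗ[ℝ] E4) (B : E4 →ₗ[ℝ] E4)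
  refine (h2 _ _).trans ?_
  refine congrArg traceCLM ?_
  refine (ContinuousLinearMap.comp_assoc _ _ _).trans ?_
  refine (congrArg (ContinuousLinearMap.comp _) h1).trans ?_
  exact ContinuousLinearMap.comp_id _

/-- The 1-form `¼ Q^a_{ba}`. -/
def traceForm (Q : MixedTensor M) : OneForm M where
  toFun x := (1 / 4 : ℝ) • (traceCLM.comp (Q x : E4 →L[ℝ] E4 →L[ℝ] E4))
  contMDiff_toFun := by
    intro p
    refine ContMDiffOn.contMDiffAt (s := (tangentTriv p).baseSet) ?_
      ((tangentTriv p).open_baseSet.mem_nhds (FiberBundle.mem_baseSet_trivializationAt' p))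
    have h1 := ((trivializationAt (E4 →L[ℝ] E4 →L[ℝ] E4) (fun x : M =>
      TangentSpace (𝓡∂ 4) x →L[ℝ] TangentSpace (𝓡∂ 4) x →L[ℝ] TangentSpace (𝓡∂ 4) x)
      p).contMDiffOn_section_baseSet_iff (IB := 𝓡∂ 4) (n := ∞) (s := Q)).1
      Q.contMDiff.contMDiffOn
    rw [mixedTensor_baseSet] at h1
    rw [← oneForm_baseSet, (trivializationAt (E4 →L[ℝ] ℝ) (fun x : M =>
      TangentSpace (𝓡∂ 4) x →L[ℝ] ℝ) p).contMDiffOn_section_baseSet_iff, oneForm_baseSet]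
    let L : (E4 →L[ℝ] E4 →L[ℝ] E4) →L[ℝ] (E4 →L[ℝ] ℝ) :=
      (1 / 4 : ℝ) • ContinuousLinearMap.compL ℝ E4 (E4 →L[ℝ] E4) ℝ traceCLM
    refine (L.contMDiff.comp_contMDiffOn h1).congr fun x hx => ?_
    ext v
    rw [oneForm_triv]
    refine congrArg (fun r : ℝ => (1 / 4 : ℝ) * r) ?_
    refine (traceCLM_conj p x hx (Q x ((tangentTriv p).symmL ℝ x v))).symm.trans ?_
    refine congrArg traceCLM ?_
    ext1 w
    exact (mixedTensor_triv Q p x hx v w).symm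

lemma formComp_traceForm (Q : MixedTensor M) (p : M) {y : E4}
    (hy : y ∈ (extChartAt (𝓡∂ 4) p).target) (b : Fin 4) :
    formComp (traceForm Q) p y b = (1 / 4) * ∑ a, mixedComp Q p y a b a := by
  have h1 := traceCLM_conj p _ (symm_mem_baseSet hy)
    (Q ((extChartAt (𝓡∂ 4) p).symm y) (coordFrame p y b))
  rw [traceCLM_eq_sum] at h1
  exact congrArg (fun r : ℝ => (1 / 4 : ℝ) * r) h1.symm

end

/-! ### Pointwise consequences of stationarity -/

lemma det_minkowski (n : ℕ) : (minkowski n).det = -1 := by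
  rw [minkowski, Matrix.det_diagonal, Fin.prod_univ_succ]
  simp

lemma minkowski_transpose (n : ℕ) : (minkowski n)ᵀ = minkowski n := Matrix.diagonal_transpose _

lemma IsLorentzian.isSymm {n : ℕ} {A : Matrix (Fin (n + 1)) (Fin (n + 1)) ℝ}
    (h : IsLorentzian A) : A.IsSymm := by
  obtain ⟨P, hP, h⟩ := h
  have h1 : Pᵀ * Aᵀ * P = Pᵀ * A * P := by
    rw [h, ← minkowski_transpose, ← h]
    simp only [Matrix.transpose_mul, Matrix.transpose_transpose, Matrix.mul_assoc]
  have h2 := congrArg (fun B => Pᵀ⁻¹ * B * P⁻¹) h1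
  have hP' : IsUnit Pᵀ.det := by rwa [Matrix.det_transpose]
  have h3 : Aᵀ = A := by
    simpa only [Matrix.mul_assoc, Matrix.mul_nonsing_inv _ hP, Matrix.mul_one,
      ← Matrix.mul_assoc Pᵀ⁻¹, Matrix.nonsing_inv_mul _ hP', Matrix.one_mul] using h2
  exact h3

lemma IsLorentzian.det_neg {n : ℕ} {A : Matrix (Fin (n + 1)) (Fin (n + 1)) ℝ}
    (h : IsLorentzian A) : A.det < 0 := by
  obtain ⟨P, hP, h⟩ := h
  have h1 := congrArg Matrix.det h
  rw [Matrix.det_mul, Matrix.det_mul, Matrix.det_transpose, det_minkowski] at h1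
  by_contra hA
  nlinarith [mul_nonneg (not_lt.1 hA) (mul_self_nonneg P.det)]

/-- The kernel of the polar form: testing on the gradient shows that the gradient vanishes. -/
lemma eq_pureTrace_of_polar_eq_zero {g : Matrix (Fin 4) (Fin 4) ℝ} (hg : g.IsSymm)
    (hdet : g.det ≠ 0) {Q : Fin 4 → Fin 4 → Fin 4 → ℝ}
    (h : ∀ q, quadForm g⁻¹ Q q + quadForm g⁻¹ q Q = 0) :
    Q = pureTrace fun b => ∑ a, Q a a b := by
  have h1 := h (quadGrad g⁻¹ Q)
  rw [quadForm_polar] at h1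
  refine eq_pureTrace_of_quadGrad_eq_zero hg hdet fun x y z => ?_
  have hnn : ∀ x y z, 0 ≤ quadGrad g⁻¹ Q x y z * quadGrad g⁻¹ Q x y z := fun _ _ _ =>
    mul_self_nonneg _
  have h2 := (Finset.sum_eq_zero_iff_of_nonneg fun x _ => Finset.sum_nonneg fun y _ =>
    Finset.sum_nonneg fun z _ => hnn x y z).1 h1 x (Finset.mem_univ _)
  have h3 := (Finset.sum_eq_zero_iff_of_nonneg fun y _ =>
    Finset.sum_nonneg fun z _ => hnn x y z).1 h2 y (Finset.mem_univ _)
  exact mul_self_eq_zero.1 ((Finset.sum_eq_zero_iff_of_nonneg fun z _ => hnn x y z).1 h3 z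
    (Finset.mem_univ _))

/-- A tensor `δ^a_c U_b` is determined by its trace over the first and last index. -/
lemma pureTrace_eq_quarter_trace {Q : Fin 4 → Fin 4 → Fin 4 → ℝ} {U : Fin 4 → ℝ}
    (h : Q = pureTrace U) : Q = pureTrace fun b => (1 / 4) * ∑ a, Q a b a := by
  have : U = fun b => (1 / 4) * ∑ a, Q a b a := by
    funext b
    rw [h]
    simp [pureTrace]
  rw [← this, h]

/-- For the connections `∇ + δ ⊗ U`, vanishing of the torsion, vanishing of the non-metricity and
vanishing of `U` are equivalent at every point. -/
lemma torsion_eq_zero_iff_nonmetricity_eq_zero {T : Set E4} {G : MetricComp} {Q : ConnComp}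
    {y : E4} (hT : IsRelOpen T) (h : IsRegularMetric G T) (hy : y ∈ T) {U : Fin 4 → ℝ}
    (hQ : Q y = pureTrace U) :
    (∀ a b c, torsion (connection G Q) y a b c = 0) ↔
      ∀ a b c, nonmetricity G (connection G Q) y a b c = 0 := by
  have ht : ∀ a b c, torsion (connection G Q) y a b c =
      (if a = c then U b else 0) - if a = b then U c else 0 := by
    intro a b c
    rw [torsion, connection, connection, h.christoffel_symm hT hy a b c, hQ, pureTrace, pureTrace]
    ring
  have hn : ∀ a b c, nonmetricity G (connection G Q) y a b c = -2 * (U a * G y b c) := by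
    intro a b c
    simp only [nonmetricity, connection, h.pd_metric hT hy, add_mul, Finset.sum_add_distrib, hQ,
      pureTrace, ite_mul, zero_mul, Finset.sum_ite_eq', Finset.mem_univ, if_true]
    ring
  have htU : (∀ a b c, torsion (connection G Q) y a b c = 0) ↔ ∀ b, U b = 0 := by
    refine ⟨fun h0 b => ?_, fun h0 a b c => by rw [ht]; simp [h0]⟩
    obtain ⟨c, hc⟩ := exists_ne b
    have := h0 c b c
    rwa [ht, if_pos rfl, if_neg hc, sub_zero] at this
  have hnU : (∀ a b c, nonmetricity G (connection G Q) y a b c = 0) ↔ ∀ b, U b = 0 := by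
    refine ⟨fun h0 a => ?_, fun h0 a b c => by rw [hn, h0]; ring⟩
    by_contra hU
    have hG : G y = 0 := by
      ext b c
      have := h0 a b c
      rw [hn] at this
      simpa [hU] using this
    have := h.det_neg y hy
    rw [hG, Matrix.det_zero] at this
    exact lt_irrefl _ this
  rw [htU, hnU]

section
variable {M : Type*} [TopologicalSpace M] [ChartedSpace (EuclideanHalfSpace 4) M]

lemma IsSpacetimeMetric.isRegularMetric {G : M → MetricComp} (h : IsSpacetimeMetric G) (p : M)
    (hs : MatSmoothOn (G p) (extChartAt (𝓡∂ 4) p).target) :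
    IsRegularMetric (G p) (extChartAt (𝓡∂ 4) p).target :=
  ⟨hs, fun y hy => (h p y hy).1.isSymm, fun y hy => (h p y hy).1.det_neg,
    fun y hy hy0 => ((h p y hy).2 hy0).det_neg⟩

lemma isCompact_image_extChartAt {p : M} {K : Set M} (hK : IsCompact K)
    (hs : K ⊆ (chartAt (EuclideanHalfSpace 4) p).source) :
    IsCompact (extChartAt (𝓡∂ 4) p '' K) :=
  hK.image_of_continuousOn ((continuousOn_extChartAt p).mono fun x hx => by
    rw [extChartAt_source]; exact hs hx)

lemma image_extChartAt_subset_target {p : M} {K : Set M}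
    (hs : K ⊆ (chartAt (EuclideanHalfSpace 4) p).source) :
    extChartAt (𝓡∂ 4) p '' K ⊆ (extChartAt (𝓡∂ 4) p).target := by
  rintro _ ⟨x, hx, rfl⟩
  exact (extChartAt (𝓡∂ 4) p).map_source (by rw [extChartAt_source]; exact hs hx)

lemma symm_notMem_of_mem_diff {p : M} {K : Set M} {y : E4}
    (hy : y ∈ (extChartAt (𝓡∂ 4) p).target \ extChartAt (𝓡∂ 4) p '' K) :
    (extChartAt (𝓡∂ 4) p).symm y ∉ K := fun h =>
  hy.2 ⟨_, h, (extChartAt (𝓡∂ 4) p).right_inv hy.1⟩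

/-- If the Palatini action is stationary under the variations `ψ • r` of `Q` for all bump functions
`ψ` at a point, then the polar form of the quadratic Lagrangian vanishes on `r` at that point. -/
theorem polar_eq_zero_of_stationary [IsManifold (𝓡∂ 4) ∞ M] [T2Space M] {p : M} {G : MetricComp}
    {Q r : ConnComp} (hG : IsRegularMetric G (extChartAt (𝓡∂ 4) p).target)
    (hQ : ConnSmoothOn Q (extChartAt (𝓡∂ 4) p).target)
    (hr : ConnSmoothOn r (extChartAt (𝓡∂ 4) p).target) (Λ : ℝ) {y₀ : E4}
    (hy₀ : y₀ ∈ (extChartAt (𝓡∂ 4) p).target)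
    (h : ∀ ψ : SmoothBumpFunction (𝓡∂ 4) ((extChartAt (𝓡∂ 4) p).symm y₀),
      tsupport ψ ⊆ (chartAt (EuclideanHalfSpace 4) p).source → ∃ q : ConnComp,
      ConnSmoothOn q (extChartAt (𝓡∂ 4) p).target ∧
      (∀ y ∈ (extChartAt (𝓡∂ 4) p).target, q y = ψ ((extChartAt (𝓡∂ 4) p).symm y) • r y) ∧
      HasDerivAt (fun t : ℝ => palatiniAction Λ G (Q + t • q)
        (extChartAt (𝓡∂ 4) p '' tsupport ψ)) 0 0) :
    quadForm (G y₀)⁻¹ (Q y₀) (r y₀) + quadForm (G y₀)⁻¹ (r y₀) (Q y₀) = 0 := by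
  set T := (extChartAt (𝓡∂ 4) p).target with hT
  have hform : ∀ {Q q : ConnComp}, ConnSmoothOn Q T → ConnSmoothOn q T →
      ContinuousOn (fun y => quadForm (G y)⁻¹ (Q y) (q y)) T := fun hQ hq =>
    (ContDiffOn.sum fun b _ => ContDiffOn.sum fun d _ => (hG.inv_smooth b d).mul
      (ContDiffOn.sum fun a _ => ContDiffOn.sum fun l _ =>
        ((hQ a a l).mul (hq l d b)).sub ((hQ a d l).mul (hq l a b)))).continuousOn
  have hz := eq_zero_of_integral_bump p
    (((hform hQ hr).add (hform hr hQ)).mul hG.sqrt_smooth.continuousOn) hy₀ fun ψ hψ => by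
    obtain ⟨q, hq, hqr, hd⟩ := h ψ hψ
    have hK := isCompact_image_extChartAt ψ.hasCompactSupport hψ
    have hKT := image_extChartAt_subset_target hψ
    have hq0 : ∀ t : ℝ, ∀ y ∈ T \ extChartAt (𝓡∂ 4) p '' tsupport ψ,
        (Q + t • q) y = (Q + (0 : ℝ) • q) y := fun t y hy => by
      have h1 : ψ ((extChartAt (𝓡∂ 4) p).symm y) = 0 :=
        image_eq_zero_of_notMem_tsupport (symm_notMem_of_mem_diff hy)
      have h2 : q y = 0 := by rw [hqr y hy.1, h1, zero_smul]
      simp [h2]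
    have h1 := hasDerivAt_palatiniAction_sub (G := fun _ => G) (Q := fun t => Q + t • q)
      (isRelOpen_target p) hK hKT
      (Filter.Eventually.of_forall fun t => ⟨hG, fun a b c =>
        (hQ a b c).add (contDiffOn_const.mul (hq a b c))⟩) (fun _ _ _ => rfl) hq0 Λ _
      (hasDerivAt_integral_quadLagrangian_affine hK (hG.mono hKT) (hQ.mono hKT) (hq.mono hKT))
    have h2 := h1.unique (hd.sub_const _)
    rw [← h2]
    refine MeasureTheory.setIntegral_congr_fun hK.measurableSet fun y hy => ?_
    simp only [hqr y (hKT hy), quadForm_smul_left, quadForm_smul_right, Pi.mul_apply, Pi.add_apply]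
    ring
  exact (mul_eq_zero.1 hz).resolve_right
    (Real.sqrt_pos.2 (abs_pos.2 (hG.det_neg y₀ hy₀).ne)).ne'

end

/-! ### Solutions of the metric Palatini action -/

section
variable {M : Type*} [TopologicalSpace M] [ChartedSpace (EuclideanHalfSpace 4) M]
  [IsManifold (𝓡∂ 4) ∞ M]

lemma covComp_eq_zero {h : CovTensor M} {p : M} {y : E4}
    (h0 : h ((extChartAt (𝓡∂ 4) p).symm y) = 0) : covComp h p y = 0 := by
  ext i j
  show h _ _ _ = 0
  rw [h0]; rfl

lemma mixedComp_eq_zero {q : MixedTensor M} {p : M} {y : E4}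
    (h0 : q ((extChartAt (𝓡∂ 4) p).symm y) = 0) : mixedComp q p y = 0 := by
  funext i j k
  rw [mixedComp, h0]
  show ((tangentTriv p).continuousLinearMapAt ℝ _
    (0 : TangentSpace (𝓡∂ 4) ((extChartAt (𝓡∂ 4) p).symm y))) i = 0
  rw [map_zero]
  rfl

lemma IsMetricVariation.symm {bc : BoundaryCondition} {h : CovTensor M}
    (hh : IsMetricVariation bc h) (x : M) (X Y : TangentSpace (𝓡∂ 4) x) : h x X Y = h x Y X := by
  cases bc
  · exact hh x X Y
  · exact hh.1 x X Y

set_option synthInstance.maxHeartbeats 200000 in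
lemma isMetricVariation_zero (bc : BoundaryCondition) :
    IsMetricVariation bc (0 : CovTensor M) := by
  cases bc
  · exact fun x X Y => rfl
  · exact ⟨fun x X Y => rfl, fun p y _ _ a b => rfl⟩

lemma mixedComp_eq_pureTrace {Q : MixedTensor M} {U : OneForm M}
    (h : ∀ (x : M) (X Y : TangentSpace (𝓡∂ 4) x), Q x X Y = U x X • Y) (p : M) {y : E4}
    (hy : y ∈ (extChartAt (𝓡∂ 4) p).target) : mixedComp Q p y = pureTrace (formComp U p y) := by
  funext a b c
  have h1 : (tangentTriv p).continuousLinearMapAt ℝ ((extChartAt (𝓡∂ 4) p).symm y)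
      (coordFrame p y c) = EuclideanSpace.single c (1 : ℝ) :=
    (tangentTriv p).continuousLinearMapAt_symmL (symm_mem_baseSet hy) _
  rw [mixedComp, h, map_smul, h1, pureTrace]
  simp [formComp]

lemma eq_smul_of_mixedComp {Q : MixedTensor M} {U : OneForm M} {p : M} {y : E4}
    (hy : y ∈ (extChartAt (𝓡∂ 4) p).target) (h : mixedComp Q p y = pureTrace (formComp U p y)) :
    ∀ X Y : TangentSpace (𝓡∂ 4) ((extChartAt (𝓡∂ 4) p).symm y),
      Q ((extChartAt (𝓡∂ 4) p).symm y) X Y = U ((extChartAt (𝓡∂ 4) p).symm y) X • Y := by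
  have hx := symm_mem_baseSet hy
  set x := (extChartAt (𝓡∂ 4) p).symm y with hxy
  set B := ((trivializationAt (E4 →L[ℝ] E4 →L[ℝ] E4) (fun x : M =>
      TangentSpace (𝓡∂ 4) x →L[ℝ] TangentSpace (𝓡∂ 4) x →L[ℝ] TangentSpace (𝓡∂ 4) x) p)
      ⟨x, Q x⟩).2 with hB
  set u := ((trivializationAt (E4 →L[ℝ] ℝ) (fun x : M => TangentSpace (𝓡∂ 4) x →L[ℝ] ℝ) p)
      ⟨x, U x⟩).2 with hu
  have hBu : ∀ b c, B (EuclideanSpace.single b (1 : ℝ)) (EuclideanSpace.single c (1 : ℝ)) =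
      u (EuclideanSpace.single b (1 : ℝ)) • EuclideanSpace.single c (1 : ℝ) := by
    intro b c
    ext a
    rw [hB, hu, mixedTensor_triv _ _ _ hx, oneForm_triv]
    refine (congrFun (congrFun (congrFun h a) b) c).trans ?_
    rw [pureTrace]
    simp [formComp]
    rfl
  have hBu' : B = u.smulRight (ContinuousLinearMap.id ℝ E4) := by
    refine ContinuousLinearMap.coe_injective ((EuclideanSpace.basisFun (Fin 4) ℝ).toBasis.ext
      fun b => ?_)
    refine ContinuousLinearMap.coe_injective ((EuclideanSpace.basisFun (Fin 4) ℝ).toBasis.ext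
      fun c => ?_)
    simpa using hBu b c
  intro X Y
  have hX := (tangentTriv p).symmL_continuousLinearMapAt (R := ℝ) hx X
  have hY := (tangentTriv p).symmL_continuousLinearMapAt (R := ℝ) hx Y
  have h1 := congrArg (fun L : E4 →L[ℝ] E4 →L[ℝ] E4 =>
    L ((tangentTriv p).continuousLinearMapAt ℝ x X) ((tangentTriv p).continuousLinearMapAt ℝ x Y))
    hBu'
  simp only [hB, hu, mixedTensor_triv _ _ _ hx, ContinuousLinearMap.smulRight_apply, oneForm_triv,
    hX, hY, smul_apply, ContinuousLinearMap.id_apply] at h1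
  rw [← map_smul] at h1
  have h2 := congrArg ((tangentTriv p).symmL ℝ x) h1
  rwa [(tangentTriv p).symmL_continuousLinearMapAt hx,
    (tangentTriv p).symmL_continuousLinearMapAt hx] at h2

end

section
variable {M : Type*} [TopologicalSpace M] [ChartedSpace (EuclideanHalfSpace 4) M]
  [IsManifold (𝓡∂ 4) ∞ M] {bc : BoundaryCondition} {Λ : ℝ}

/-- Along a variation of `(g, δ ⊗ U)`, the Palatini and the Einstein-Hilbert action have the same
first variation. -/
lemma hasDerivAt_metric_sub {g h : CovTensor M} {Q q : MixedTensor M} {U : OneForm M}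
    (hg : IsSpacetimeMetric (covComp g)) (hh : IsMetricVariation bc h)
    (hQ : ∀ (x : M) (X Y : TangentSpace (𝓡∂ 4) x), Q x X Y = U x X • Y)
    {p : M} {K : Set M} (hK : IsCompact K) (hKs : K ⊆ (chartAt (EuclideanHalfSpace 4) p).source)
    (hS : {x | h x ≠ 0 ∨ q x ≠ 0} ⊆ K) :
    HasDerivAt (fun t : ℝ => palatiniAction Λ (covComp g p + t • covComp h p)
        (mixedComp Q p + t • mixedComp q p) (extChartAt (𝓡∂ 4) p '' K)
      - einsteinHilbertAction Λ (covComp g p + t • covComp h p) (extChartAt (𝓡∂ 4) p '' K)) 0 0 := by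
  set T := (extChartAt (𝓡∂ 4) p).target with hT
  have hK' := isCompact_image_extChartAt hK hKs
  have hKT := image_extChartAt_subset_target hKs
  have hreg : IsRegularMetric (covComp g p) T := hg.isRegularMetric p (matSmoothOn_covComp g p)
  have hgs := matSmoothOn_covComp g p
  have hhs := matSmoothOn_covComp h p
  have hQs := connSmoothOn_mixedComp Q p
  have hqs := connSmoothOn_mixedComp q p
  have h0 : ∀ y ∈ T \ extChartAt (𝓡∂ 4) p '' K, covComp h p y = 0 ∧ mixedComp q p y = 0 := by
    intro y hy
    have h1 : ¬ (h _ ≠ 0 ∨ q _ ≠ 0) := fun h' => symm_notMem_of_mem_diff hy (hS h')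
    rw [not_or, not_not, not_not] at h1
    exact ⟨covComp_eq_zero h1.1, mixedComp_eq_zero h1.2⟩
  have hL : MatLipAtZero (extChartAt (𝓡∂ 4) p '' K) fun t : ℝ => covComp g p + t • covComp h p :=
    MatLipAtZero.add_smul hK' (fun i j => (hgs i j).continuousOn.mono hKT)
      fun i j => (hhs i j).continuousOn.mono hKT
  have hG0 : covComp g p + (0 : ℝ) • covComp h p = covComp g p := by rw [zero_smul, add_zero]
  have hG : ∀ t : ℝ, ∀ y ∈ T \ extChartAt (𝓡∂ 4) p '' K, (covComp g p + t • covComp h p) y =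
      (covComp g p + (0 : ℝ) • covComp h p) y := fun t y hy => by
    simp [(h0 y hy).1]
  have hev := eventually_isRegularMetric (T := T) hK' hKT
    (G := fun t : ℝ => covComp g p + t • covComp h p)
    (fun t i j => (hgs i j).add (contDiffOn_const.mul (hhs i j)))
    (fun t y hy => by
      refine (hreg.symm y hy).add (Matrix.IsSymm.smul ?_ t)
      ext i j
      exact hh.symm _ _ _)
    hL (by rw [hG0]; exact hreg) hG
  refine hasDerivAt_palatiniAction_sub (isRelOpen_target p) hK' hKT
    (G := fun t : ℝ => covComp g p + t • covComp h p)
    (Q := fun t : ℝ => mixedComp Q p + t • mixedComp q p) ?_ hG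
    (fun t y hy => by simp [(h0 y hy).2]) Λ 0 ?_
  · exact hev.mono fun t ht => ⟨ht, fun a b c =>
      (hQs a b c).add (contDiffOn_const.mul (hqs a b c))⟩
  · refine hasDerivAt_integral_quadLagrangian (D := fun t => t • mixedComp q p) hK' hL
      (by rw [hG0]; exact fun i j => (hgs i j).continuousOn.mono hKT)
      (by rw [hG0]; exact fun y hy => (hreg.det_neg y (hKT hy)).ne) (formComp U p) ?_ ?_
    · intro a b c
      have := (Asymptotics.isBigO_refl (fun x : ℝ × E4 => x.1)
        (unifFilter (extChartAt (𝓡∂ 4) p '' K))).mul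
        (isBigO_one_of_continuousOn hK' ((hqs a b c).continuousOn.mono hKT))
      exact this.congr_right fun x => by simp
    · refine Filter.Eventually.of_forall fun t y hy => ?_
      rw [← mixedComp_eq_pureTrace hQ p (hKT hy)]
      rfl

set_option synthInstance.maxHeartbeats 200000 in
/-- Stationarity under the variations of `Q` alone determines `Q` up to the 1-form
`U = ¼ Q^a_{ba}`. -/
lemma eq_pureTrace_of_mem_solPalatini [T2Space M] {φ : CovTensor M × MixedTensor M}
    (hφ : φ ∈ (solPalatini bc Λ : Set (CovTensor M × MixedTensor M))) (p : M) {y : E4}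
    (hy : y ∈ (extChartAt (𝓡∂ 4) p).target) :
    mixedComp φ.2 p y = pureTrace (formComp (traceForm φ.2) p y) := by
  have hreg := hφ.1.isRegularMetric p (matSmoothOn_covComp φ.1 p)
  have h1 : ∀ c, quadForm (covComp φ.1 p y)⁻¹ (mixedComp φ.2 p y) c +
      quadForm (covComp φ.1 p y)⁻¹ c (mixedComp φ.2 p y) = 0 := by
    intro c
    refine polar_eq_zero_of_stationary (r := fun _ => c) hreg (connSmoothOn_mixedComp φ.2 p)
      (fun _ _ _ => contDiffOn_const) Λ hy fun ψ hψ => ?_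
    obtain ⟨q, hq0, hq⟩ := exists_mixedTensor_mixedComp p ψ.contMDiff hψ c
    refine ⟨mixedComp q p, connSmoothOn_mixedComp q p, hq, ?_⟩
    have h2 := hφ.2 0 q (isMetricVariation_zero bc) p (tsupport ψ) ψ.hasCompactSupport hψ (by
      rintro x (hx | hx)
      · exact absurd rfl hx
      · exact subset_tsupport _ fun h => hx (hq0 x h))
    have h3 : covComp (0 : CovTensor M) p = 0 := funext fun y => covComp_eq_zero rfl
    simpa only [h3, smul_zero, add_zero] using h2
  have h2 := pureTrace_eq_quarter_trace
    (eq_pureTrace_of_polar_eq_zero (hreg.symm y hy) (hreg.det_neg y hy).ne h1)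
  rw [h2]
  congr 1
  funext b
  rw [formComp_traceForm φ.2 p hy]

set_option synthInstance.maxHeartbeats 200000 in
theorem solPalatini_eq [T2Space M] (bc : BoundaryCondition) (Λ : ℝ) :
    (solPalatini bc Λ : Set (CovTensor M × MixedTensor M)) =
      {φ | φ.1 ∈ solEinsteinHilbert bc Λ ∧
        ∃ U : OneForm M, ∀ (x : M) (X Y : TangentSpace (𝓡∂ 4) x), φ.2 x X Y = U x X • Y} := by
  ext ⟨g, Q⟩
  constructor
  · intro hφ
    have hU : ∀ (x : M) (X Y : TangentSpace (𝓡∂ 4) x), Q x X Y = traceForm Q x X • Y := by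
      intro x
      have h1 := mem_extChartAt_target (I := 𝓡∂ 4) x
      have h2 := eq_smul_of_mixedComp h1 (eq_pureTrace_of_mem_solPalatini hφ x h1)
      rwa [extChartAt_to_inv] at h2
    refine ⟨⟨hφ.1, fun h hh p K hK hKs hS => ?_⟩, traceForm Q, hU⟩
    have hS' : {x | h x ≠ 0 ∨ (0 : MixedTensor M) x ≠ 0} ⊆ K := by
      rintro x (hx | hx)
      · exact hS hx
      · exact absurd rfl hx
    have h1 := hφ.2 h 0 hh p K hK hKs hS'
    have h2 := h1.sub (hasDerivAt_metric_sub (Λ := Λ) hφ.1 hh hU hK hKs hS')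
    rw [sub_zero] at h2
    refine h2.congr_of_eventuallyEq (Filter.Eventually.of_forall fun t => ?_)
    exact (sub_sub_cancel _ _).symm
  · rintro ⟨hg, U, hU⟩
    refine ⟨hg.1, fun h q hh p K hK hKs hS => ?_⟩
    have h1 := hg.2 h hh p K hK hKs fun x hx => hS (Or.inl hx)
    have h2 := (hasDerivAt_metric_sub (Λ := Λ) hg.1 hh hU hK hKs hS).add h1
    rw [add_zero] at h2
    refine h2.congr_of_eventuallyEq (Filter.Eventually.of_forall fun t => ?_)
    exact (sub_add_cancel _ _).symm

end

/-! ### Tetrads and spin connections -/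

lemma minkowski_mul_self (n : ℕ) : minkowski n * minkowski n = 1 := by
  rw [minkowski, Matrix.diagonal_mul_diagonal, ← Matrix.diagonal_one]
  congr 1
  funext i
  refine Fin.cases ?_ (fun j => ?_) i <;> simp

lemma det_tetradMetric (e : TetradComp) (y : E4) :
    (tetradMetric e y).det = -((e y).det * (e y).det) := by
  rw [tetradMetric, Matrix.det_mul, Matrix.det_mul, Matrix.det_transpose, det_minkowski]
  ring

lemma tetradMetric_symm (e : TetradComp) (y : E4) : (tetradMetric e y).IsSymm := by
  rw [Matrix.IsSymm, tetradMetric, Matrix.transpose_mul, Matrix.transpose_mul,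
    Matrix.transpose_transpose, minkowski_transpose, Matrix.mul_assoc]

/-- The tensor `E^b_K e^J_a v_m^K_J` of a tetrad `e` and of internal components `v_m^{KL}`. -/
def tetradToMixed (e : Matrix (Fin 4) (Fin 4) ℝ) (v : Fin 4 → Fin 4 → Fin 4 → ℝ) :
    Fin 4 → Fin 4 → Fin 4 → ℝ := fun b m a =>
  ∑ K, ∑ J, e⁻¹ b K * e J a * ∑ L, v K L m * minkowski 3 L J

lemma tetradQ_eq (e : TetradComp) (w : SpinComp) (y : E4) :
    tetradQ e w y = tetradToMixed (e y) (w y - spinLC e y) := rfl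

section
variable {e : Matrix (Fin 4) (Fin 4) ℝ} {v v' : Fin 4 → Fin 4 → Fin 4 → ℝ}

lemma tetradToMixed_add :
    tetradToMixed e (v + v') = tetradToMixed e v + tetradToMixed e v' := by
  funext b m a
  simp only [tetradToMixed, Pi.add_apply, add_mul, mul_add, Finset.sum_add_distrib]

lemma tetradToMixed_smul (t : ℝ) : tetradToMixed e (t • v) = t • tetradToMixed e v := by
  funext b m a
  simp only [tetradToMixed, Pi.smul_apply, smul_eq_mul, Finset.mul_sum]
  refine Finset.sum_congr rfl fun K _ => Finset.sum_congr rfl fun J _ =>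
    Finset.sum_congr rfl fun L _ => ?_
  ring

lemma tetradToMixed_apply (b m a : Fin 4) : tetradToMixed e v b m a =
    (e⁻¹ * ((Matrix.of fun K L => v K L m) * minkowski 3) * e) b a := by
  simp only [tetradToMixed, Matrix.mul_apply, Matrix.of_apply, Finset.sum_mul]
  rw [Finset.sum_comm]
  refine Finset.sum_congr rfl fun J _ => Finset.sum_congr rfl fun K _ => ?_
  ring

lemma exists_tetradToMixed_eq (he : IsUnit e.det) (q : Fin 4 → Fin 4 → Fin 4 → ℝ) :
    ∃ v, tetradToMixed e v = q := by
  refine ⟨fun K L m => (e * (Matrix.of fun b a => q b m a) * e⁻¹ * minkowski 3) K L, ?_⟩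
  funext b m a
  rw [tetradToMixed_apply]
  have h1 : (Matrix.of fun K L => (e * (Matrix.of fun b a => q b m a) * e⁻¹ * minkowski 3) K L) =
      e * (Matrix.of fun b a => q b m a) * e⁻¹ * minkowski 3 := rfl
  rw [h1, Matrix.mul_assoc _ (minkowski 3), minkowski_mul_self, Matrix.mul_one, Matrix.mul_assoc,
    Matrix.mul_assoc, Matrix.nonsing_inv_mul _ he, Matrix.mul_one, ← Matrix.mul_assoc,
    Matrix.nonsing_inv_mul _ he, Matrix.one_mul]
  rfl

lemma tetradToMixed_injective (he : IsUnit e.det) (h : tetradToMixed e v = tetradToMixed e v') :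
    v = v' := by
  have h1 : ∀ m, (Matrix.of fun K L => v K L m) = Matrix.of fun K L => v' K L m := by
    intro m
    have h2 : e⁻¹ * ((Matrix.of fun K L => v K L m) * minkowski 3) * e =
        e⁻¹ * ((Matrix.of fun K L => v' K L m) * minkowski 3) * e := by
      ext b a
      rw [← tetradToMixed_apply, ← tetradToMixed_apply, h]
    have h3 := congrArg (fun A => e * A * e⁻¹ * minkowski 3) h2
    simpa only [Matrix.mul_assoc, Matrix.mul_nonsing_inv_cancel_left _ _ he,
      Matrix.mul_nonsing_inv _ he, Matrix.mul_nonsing_inv_cancel_left _ (minkowski 3) he,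
      minkowski_mul_self, Matrix.mul_one] using h3
  funext K L m
  exact congrFun (congrFun (h1 m) K) L

/-- The internal components `η^{KL} U_m` correspond to the tensor `δ^b_a U_m`. -/
lemma tetradToMixed_minkowski (he : IsUnit e.det) (U : Fin 4 → ℝ) :
    tetradToMixed e (fun K L m => minkowski 3 K L * U m) = pureTrace U := by
  funext b m a
  rw [tetradToMixed_apply]
  have h1 : (Matrix.of fun K L => minkowski 3 K L * U m) = U m • minkowski 3 := by
    ext K L
    simp [mul_comm]
  rw [h1, Matrix.smul_mul, minkowski_mul_self, Matrix.mul_smul, Matrix.mul_one, Matrix.smul_mul,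
    Matrix.nonsing_inv_mul _ he, pureTrace, Matrix.smul_apply, Matrix.one_apply, smul_eq_mul]
  split_ifs <;> simp

end

/-! ### The Levi-Civita spin connection -/

section
variable {T : Set E4} {e e' : TetradComp} {w : SpinComp} {y : E4}

lemma MatSmoothOn.tetradMetric (he : MatSmoothOn e T) : MatSmoothOn (tetradMetric e) T :=
  MatSmoothOn.mul (MatSmoothOn.mul (A := fun y => (e y)ᵀ) (B := fun _ => minkowski 3)
    (fun i j => he j i) fun _ _ => contDiffOn_const) he

lemma IsRegularMetric.det_tetrad_ne_zero (h : IsRegularMetric (Palatini.tetradMetric e) T)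
    (hy : y ∈ T) : (e y).det ≠ 0 := by
  intro h0
  have := h.det_neg y hy
  rw [det_tetradMetric, h0] at this
  simp at this

lemma spinLC_eq (K J m : Fin 4) : spinLC e y K J m =
    (e y * (pdMat m (fun z => (e z)⁻¹) y +
      (Matrix.of fun a b => christoffel (tetradMetric e) y a m b) * (e y)⁻¹) *
        minkowski 3) K J := by
  simp only [spinLC, Matrix.mul_apply, Matrix.add_apply, pdMat, Matrix.of_apply]

lemma christoffel_congr {G G' : MetricComp} (hT : IsRelOpen T) (h : Set.EqOn G G' T) (hy : y ∈ T) :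
    christoffel G y = christoffel G' y := by
  funext a b c
  have h1 : ∀ m i j, pd m (fun z => G z i j) y = pd m (fun z => G' z i j) y := fun m i j =>
    hT.pd_congr (fun z hz => by rw [h hz]) hy m
  simp only [christoffel, h1, h hy]

lemma spinLC_congr (hT : IsRelOpen T) (h : Set.EqOn e e' T) (hy : y ∈ T) :
    spinLC e y = spinLC e' y := by
  funext K J m
  have h1 : ∀ a I, pd m (fun z => (e z)⁻¹ a I) y = pd m (fun z => (e' z)⁻¹ a I) y := fun a I =>
    hT.pd_congr (fun z hz => by simp only [h hz]) hy m
  have h2 : christoffel (tetradMetric e) y = christoffel (tetradMetric e') y :=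
    christoffel_congr hT (fun z hz => by simp only [tetradMetric, h hz]) hy
  simp only [spinLC, h1, h2, h hy]

lemma tetradQ_congr {w' : SpinComp} (hT : IsRelOpen T) (h : Set.EqOn e e' T) (hy : y ∈ T)
    (hw : w y = w' y) : tetradQ e w y = tetradQ e' w' y := by
  rw [tetradQ_eq, tetradQ_eq, spinLC_congr hT h hy, h hy, hw]

variable (hT : IsRelOpen T) (he : MatSmoothOn e T)
include hT he

lemma pdMat_tetradMetric (hy : y ∈ T) (m : Fin 4) : pdMat m (tetradMetric e) y =
    (pdMat m e y)ᵀ * minkowski 3 * e y + (e y)ᵀ * minkowski 3 * pdMat m e y := by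
  have h0 : MatSmoothOn (fun y => (e y)ᵀ) T := fun i j => he j i
  have hη : MatSmoothOn (fun _ => minkowski 3) T := fun _ _ => contDiffOn_const
  have h1 : pdMat m (fun _ => minkowski 3) y = 0 := by
    ext i j
    exact pd_const _ _
  have h2 : pdMat m (fun y => (e y)ᵀ) y = (pdMat m e y)ᵀ := rfl
  refine (pdMat_mul hT hy m (MatSmoothOn.mul h0 hη) he).trans ?_
  rw [pdMat_mul hT hy m h0 hη, h1, h2, Matrix.mul_zero, add_zero]

variable (hg : IsRegularMetric (tetradMetric e) T)
include hg

lemma connSmoothOn_spinLC : ConnSmoothOn (spinLC e) T := fun K _ m =>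
  have hi := he.inv fun _ hy => hg.det_tetrad_ne_zero hy
  ContDiffOn.sum fun I _ => (ContDiffOn.sum fun a _ => (he K a).mul
    ((hT.contDiffOn_pd (hi a I) m).add (ContDiffOn.sum fun b _ =>
      (hg.christoffel_smooth hT a m b).mul (hi b I)))).mul contDiffOn_const

omit hT in
lemma connSmoothOn_tetradToMixed {v : ConnComp} (hv : ConnSmoothOn v T) :
    ConnSmoothOn (fun y => tetradToMixed (e y) (v y)) T := fun b m a =>
  have hi := he.inv fun _ hy => hg.det_tetrad_ne_zero hy
  ContDiffOn.sum fun K _ => ContDiffOn.sum fun J _ => ((hi b K).mul (he J a)).mul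
    (ContDiffOn.sum fun L _ => (hv K L m).mul contDiffOn_const)

lemma connSmoothOn_tetradQ (hw : ConnSmoothOn w T) : ConnSmoothOn (tetradQ e w) T :=
  connSmoothOn_tetradToMixed he hg (v := fun y => w y - spinLC e y) fun a b c =>
    (hw a b c).sub (connSmoothOn_spinLC hT he hg a b c)

/-- The Levi-Civita spin connection is trace-free: `∂ log |det e| = Γ^l_{ml}`. -/
lemma trace_spinLC (hy : y ∈ T) (m : Fin 4) :
    ∑ I, ∑ J, minkowski 3 I J * spinLC e y I J m = 0 := by
  have hu : IsUnit (e y).det := (hg.det_tetrad_ne_zero hy).isUnit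
  have hη : IsUnit (minkowski 3).det := by rw [det_minkowski]; norm_num
  have hut : IsUnit (e y)ᵀ.det := by rwa [Matrix.det_transpose]
  set Γ : Matrix (Fin 4) (Fin 4) ℝ :=
    Matrix.of fun a b => christoffel (tetradMetric e) y a m b with hΓ
  have h1 : ∑ I, ∑ J, minkowski 3 I J * spinLC e y I J m =
      (e y * (pdMat m (fun z => (e z)⁻¹) y + Γ * (e y)⁻¹) * minkowski 3 * minkowski 3).trace := by
    rw [Matrix.trace]
    refine Finset.sum_congr rfl fun I _ => ?_
    rw [Matrix.diag_apply, Matrix.mul_apply]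
    refine Finset.sum_congr rfl fun J _ => ?_
    rw [spinLC_eq, mul_comm, ← minkowski_transpose, Matrix.transpose_apply, minkowski_transpose]
  have h2 := hg.trace_inv_mul_pdMat hT hy m
  have h3 : ((tetradMetric e y)⁻¹ * pdMat m (tetradMetric e) y).trace =
      2 * ((e y)⁻¹ * pdMat m e y).trace := by
    have hinv : (tetradMetric e y)⁻¹ = (e y)⁻¹ * minkowski 3 * (e y)ᵀ⁻¹ := by
      rw [tetradMetric, Matrix.mul_inv_rev, Matrix.mul_inv_rev,
        Matrix.inv_eq_left_inv (minkowski_mul_self 3), Matrix.mul_assoc]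
    have e1 : (tetradMetric e y)⁻¹ * ((e y)ᵀ * minkowski 3 * pdMat m e y) =
        (e y)⁻¹ * pdMat m e y := by
      rw [hinv]
      simp only [Matrix.mul_assoc, Matrix.nonsing_inv_mul_cancel_left _ _ hut]
      rw [← Matrix.mul_assoc (minkowski 3), minkowski_mul_self, Matrix.one_mul]
    have e2 : ((tetradMetric e y)⁻¹ * ((pdMat m e y)ᵀ * minkowski 3 * e y)).trace =
        ((e y)⁻¹ * pdMat m e y).trace := by
      rw [← Matrix.trace_transpose, Matrix.transpose_mul, (hg.inv_symm hy).eq,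
        Matrix.trace_mul_comm, ← e1]
      simp only [Matrix.transpose_mul, Matrix.transpose_transpose, minkowski_transpose,
        Matrix.mul_assoc]
    rw [pdMat_tetradMetric hT he hy, Matrix.mul_add, Matrix.trace_add, e1, e2, two_mul]
  have h4 : Γ.trace = ∑ l, christoffel (tetradMetric e) y l m l := rfl
  rw [h1, Matrix.mul_assoc, minkowski_mul_self, Matrix.mul_one, Matrix.trace_mul_comm,
    pdMat_inv hT hy m he fun y hy => hg.det_tetrad_ne_zero hy, Matrix.add_mul, Matrix.trace_add,
    Matrix.mul_assoc Γ, Matrix.nonsing_inv_mul _ hu, Matrix.mul_one, Matrix.neg_mul,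
    Matrix.mul_assoc _ (e y)⁻¹, Matrix.nonsing_inv_mul _ hu, Matrix.mul_one, Matrix.trace_neg]
  linarith

omit hT he in
/-- The connection of `(e, ω̃)` differs from the Levi-Civita connection by `δ ⊗ U` if and only if
`ω̃ = ω + η U`. -/
lemma tetradQ_eq_pureTrace_iff (hy : y ∈ T) (U : Fin 4 → ℝ) : tetradQ e w y = pureTrace U ↔
    ∀ I J m, w y I J m = spinLC e y I J m + minkowski 3 I J * U m := by
  have hu : IsUnit (e y).det := (hg.det_tetrad_ne_zero hy).isUnit
  rw [tetradQ_eq, ← tetradToMixed_minkowski hu]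
  constructor
  · intro h I J m
    have := congrFun (congrFun (congrFun (tetradToMixed_injective hu h) I) J) m
    exact sub_eq_iff_eq_add'.1 this
  · intro h
    congr 1
    funext I J m
    exact sub_eq_iff_eq_add'.2 (h I J m)

end

/-! ### Variations of a tetrad -/

section
open Filter Asymptotics

variable {T K : Set E4} {e f : TetradComp}

lemma LipAtZero.congr {φ ψ : ℝ → E4 → ℝ} (h : LipAtZero K φ)
    (he : ∀ᶠ t in nhds 0, ∀ y ∈ K, φ t y = ψ t y) : LipAtZero K ψ := by
  have h1 : ∀ᶠ p in unifFilter K, φ p.1 p.2 = ψ p.1 p.2 := eventually_prod_principal_iff.2 he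
  have h0 : ∀ᶠ p in unifFilter K, φ 0 p.2 = ψ 0 p.2 :=
    eventually_prod_principal_iff.2 (Eventually.of_forall fun _ => he.self_of_nhds)
  exact ⟨h.bdd.congr' h1 EventuallyEq.rfl,
    h.lip.congr' (by filter_upwards [h1, h0] with p h1 h0; rw [h1, h0]) EventuallyEq.rfl⟩

lemma MatLipAtZero.add {n m : Type*} {A B : ℝ → E4 → Matrix n m ℝ} (hA : MatLipAtZero K A)
    (hB : MatLipAtZero K B) : MatLipAtZero K fun t y => A t y + B t y :=
  fun i j => (hA i j).add (hB i j)

lemma MatLipAtZero.const {n m : Type*} (A : Matrix n m ℝ) :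
    MatLipAtZero K fun _ _ => A := fun _ _ => LipAtZero.const _

lemma MatLipAtZero.transpose {n m : Type*} {A : ℝ → E4 → Matrix n m ℝ} (hA : MatLipAtZero K A) :
    MatLipAtZero K fun t y => (A t y)ᵀ := fun i j => hA j i

variable (hT : IsRelOpen T) (hK : IsCompact K) (hKT : K ⊆ T) (he : MatSmoothOn e T)
  (hf : MatSmoothOn f T)

section
include he hf

lemma matSmoothOn_add_smul (t : ℝ) : MatSmoothOn (e + t • f) T := fun i j =>
  (he i j).add (contDiffOn_const.mul (hf i j))

include hK hKT

lemma matLipAtZero_add_smul : MatLipAtZero K fun t : ℝ => e + t • f :=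
  MatLipAtZero.add_smul hK (fun i j => (he i j).continuousOn.mono hKT)
    fun i j => (hf i j).continuousOn.mono hKT

lemma matLipAtZero_tetradMetric :
    MatLipAtZero K fun t : ℝ => tetradMetric (e + t • f) :=
  have h := matLipAtZero_add_smul hK hKT he hf
  (h.transpose.mul (MatLipAtZero.const _)).mul h

include hT

lemma matLipAtZero_pdMat (m : Fin 4) : MatLipAtZero K fun t : ℝ => pdMat m (e + t • f) := by
  intro i j
  refine ((LipAtZero.of_continuousOn hK ((hT.contDiffOn_pd (he i j) m).continuousOn.mono hKT)).add
    (LipAtZero.id.mul (LipAtZero.of_continuousOn hK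
      ((hT.contDiffOn_pd (hf i j) m).continuousOn.mono hKT)))).congr ?_
  refine Eventually.of_forall fun t y hy => ?_
  refine Eq.symm ((pd_add hT (hKT hy) m (he i j) (contDiffOn_const.mul (hf i j))).trans ?_)
  rw [pd_const_mul hT (hKT hy) m t (hf i j)]

lemma matLipAtZero_pdMat_tetradMetric (m : Fin 4) :
    MatLipAtZero K fun t : ℝ => pdMat m (tetradMetric (e + t • f)) := by
  have h := matLipAtZero_add_smul hK hKT he hf
  have hp := matLipAtZero_pdMat hT hK hKT he hf m
  intro i j
  refine (((hp.transpose.mul (MatLipAtZero.const (minkowski 3))).mul h).add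
    ((h.transpose.mul (MatLipAtZero.const (minkowski 3))).mul hp) i j).congr ?_
  exact Eventually.of_forall fun t y hy => (congrFun (congrFun
    (pdMat_tetradMetric hT (matSmoothOn_add_smul he hf t) (hKT hy) m) i) j).symm

variable (h0 : IsRegularMetric (tetradMetric e) T)
  (hev : ∀ᶠ t : ℝ in nhds 0, IsRegularMetric (tetradMetric (e + t • f)) T)
include h0

lemma lipAtZero_christoffel_tetradMetric (a b c : Fin 4) :
    LipAtZero K fun t y => christoffel (tetradMetric (e + t • f)) y a b c := by
  have hi := (matLipAtZero_tetradMetric hK hKT he hf).inv hK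
    (fun i j => by simpa using (h0.smooth i j).continuousOn.mono hKT)
    fun y hy => by simpa using (h0.det_neg y (hKT hy)).ne
  have hp := fun m => matLipAtZero_pdMat_tetradMetric hT hK hKT he hf m
  exact (LipAtZero.const _).mul (LipAtZero.sum _ fun d _ => (hi a d).mul
    (((hp b d c).add (hp c d b)).sub (hp d b c)))

omit hT in
lemma matLipAtZero_inv_tetrad : MatLipAtZero K fun t y => ((e + t • f) y)⁻¹ :=
  (matLipAtZero_add_smul hK hKT he hf).inv hK
    (fun i j => by simpa using (he i j).continuousOn.mono hKT)
    fun y hy => by simpa using h0.det_tetrad_ne_zero (hKT hy)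

include hev

lemma lipAtZero_spinLC (I J m : Fin 4) :
    LipAtZero K fun t y => spinLC (e + t • f) y I J m := by
  have h := matLipAtZero_add_smul hK hKT he hf
  have hi := matLipAtZero_inv_tetrad hK hKT he hf h0
  have hp := matLipAtZero_pdMat hT hK hKT he hf m
  have hd : MatLipAtZero K fun t : ℝ => pdMat m (fun z => ((e + t • f) z)⁻¹) := by
    intro a b
    refine (((hi.mul hp).mul hi) a b).neg.congr ?_
    filter_upwards [hev] with t ht y hy
    rw [pdMat_inv hT (hKT hy) m (matSmoothOn_add_smul he hf t)
      fun y hy => ht.det_tetrad_ne_zero hy]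
    rfl
  simp only [spinLC_eq]
  exact ((h.mul (hd.add (MatLipAtZero.mul (fun a b =>
    lipAtZero_christoffel_tetradMetric hT hK hKT he hf h0 a m b) hi))).mul
    (MatLipAtZero.const (minkowski 3))) I J

/-- Along a variation of `(e, ω + η U)`, the tensor `Q` stays of the form `δ ⊗ U` up to `O(t)`, so
that the Palatini and the Einstein-Hilbert action have the same first variation. -/
theorem hasDerivAt_tetrad_sub_of_eqOn {w u : SpinComp} {U : E4 → Fin 4 → ℝ}
    (hw : ConnSmoothOn w T) (hu : ConnSmoothOn u T)
    (hU : ∀ y ∈ T, ∀ I J m, w y I J m = spinLC e y I J m + minkowski 3 I J * U y m)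
    (hf0 : ∀ y ∈ T \ K, f y = 0) (hu0 : ∀ y ∈ T \ K, u y = 0) (Λ : ℝ) :
    HasDerivAt (fun t : ℝ => palatiniAction Λ (tetradMetric (e + t • f))
        (tetradQ (e + t • f) (w + t • u)) K
      - einsteinHilbertAction Λ (tetradMetric (e + t • f)) K) 0 0 := by
  have hE : ∀ t : ℝ, Set.EqOn (e + t • f) (e + (0 : ℝ) • f) (T \ K) := fun t y hy => by
    simp [hf0 y hy]
  have he0 : e + (0 : ℝ) • f = e := by rw [zero_smul, add_zero]
  refine hasDerivAt_palatiniAction_sub hT hK hKT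
    (G := fun t : ℝ => tetradMetric (e + t • f))
    (Q := fun t : ℝ => tetradQ (e + t • f) (w + t • u)) ?_
    (fun t y hy => by simp only [tetradMetric, hE t hy])
    (fun t y hy => tetradQ_congr (hT.diff hK.isClosed) (hE t) hy (by simp [hu0 y hy])) Λ 0 ?_
  · filter_upwards [hev] with t ht
    exact ⟨ht, connSmoothOn_tetradQ hT (matSmoothOn_add_smul he hf t) ht fun a b c =>
      (hw a b c).add (contDiffOn_const.mul (hu a b c))⟩
  · refine hasDerivAt_integral_quadLagrangian
      (D := fun t y => tetradToMixed ((e + t • f) y)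
        (t • u y - (spinLC (e + t • f) y - spinLC (e + (0 : ℝ) • f) y))) hK
      (matLipAtZero_tetradMetric hK hKT he hf)
      (by rw [he0]; exact fun i j => (h0.smooth i j).continuousOn.mono hKT)
      (by rw [he0]; exact fun y hy => (h0.det_neg y (hKT hy)).ne) U ?_ ?_
    · intro b m a
      have h1 := matLipAtZero_add_smul hK hKT he hf
      have h2 := matLipAtZero_inv_tetrad hK hKT he hf h0
      have h3 : ∀ I J, (fun x : ℝ × E4 => (x.1 • u x.2 - (spinLC (e + x.1 • f) x.2
          - spinLC (e + (0 : ℝ) • f) x.2)) I J m) =O[unifFilter K] fun x => x.1 := by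
        intro I J
        have h4 := (isBigO_refl (fun x : ℝ × E4 => x.1) (unifFilter K)).mul
          (isBigO_one_of_continuousOn hK ((hu I J m).continuousOn.mono hKT))
        exact (h4.congr_right fun x => by simp).sub
          (lipAtZero_spinLC hT hK hKT he hf h0 hev I J m).lip
      refine IsBigO.fun_sum fun I _ => IsBigO.fun_sum fun J _ => ?_
      have h5 : (fun x : ℝ × E4 => ∑ L, (x.1 • u x.2 - (spinLC (e + x.1 • f) x.2
          - spinLC (e + (0 : ℝ) • f) x.2)) I L m * minkowski 3 L J) =O[unifFilter K]
            fun x => x.1 :=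
        IsBigO.fun_sum fun L _ => ((h3 I L).mul (isBigO_const_const (minkowski 3 L J)
          (one_ne_zero (α := ℝ)) _)).congr_right fun x => by simp
      exact (((h2 b I).bdd.mul (h1 J a).bdd).mul h5).congr_right fun x => by simp
    · filter_upwards [hev] with t ht y hy
      have hu : IsUnit ((e + t • f) y).det := (ht.det_tetrad_ne_zero (hKT hy)).isUnit
      rw [tetradQ_eq, ← tetradToMixed_minkowski hu, ← tetradToMixed_add]
      congr 1
      funext I J m
      simp only [he0, Pi.sub_apply, Pi.add_apply, Pi.smul_apply, hU y (hKT hy) I J m]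
      ring

end
end

/-! ### Solutions of the tetrad Palatini action -/

section
variable {M : Type*} [TopologicalSpace M] [ChartedSpace (EuclideanHalfSpace 4) M]
  [IsManifold (𝓡∂ 4) ∞ M] {bc : BoundaryCondition} {Λ : ℝ}

lemma formComp_eq_zero {θ : OneForm M} {p : M} {y : E4}
    (h : θ ((extChartAt (𝓡∂ 4) p).symm y) = 0) (i : Fin 4) : formComp θ p y i = 0 := by
  rw [formComp, h]
  rfl

lemma matSmoothOn_tetradComp (e : Fin 4 → OneForm M) (p : M) :
    MatSmoothOn (tetradComp e p) (extChartAt (𝓡∂ 4) p).target := fun I i =>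
  contDiffOn_formComp (e I) p i

lemma connSmoothOn_spinComp (w : Fin 4 → Fin 4 → OneForm M) (p : M) :
    ConnSmoothOn (spinComp w p) (extChartAt (𝓡∂ 4) p).target := fun I J i =>
  contDiffOn_formComp (w I J) p i

/-- The 1-form `¼ η_{IJ} ω^{IJ}`. -/
def spinTrace (w : Fin 4 → Fin 4 → OneForm M) : OneForm M :=
  (1 / 4 : ℝ) • (w 1 1 + w 2 2 + w 3 3 - w 0 0)

lemma formComp_spinTrace (w : Fin 4 → Fin 4 → OneForm M) (p : M) (y : E4) (m : Fin 4) :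
    formComp (spinTrace w) p y m =
      (1 / 4) * ∑ I, ∑ J, minkowski 3 I J * spinComp w p y I J m := by
  have h1 : formComp (spinTrace w) p y m = (1 / 4) * (spinComp w p y 1 1 m + spinComp w p y 2 2 m
      + spinComp w p y 3 3 m - spinComp w p y 0 0 m) := rfl
  have h2 : ∀ I, ∑ J, minkowski 3 I J * spinComp w p y I J m =
      (Fin.cons (-1) (fun _ => 1) : Fin 4 → ℝ) I * spinComp w p y I I m := fun I => by
    simp [minkowski, Matrix.diagonal_apply]
  rw [h1, Finset.sum_congr rfl fun I _ => h2 I, Fin.sum_univ_four,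
    show (Fin.cons (-1) (fun _ => 1) : Fin 4 → ℝ) = ![-1, 1, 1, 1] from by
      funext i; fin_cases i <;> rfl]
  simp
  ring

lemma isTetradVariation_zero (bc : BoundaryCondition) :
    IsTetradVariation bc (0 : Fin 4 → OneForm M) := by
  cases bc
  · exact trivial
  · exact fun p y _ _ I a => rfl

lemma isRegularMetric_tetradMetric {e : Fin 4 → OneForm M}
    (h : IsSpacetimeMetric fun p => tetradMetric (tetradComp e p)) (p : M) :
    IsRegularMetric (tetradMetric (tetradComp e p)) (extChartAt (𝓡∂ 4) p).target :=
  h.isRegularMetric p (matSmoothOn_tetradComp e p).tetradMetric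

/-- Along a variation of `(e, ω + η U)`, the Palatini and the Einstein-Hilbert action have the same
first variation. -/
lemma hasDerivAt_tetrad_sub {e f : Fin 4 → OneForm M} {w u : Fin 4 → Fin 4 → OneForm M}
    {U : OneForm M} (he : IsSpacetimeMetric fun p => tetradMetric (tetradComp e p))
    (hU : ∀ p : M, ∀ y ∈ (extChartAt (𝓡∂ 4) p).target, ∀ I J m : Fin 4, spinComp w p y I J m =
      spinLC (tetradComp e p) y I J m + minkowski 3 I J * formComp U p y m)
    {p : M} {K : Set M} (hK : IsCompact K) (hKs : K ⊆ (chartAt (EuclideanHalfSpace 4) p).source)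
    (hS : {x | ∃ I J, f I x ≠ 0 ∨ u I J x ≠ 0} ⊆ K) :
    HasDerivAt (fun t : ℝ => palatiniAction Λ (tetradMetric (tetradComp e p + t • tetradComp f p))
        (tetradQ (tetradComp e p + t • tetradComp f p) (spinComp w p + t • spinComp u p))
        (extChartAt (𝓡∂ 4) p '' K)
      - einsteinHilbertAction Λ (tetradMetric (tetradComp e p + t • tetradComp f p))
        (extChartAt (𝓡∂ 4) p '' K)) 0 0 := by
  have hK' := isCompact_image_extChartAt hK hKs
  have hKT := image_extChartAt_subset_target hKs
  have hreg := isRegularMetric_tetradMetric he p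
  have hes := matSmoothOn_tetradComp e p
  have hfs := matSmoothOn_tetradComp f p
  have h0 : ∀ y ∈ (extChartAt (𝓡∂ 4) p).target \ extChartAt (𝓡∂ 4) p '' K,
      tetradComp f p y = 0 ∧ spinComp u p y = 0 := by
    intro y hy
    have h1 : ∀ I J, ¬ (f I _ ≠ 0 ∨ u I J _ ≠ 0) := fun I J h' =>
      symm_notMem_of_mem_diff hy (hS ⟨I, J, h'⟩)
    simp only [not_or, not_not] at h1
    exact ⟨Matrix.ext fun I i => formComp_eq_zero (h1 I 0).1 i,
      funext fun I => funext fun J => funext fun i => formComp_eq_zero (h1 I J).2 i⟩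
  refine hasDerivAt_tetrad_sub_of_eqOn (isRelOpen_target p) hK' hKT hes hfs hreg ?_
    (connSmoothOn_spinComp w p) (connSmoothOn_spinComp u p) (hU p) (fun y hy => (h0 y hy).1)
    (fun y hy => (h0 y hy).2) Λ
  refine eventually_isRegularMetric hK' hKT
    (G := fun t : ℝ => tetradMetric (tetradComp e p + t • tetradComp f p))
    (fun t => (matSmoothOn_add_smul hes hfs t).tetradMetric)
    (fun t y hy => tetradMetric_symm _ y) (matLipAtZero_tetradMetric hK' hKT hes hfs)
    (by simpa using hreg) fun t y hy => ?_
  simp [tetradMetric, (h0 y hy).1]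

set_option synthInstance.maxHeartbeats 200000 in
/-- Variations of `ω̃` alone induce all pointwise variations of `Q`, so stationarity has the same
consequence as for the metric action. -/
lemma exists_tetradQ_eq_pureTrace_of_mem_solPalatiniTetrad [T2Space M]
    {φ : (Fin 4 → OneForm M) × (Fin 4 → Fin 4 → OneForm M)}
    (hφ : φ ∈ (solPalatiniTetrad bc Λ : Set ((Fin 4 → OneForm M) × (Fin 4 → Fin 4 → OneForm M))))
    (p : M) {y : E4} (hy : y ∈ (extChartAt (𝓡∂ 4) p).target) :
    ∃ U, tetradQ (tetradComp φ.1 p) (spinComp φ.2 p) y = pureTrace U := by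
  have hreg := isRegularMetric_tetradMetric hφ.1 p
  have hes := matSmoothOn_tetradComp φ.1 p
  refine ⟨_, eq_pureTrace_of_polar_eq_zero (tetradMetric_symm _ y) (hreg.det_neg y hy).ne
    fun r => ?_⟩
  obtain ⟨c, rfl⟩ := exists_tetradToMixed_eq (hreg.det_tetrad_ne_zero hy).isUnit r
  refine polar_eq_zero_of_stationary (r := fun y => tetradToMixed (tetradComp φ.1 p y) c) hreg
    (connSmoothOn_tetradQ (isRelOpen_target p) hes hreg (connSmoothOn_spinComp φ.2 p))
    (connSmoothOn_tetradToMixed hes hreg (v := fun _ => c) fun _ _ _ => contDiffOn_const) Λ hy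
    fun ψ hψ => ?_
  choose u hu0 hu using fun I J => exists_oneForm_formComp p ψ.contMDiff hψ (c I J)
  have hus : ∀ y ∈ (extChartAt (𝓡∂ 4) p).target,
      spinComp u p y = ψ ((extChartAt (𝓡∂ 4) p).symm y) • c := fun y hy =>
    funext fun I => funext fun J => funext fun i => hu I J y hy i
  refine ⟨fun y => tetradToMixed (tetradComp φ.1 p y) (spinComp u p y),
    connSmoothOn_tetradToMixed hes hreg (connSmoothOn_spinComp u p),
    fun y hy => by beta_reduce; rw [hus y hy, tetradToMixed_smul], ?_⟩
  have h2 := hφ.2 0 u (isTetradVariation_zero bc) p (tsupport ψ) ψ.hasCompactSupport hψ (by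
    rintro x ⟨I, J, hx | hx⟩
    · exact absurd rfl hx
    · exact subset_tsupport _ fun h => hx (hu0 I J x h))
  have h3 : tetradComp (0 : Fin 4 → OneForm M) p = 0 :=
    funext fun y => Matrix.ext fun I i => rfl
  have h4 : ∀ t : ℝ, tetradQ (tetradComp φ.1 p) (spinComp φ.2 p + t • spinComp u p) =
      tetradQ (tetradComp φ.1 p) (spinComp φ.2 p) +
        t • fun y => tetradToMixed (tetradComp φ.1 p y) (spinComp u p y) := by
    intro t
    funext y
    rw [Pi.add_apply, Pi.smul_apply, tetradQ_eq, tetradQ_eq, ← tetradToMixed_smul,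
      ← tetradToMixed_add]
    congr 1
    rw [Pi.add_apply, Pi.smul_apply]
    abel
  simpa only [h3, smul_zero, add_zero, h4] using h2

/-- For a solution, `ω̃ = ω + η U` with `U = ¼ η_{IJ} ω̃^{IJ}`, since `ω` is trace-free. -/
lemma spinComp_eq_of_mem_solPalatiniTetrad [T2Space M]
    {φ : (Fin 4 → OneForm M) × (Fin 4 → Fin 4 → OneForm M)}
    (hφ : φ ∈ (solPalatiniTetrad bc Λ : Set ((Fin 4 → OneForm M) × (Fin 4 → Fin 4 → OneForm M))))
    (p : M) {y : E4} (hy : y ∈ (extChartAt (𝓡∂ 4) p).target) (I J m : Fin 4) :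
    spinComp φ.2 p y I J m = spinLC (tetradComp φ.1 p) y I J m +
      minkowski 3 I J * formComp (spinTrace φ.2) p y m := by
  have hreg := isRegularMetric_tetradMetric hφ.1 p
  obtain ⟨U, hU⟩ := exists_tetradQ_eq_pureTrace_of_mem_solPalatiniTetrad hφ p hy
  rw [tetradQ_eq_pureTrace_iff hreg hy] at hU
  have h1 : formComp (spinTrace φ.2) p y m = U m := by
    have h2 : (minkowski 3 * (minkowski 3)ᵀ).trace = 4 := by
      rw [minkowski_transpose, minkowski_mul_self, Matrix.trace_one, Fintype.card_fin]
      norm_num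
    have h3 : ∑ I, ∑ J, minkowski 3 I J * minkowski 3 I J = 4 := h2
    rw [formComp_spinTrace]
    simp only [hU, mul_add, Finset.sum_add_distrib, ← mul_assoc]
    rw [trace_spinLC (isRelOpen_target p) (matSmoothOn_tetradComp φ.1 p) hreg hy]
    simp only [← Finset.sum_mul, h3]
    ring
  rw [h1]
  exact hU I J m

set_option synthInstance.maxHeartbeats 200000 in
theorem solPalatiniTetrad_eq [T2Space M] (bc : BoundaryCondition) (Λ : ℝ) :
    (solPalatiniTetrad bc Λ : Set ((Fin 4 → OneForm M) × (Fin 4 → Fin 4 → OneForm M))) =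
      {φ | φ.1 ∈ solEinsteinHilbertTetrad bc Λ ∧
        ∃ U : OneForm M, ∀ p : M, ∀ y ∈ (extChartAt (𝓡∂ 4) p).target, ∀ I J m : Fin 4,
          spinComp φ.2 p y I J m = spinLC (tetradComp φ.1 p) y I J m +
            minkowski 3 I J * formComp U p y m} := by
  ext ⟨e, w⟩
  constructor
  · intro hφ
    have hU := fun p y hy => spinComp_eq_of_mem_solPalatiniTetrad hφ p (y := y) hy
    refine ⟨⟨hφ.1, fun f hf p K hK hKs hS => ?_⟩, spinTrace w, hU⟩
    have hS' : {x | ∃ I J, f I x ≠ 0 ∨ (0 : Fin 4 → Fin 4 → OneForm M) I J x ≠ 0} ⊆ K := by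
      rintro x ⟨I, J, hx | hx⟩
      · exact hS ⟨I, hx⟩
      · exact absurd rfl hx
    have h2 := (hφ.2 f 0 hf p K hK hKs hS').sub
      (hasDerivAt_tetrad_sub (Λ := Λ) hφ.1 hU hK hKs hS')
    rw [sub_zero] at h2
    refine h2.congr_of_eventuallyEq (Filter.Eventually.of_forall fun t => ?_)
    exact (sub_sub_cancel _ _).symm
  · rintro ⟨he, U, hU⟩
    refine ⟨he.1, fun f u hf p K hK hKs hS => ?_⟩
    have h1 := he.2 f hf p K hK hKs fun x ⟨I, hx⟩ => hS ⟨I, 0, Or.inl hx⟩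
    have h2 := (hasDerivAt_tetrad_sub (Λ := Λ) he.1 hU hK hKs hS).add h1
    rw [add_zero] at h2
    refine h2.congr_of_eventuallyEq (Filter.Eventually.of_forall fun t => ?_)
    exact (sub_add_cancel _ _).symm

end

end Palatini

end

theorem mainTheorem3 (M : Type*) [TopologicalSpace M] [T2Space M] [SecondCountableTopology M]
    [ChartedSpace (EuclideanHalfSpace 4) M] [IsManifold (𝓡∂ 4) ∞ M]
    (bc : Palatini.BoundaryCondition) (Λ : ℝ) :
    (Palatini.solPalatini bc Λ : Set (Palatini.CovTensor M × Palatini.MixedTensor M)) =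
        {φ | φ.1 ∈ Palatini.solEinsteinHilbert bc Λ ∧
          ∃ U : Palatini.OneForm M, ∀ (x : M) (X Y : TangentSpace (𝓡∂ 4) x),
            φ.2 x X Y = U x X • Y} ∧
      (Palatini.solPalatiniTetrad bc Λ :
          Set ((Fin 4 → Palatini.OneForm M) × (Fin 4 → Fin 4 → Palatini.OneForm M))) =
        {φ | φ.1 ∈ Palatini.solEinsteinHilbertTetrad bc Λ ∧
          ∃ U : Palatini.OneForm M, ∀ p : M, ∀ y ∈ (extChartAt (𝓡∂ 4) p).target,
            ∀ I J m : Fin 4, Palatini.spinComp φ.2 p y I J m =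
              Palatini.spinLC (Palatini.tetradComp φ.1 p) y I J m +
                Palatini.minkowski 3 I J * Palatini.formComp U p y m} ∧
      (∀ φ ∈ (Palatini.solPalatini bc Λ : Set (Palatini.CovTensor M × Palatini.MixedTensor M)),
        Palatini.TorsionFreeIffMetric (Palatini.covComp φ.1) (Palatini.mixedComp φ.2)) ∧
      (∀ φ ∈ (Palatini.solPalatiniTetrad bc Λ :
          Set ((Fin 4 → Palatini.OneForm M) × (Fin 4 → Fin 4 → Palatini.OneForm M))),
        Palatini.TorsionFreeIffMetric (fun p => Palatini.tetradMetric (Palatini.tetradComp φ.1 p))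
          (fun p => Palatini.tetradQ (Palatini.tetradComp φ.1 p) (Palatini.spinComp φ.2 p))) := by
  refine ⟨Palatini.solPalatini_eq bc Λ, Palatini.solPalatiniTetrad_eq bc Λ,
    fun φ hφ p y hy => ?_, fun φ hφ p y hy => ?_⟩
  · exact Palatini.torsion_eq_zero_iff_nonmetricity_eq_zero (Palatini.isRelOpen_target p)
      (hφ.1.isRegularMetric p (Palatini.matSmoothOn_covComp φ.1 p)) hy
      (Palatini.eq_pureTrace_of_mem_solPalatini hφ p hy)
  · obtain ⟨U, hU⟩ := Palatini.exists_tetradQ_eq_pureTrace_of_mem_solPalatiniTetrad hφ p hy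
    exact Palatini.torsion_eq_zero_iff_nonmetricity_eq_zero (Palatini.isRelOpen_target p)
      (Palatini.isRegularMetric_tetradMetric hφ.1 p) hy hU
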